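/- Let $(M,g)$ be a globally hyperbolic real analytic spacetime: $M$ is a connected, Hausdorff, paracompact real analytic manifold, $g$ is a real analytic Lorentzian metric of signature $(-,+,\dots,+)$, $(M,g)$ is equipped with a time orientation, and it possesses a smooth spacelike Cauchy hypersurface. Let $P=-\nabla^a\nabla_a+V$ with $V:M\to\mathbb{R}$ real analytic. Let $G=G_{\rm ret}-G_{\rm adv}$ be the difference of the retarded and advanced inverses $C_c^\infty(M)\to C^\infty(M)$ of $P$, let $(u|v)_M=\int_M\overline{u}\,v\,d{\rm vol}_g$, and let $\mathcal{V}=C_c^\infty(M)/PC_c^\infty(M)$ with the hermitian form $\overline{[u]}\cdot Q[v]={\rm i}(u|Gv)_M$. Let ${\rm CCR}(P)$ be the $*$-algebra generated by $1$, $\psi(a)$, $\psi^*(a)=\psi(a)^*$ $(a\in\mathcal{V})$, with $\psi^*$ linear, $\psi$ antilinear, $[\psi(a),\psi(b)]=[\psi^*(a),\psi^*(b)]=0$ and $[\psi(a),\psi^*(b)]=(\overline{a}\cdot Qb)1$. The spacetime covariances of a gauge invariant quasi-free state $\omega$ on ${\rm CCR}(P)$ are the operators $\Lambda^\pm:C_c^\infty(M)\to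 C^\infty(M)$ with $$(u|\Lambda^+v)_M=\omega(\psi([u])\psi^*([v])),\qquad (u|\Lambda^-v)_M=\omega(\psi^*([v])\psi([u])),\qquad u,v\in C_c^\infty(M);$$ their kernels are the distributions on $M\times M$ with $\langle\Lambda^\pm,\overline{u}\otimes v\rangle=(u|\Lambda^\pm v)_M$. Let $\mathcal{N}^\pm\subset T^*M\setminus 0$ be the set of nonzero null covectors $(x,\xi)$ with $\pm\xi\cdot v>0$ for all future directed timelike $v\in T_xM$. The state $\omega$ is called an analytic Hadamard state if $${\rm WF}_{\rm a}(\Lambda^\pm)'\subset\mathcal{N}^\pm\times\mathcal{N}^\pm,$$ where ${\rm WF}_{\rm a}$ is the analytic wave front set and $\Gamma'=\{((x_1,\xi_1),(x_2,\xi_2)):((x_1,\xi_1),(x_2,-\xi_2))\in\Gamma\}$. If $\omega$ and $\tilde\omega$ are two analytic Hadamard states on ${\rm CCR}(P)$, with spacetime covariances $\Lambda^\pm$ and $\tilde\Lambda^\pm$, then $\Lambda^\pm-\tilde\Lambda^\pm$ have real analytic kernels: there are real analytic functions $k^\pm:M\times M\to\mathbb{C}$ such that, for all $v\in C_c^\infty(M)$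 and $x\in M$, $$\big((\Lambda^\pm-\tilde\Lambda^\pm)v\big)(x)=\int_M k^\pm(x,y)\,v(y)\,d{\rm vol}_g(y).$$ -/

import Mathlib

open scoped Manifold ContDiff Distributions Topology ComplexConjugate
open TopologicalSpace MeasureTheory Set Filter

noncomputable section

/-! ## The CCR `*`-algebra of a phase space and its gauge invariant quasi-free states -/

namespace CCR

/-- Generators: `Sum.inl v` stands for `ψ(v)` and `Sum.inr v` for `ψ*(v)`. -/
abbrev Free (V : Type*) := FreeAlgebra ℂ (V ⊕ V)

/-- The antilinear anti-homomorphism of the free algebra which exchanges `ψ(v)` and `ψ*(v)`,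
written as a ring homomorphism into the opposite ring. -/
def adjHom (V : Type*) : Free V →+* (Free V)ᵐᵒᵖ :=
  letI : Algebra ℂ (Free V)ᵐᵒᵖ :=
    ((algebraMap ℂ (Free V)ᵐᵒᵖ).comp (starRingEnd ℂ)).toAlgebra'
      (fun c x => Algebra.commutes (starRingEnd ℂ c) x)
  (FreeAlgebra.lift ℂ (fun x : V ⊕ V => MulOpposite.op (FreeAlgebra.ι ℂ x.swap))).toRingHom

/-- The adjoint on the free `*`-algebra. -/
def adj {V : Type*} (a : Free V) : Free V := (adjHom V a).unop

theorem adjHom_ι {V : Type*} (x : V ⊕ V) :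
    adjHom V (FreeAlgebra.ι ℂ x) = MulOpposite.op (FreeAlgebra.ι ℂ x.swap) := by
  let : Algebra ℂ (Free V)ᵐᵒᵖ :=
    ((algebraMap ℂ (Free V)ᵐᵒᵖ).comp (starRingEnd ℂ)).toAlgebra'
      (fun c x => Algebra.commutes (starRingEnd ℂ c) x)
  exact FreeAlgebra.lift_ι_apply (R := ℂ)
    (fun x : V ⊕ V => MulOpposite.op (FreeAlgebra.ι ℂ x.swap)) x

theorem adjHom_algebraMap {V : Type*} (c : ℂ) :
    adjHom V (algebraMap ℂ (Free V) c) = MulOpposite.op (algebraMap ℂ (Free V) (conj c)) := by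
  let : Algebra ℂ (Free V)ᵐᵒᵖ :=
    ((algebraMap ℂ (Free V)ᵐᵒᵖ).comp (starRingEnd ℂ)).toAlgebra'
      (fun c x => Algebra.commutes (starRingEnd ℂ c) x)
  exact AlgHom.commutes (FreeAlgebra.lift ℂ
    (fun x : V ⊕ V => MulOpposite.op (FreeAlgebra.ι ℂ x.swap))) c

theorem adj_adj {V : Type*} (a : Free V) : adj (adj a) = a := by
  induction a using FreeAlgebra.induction with
  | grade0 c => simp [adj, adjHom_algebraMap]
  | grade1 x => simp [adj, adjHom_ι]
  | mul a b ha hb => simp only [adj, map_mul, MulOpposite.unop_mul] at *; rw [ha, hb]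
  | add a b ha hb => simp only [adj, map_add, MulOpposite.unop_add] at *; rw [ha, hb]

variable {V : Type*} [AddCommGroup V] [Module ℂ V]

/-- The defining relations of `CCR(V, q)`, where `q v w` is the value `v̄ · q w` of the form, and
their adjoints. -/
inductive Rel (q : V → V → ℂ) : Free V → Free V → Prop
  | psi (v w : V) (c : ℂ) : Rel q (FreeAlgebra.ι ℂ (Sum.inl (v + c • w)))
      (FreeAlgebra.ι ℂ (Sum.inl v) + conj c • FreeAlgebra.ι ℂ (Sum.inl w))
  | psiStar (v w : V) (c : ℂ) : Rel q (FreeAlgebra.ι ℂ (Sum.inr (v + c • w)))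
      (FreeAlgebra.ι ℂ (Sum.inr v) + c • FreeAlgebra.ι ℂ (Sum.inr w))
  | comm_psi (v w : V) : Rel q
      (FreeAlgebra.ι ℂ (Sum.inl v) * FreeAlgebra.ι ℂ (Sum.inl w)
        - FreeAlgebra.ι ℂ (Sum.inl w) * FreeAlgebra.ι ℂ (Sum.inl v)) 0
  | comm_psiStar (v w : V) : Rel q
      (FreeAlgebra.ι ℂ (Sum.inr v) * FreeAlgebra.ι ℂ (Sum.inr w)
        - FreeAlgebra.ι ℂ (Sum.inr w) * FreeAlgebra.ι ℂ (Sum.inr v)) 0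
  | comm_psi_psiStar (v w : V) : Rel q
      (FreeAlgebra.ι ℂ (Sum.inl v) * FreeAlgebra.ι ℂ (Sum.inr w)
        - FreeAlgebra.ι ℂ (Sum.inr w) * FreeAlgebra.ι ℂ (Sum.inl v))
      (algebraMap ℂ (Free V) (q v w))
  | adjoint {a b : Free V} : Rel q a b → Rel q (adj a) (adj b)

/-- The algebra `CCR(V, q)`. -/
abbrev Alg (q : V → V → ℂ) := RingQuot (Rel q)

/-- The field `ψ(v)`. -/
def psi (q : V → V → ℂ) (v : V) : Alg q :=
  RingQuot.mkAlgHom ℂ (Rel q) (FreeAlgebra.ι ℂ (Sum.inl v))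

/-- The field `ψ*(v)`. -/
def psiStar (q : V → V → ℂ) (v : V) : Alg q :=
  RingQuot.mkAlgHom ℂ (Rel q) (FreeAlgebra.ι ℂ (Sum.inr v))

/-- The adjoint of `CCR(V, q)`, as a ring homomorphism into the opposite ring. -/
def starHom (q : V → V → ℂ) : Alg q →+* (Alg q)ᵐᵒᵖ :=
  RingQuot.lift ⟨(RingHom.op (RingQuot.mkRingHom (Rel q))).comp (adjHom V), by
    intro a b h
    exact congrArg MulOpposite.op (RingQuot.mkRingHom_rel (Rel.adjoint h))⟩

theorem starHom_mk (q : V → V → ℂ) (a : Free V) :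
    starHom q (RingQuot.mkRingHom (Rel q) a)
      = MulOpposite.op (RingQuot.mkRingHom (Rel q) (adj a)) :=
  RingQuot.lift_mkRingHom_apply _ _ _

/-- The `*`-ring structure of `CCR(V, q)`: antilinear, with `ψ(v)* = ψ*(v)`. -/
instance instStarRing (q : V → V → ℂ) : StarRing (Alg q) where
  star a := (starHom q a).unop
  star_involutive a := by
    obtain ⟨a, rfl⟩ := RingQuot.mkRingHom_surjective (Rel q) a
    simp [starHom_mk, adj_adj]
  star_mul a b := by simp
  star_add a b := by simp

theorem star_psi (q : V → V → ℂ) (v : V) : star (psi q v) = psiStar q v := by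
  show (starHom q (psi q v)).unop = _
  rw [psi, psiStar, ← RingHom.coe_coe (RingQuot.mkAlgHom ℂ (Rel q)), RingQuot.mkAlgHom_coe,
    starHom_mk]
  simp [adj, adjHom_ι]

theorem star_smul (q : V → V → ℂ) (c : ℂ) (a : Alg q) : star (c • a) = conj c • star a := by
  obtain ⟨a, rfl⟩ := RingQuot.mkAlgHom_surjective ℂ (Rel q) a
  rw [← map_smul, ← RingHom.coe_coe (RingQuot.mkAlgHom ℂ (Rel q)), RingQuot.mkAlgHom_coe]
  show (starHom q _).unop = conj c • (starHom q _).unop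
  rw [starHom_mk, starHom_mk, ← RingQuot.mkAlgHom_coe ℂ (Rel q)]
  simp only [RingHom.coe_coe, MulOpposite.unop_op]
  rw [← map_smul]
  congr 1
  simp [adj, Algebra.smul_def, adjHom_algebraMap, Algebra.commutes]

/-- A state: a normalised positive linear functional. -/
structure IsState {q : V → V → ℂ} (s : Alg q →ₗ[ℂ] ℂ) : Prop where
  map_one : s 1 = 1
  nonneg : ∀ a : Alg q, 0 ≤ (s (star a * a)).re ∧ (s (star a * a)).im = 0

/-- A gauge invariant quasi-free state. -/
structure IsQuasiFree {q : V → V → ℂ} (s : Alg q →ₗ[ℂ] ℂ) : Prop extends IsState s where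
  eq_zero : ∀ (k l : ℕ) (v : Fin k → V) (w : Fin l → V), k ≠ l →
    s ((List.ofFn fun i => psiStar q (v i)).prod * (List.ofFn fun j => psi q (w j)).prod) = 0
  wick : ∀ (k : ℕ) (v w : Fin k → V),
    s ((List.ofFn fun i => psiStar q (v i)).prod * (List.ofFn fun j => psi q (w j)).prod)
      = ∑ σ : Equiv.Perm (Fin k), ∏ i, s (psiStar q (v i) * psi q (w (σ i)))

end CCR

/-! ## Test functions and distributions on manifolds -/

section Manifold

variable {W : Type*} [NormedAddCommGroup W] [NormedSpace ℝ W]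
  {H : Type*} [TopologicalSpace H] (I : ModelWithCorners ℝ W H)
  (N : Type*) [TopologicalSpace N] [ChartedSpace H N]

theorem contMDiff_const_smul_complex {f : N → ℂ} (c : ℂ) (hf : ContMDiff I 𝓘(ℝ, ℂ) ∞ f) :
    ContMDiff I 𝓘(ℝ, ℂ) ∞ (c • f) :=
  ((c • ContinuousLinearMap.id ℝ ℂ).contMDiff (n := ∞)).comp hf

/-- `C^∞(N)`, complex valued. -/
def SmoothFn : Submodule ℂ (N → ℂ) where
  carrier := {f | ContMDiff I 𝓘(ℝ, ℂ) ∞ f}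
  add_mem' hf hg := ContMDiff.add hf hg
  zero_mem' := contMDiff_const
  smul_mem' c _ hf := contMDiff_const_smul_complex I N c hf

/-- `C_c^∞(N)`, complex valued. -/
def TestFn : Submodule ℂ (N → ℂ) where
  carrier := {f | ContMDiff I 𝓘(ℝ, ℂ) ∞ f ∧ HasCompactSupport f}
  add_mem' hf hg := ⟨hf.1.add hg.1, hf.2.add hg.2⟩
  zero_mem' := ⟨contMDiff_const, HasCompactSupport.zero⟩
  smul_mem' c _ hf := ⟨contMDiff_const_smul_complex I N c hf.1, hf.2.smul_left (f := fun _ => c)⟩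

variable {I N}

instance : CoeFun (SmoothFn I N) (fun _ => N → ℂ) := ⟨Subtype.val⟩
instance : CoeFun (TestFn I N) (fun _ => N → ℂ) := ⟨Subtype.val⟩

variable [I.Boundaryless]

variable (I) in
/-- The image of the chart at `x`, an open subset of the model space. -/
def chartDomain (x : N) : Opens W := ⟨(extChartAt I x).target, isOpen_extChartAt_target x⟩

variable [T2Space N] [IsManifold I ω N]

open scoped Classical in
variable (I) in
/-- A test function on the image of the chart at `x`, viewed as a test function on the manifold
(extended by zero). -/
def ofChart (x : N) (φ : 𝓓(chartDomain I x, ℝ)) : TestFn I N :=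
  ⟨fun p => if p ∈ (extChartAt I x).source then ((φ (extChartAt I x p) : ℝ) : ℂ) else 0, by
    set K : Set N := (extChartAt I x).symm '' tsupport φ with hK
    have hKc : IsCompact K := φ.hasCompactSupport.image_of_continuousOn
      ((continuousOn_extChartAt_symm x).mono φ.tsupport_subset)
    have hKs : K ⊆ (extChartAt I x).source := by
      rintro _ ⟨y, hy, rfl⟩
      exact (extChartAt I x).map_target (φ.tsupport_subset hy)
    have h0 : ∀ p ∉ K, (if p ∈ (extChartAt I x).source then
        ((φ (extChartAt I x p) : ℝ) : ℂ) else 0) = 0 := by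
      intro p hp
      split_ifs with h
      · have : extChartAt I x p ∉ tsupport φ := fun h' =>
          hp ⟨_, h', (extChartAt I x).left_inv h⟩
        rw [image_eq_zero_of_notMem_tsupport this, Complex.ofReal_zero]
      · rfl
    refine ⟨fun p => ?_, HasCompactSupport.intro hKc h0⟩
    by_cases hp : p ∈ (extChartAt I x).source
    · have hs : (extChartAt I x).source ∈ 𝓝 p := (isOpen_extChartAt_source x).mem_nhds hp
      have h1 : ContMDiffAt I 𝓘(ℝ, W) ∞ (extChartAt I x) p :=
        contMDiffAt_extChartAt' (by rwa [extChartAt_source] at hp)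
      have h2 : ContMDiff 𝓘(ℝ, W) 𝓘(ℝ, ℂ) ∞ (fun y : W => ((φ y : ℝ) : ℂ)) :=
        (Complex.ofRealCLM.contDiff.comp φ.contDiff).contMDiff
      refine (h2.contMDiffAt.comp p h1).congr_of_eventuallyEq ?_
      filter_upwards [hs] with q hq
      exact if_pos hq
    · have hs : Kᶜ ∈ 𝓝 p := hKc.isClosed.isOpen_compl.mem_nhds (fun h => hp (hKs h))
      refine (contMDiffAt_const (c := (0 : ℂ))).congr_of_eventuallyEq ?_
      filter_upwards [hs] with q hq
      exact h0 q hq⟩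

theorem ofChart_of_mem {x p : N} (φ : 𝓓(chartDomain I x, ℝ))
    (h : p ∈ (extChartAt I x).source) : ofChart I x φ p = ((φ (extChartAt I x p) : ℝ) : ℂ) :=
  if_pos h

theorem ofChart_of_notMem {x p : N} (φ : 𝓓(chartDomain I x, ℝ))
    (h : p ∉ (extChartAt I x).source) : ofChart I x φ p = 0 :=
  if_neg h

theorem ofChart_add (x : N) (φ ψ : 𝓓(chartDomain I x, ℝ)) :
    ofChart I x (φ + ψ) = ofChart I x φ + ofChart I x ψ := by
  apply Subtype.ext
  funext p
  by_cases h : p ∈ (extChartAt I x).source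
  · exact (ofChart_of_mem _ h).trans ((Complex.ofReal_add _ _).trans
      (congrArg₂ (· + ·) (ofChart_of_mem φ h).symm (ofChart_of_mem ψ h).symm))
  · exact (ofChart_of_notMem _ h).trans ((add_zero (0 : ℂ)).symm.trans
      (congrArg₂ (· + ·) (ofChart_of_notMem φ h).symm (ofChart_of_notMem ψ h).symm))

theorem ofChart_smul (x : N) (c : ℝ) (φ : 𝓓(chartDomain I x, ℝ)) :
    ofChart I x (c • φ) = (c : ℂ) • ofChart I x φ := by
  apply Subtype.ext
  funext p
  by_cases h : p ∈ (extChartAt I x).source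
  · exact (ofChart_of_mem _ h).trans ((Complex.ofReal_mul _ _).trans
      (congrArg ((c : ℂ) * ·) (ofChart_of_mem φ h).symm))
  · exact (ofChart_of_notMem _ h).trans ((mul_zero (c : ℂ)).symm.trans
      (congrArg ((c : ℂ) * ·) (ofChart_of_notMem φ h).symm))

variable (I N) in
/-- `𝒟'(N)`: linear forms on `C_c^∞(N)` which are distributions in the charts. -/
structure ManifoldDistribution where
  toLin : TestFn I N →ₗ[ℂ] ℂ
  cont : ∀ x : N, Continuous fun φ : 𝓓(chartDomain I x, ℝ) => toLin (ofChart I x φ)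

/-- The coordinate expression of a distribution in the chart at `x`. -/
def ManifoldDistribution.inChart (T : ManifoldDistribution I N) (x : N) :
    𝓓'(chartDomain I x, ℂ) where
  toFun φ := T.toLin (ofChart I x φ)
  map_add' φ ψ := by rw [ofChart_add, map_add]
  map_smul' c φ := by
    rw [ofChart_smul, map_smul]
    rfl
  cont := T.cont x

end Manifold

/-! ## Boundary values of holomorphic functions and the analytic wave front set

The complexification of a real vector space `W` is `W × W`, with `(x, y)` standing for `x + iy`. -/

section Microlocal

variable {W : Type*} [NormedAddCommGroup W] [NormedSpace ℝ W]

/-- `F` is holomorphic on the open set `D`: real differentiable with complex linear differential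
(multiplication by `i` on `W × W` being `(a, b) ↦ (-b, a)`). -/
def IsHolomorphicOn (F : W × W → ℂ) (D : Set (W × W)) : Prop :=
  IsOpen D ∧ DifferentiableOn ℝ F D ∧
    ∀ p ∈ D, ∀ a b : W, fderiv ℝ F p (-b, a) = Complex.I * fderiv ℝ F p (a, b)

/-- Convex open cones; "proper" means that the closure contains no line. -/
structure IsConvexOpenCone (Γ : Set W) : Prop where
  isOpen : IsOpen Γ
  nonempty : Γ.Nonempty
  convex : Convex ℝ Γ
  smul_mem : ∀ c : ℝ, 0 < c → ∀ y ∈ Γ, c • y ∈ Γ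
  proper : ∀ y ∈ closure Γ, -y ∈ closure Γ → y = 0

/-- `Γ' ⋐ Γ` for cones: `Γ' ∩ 𝕊` is relatively compact in `Γ ∩ 𝕊`. -/
structure IsRelCompactSubcone (Γ' Γ : Set W) : Prop where
  subset : Γ' ⊆ Γ
  smul_mem : ∀ c : ℝ, 0 < c → ∀ y ∈ Γ', c • y ∈ Γ'
  closure_subset : closure (Γ' ∩ Metric.sphere 0 1) ⊆ Γ

/-- The polar cone `Γ°`. -/
def polarCone (Γ : Set W) : Set (W →L[ℝ] ℝ) := {ξ | ∀ y ∈ Γ, 0 ≤ ξ y}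

/-- `D` is a tuboid of profile `Ω + iΓ`. -/
structure IsTuboid (D : Set (W × W)) (Ω : Opens W) (Γ : Set W) : Prop where
  isOpen : IsOpen D
  subset : D ⊆ (Ω : Set W) ×ˢ Γ
  exists_mem : ∀ x₀ ∈ Ω, ∀ Γ' : Set W, IsRelCompactSubcone Γ' Γ →
    ∃ Ω' : Opens W, Ω' ≤ Ω ∧ x₀ ∈ Ω' ∧ ∃ r : ℝ, 0 < r ∧
      ∀ x ∈ Ω', ∀ y ∈ Γ', 0 < ‖y‖ → ‖y‖ ≤ r → (x, y) ∈ D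

/-- Temperate growth near the real points of `Ω` in the directions of `Γ`. -/
def IsTemperate (F : W × W → ℂ) (Ω : Opens W) (Γ : Set W) : Prop :=
  ∀ K : Set W, IsCompact K → K ⊆ Ω → ∀ Γ' : Set W, IsRelCompactSubcone Γ' Γ →
    ∃ (C r : ℝ) (m : ℕ), 0 < r ∧
      ∀ x ∈ K, ∀ y ∈ Γ', 0 < ‖y‖ → ‖y‖ ≤ r → ‖F (x, y)‖ ≤ C * (‖y‖ ^ m)⁻¹

variable [MeasureSpace W]

/-- `f = F(x + iΓ0)`: the distribution `f` on `Ω` is the limit of `F(· + iy)` as `y → 0` within any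
cone `Γ' ⋐ Γ`. -/
def HasBoundaryValue (F : W × W → ℂ) (Ω : Opens W) (Γ : Set W) (f : 𝓓'(Ω, ℂ)) : Prop :=
  ∀ Γ' : Set W, IsRelCompactSubcone Γ' Γ → ∀ φ : 𝓓(Ω, ℝ),
    Tendsto (fun y : W => ∫ x, F (x, y) * ((φ x : ℝ) : ℂ)) (𝓝[Γ'] 0) (𝓝 (f φ))

/-- `F`, defined on `D`, extends holomorphically to a complex neighbourhood of `x₀`. -/
def IsHolomorphicNear (F : W × W → ℂ) (D : Set (W × W)) (x₀ : W) : Prop :=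
  ∃ (U : Set (W × W)) (G : W × W → ℂ), (x₀, 0) ∈ U ∧ IsHolomorphicOn G U ∧ EqOn G F (U ∩ D)

/-- `(x₀, ξ₀) ∉ WF_a(u)`: near `x₀`, `u` is a finite sum of boundary values `F_j(x + iΓ_j0)`, with
`F_j` holomorphic near `x₀` whenever `ξ₀ ∈ Γ_j°`. -/
def IsMicroAnalyticAt {Ω : Opens W} (u : 𝓓'(Ω, ℂ)) (x₀ : W) (ξ₀ : W →L[ℝ] ℝ) : Prop :=
  ∃ Ω' : Opens W, Ω' ≤ Ω ∧ x₀ ∈ Ω' ∧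
    ∃ (m : ℕ) (Γ : Fin m → Set W) (D : Fin m → Set (W × W)) (F : Fin m → W × W → ℂ)
      (f : Fin m → 𝓓'(Ω', ℂ)),
      (∀ j, IsConvexOpenCone (Γ j) ∧ IsTuboid (D j) Ω' (Γ j) ∧ IsHolomorphicOn (F j) (D j) ∧
        IsTemperate (F j) Ω' (Γ j) ∧ HasBoundaryValue (F j) Ω' (Γ j) (f j) ∧
        (ξ₀ ∈ polarCone (Γ j) → IsHolomorphicNear (F j) (D j) x₀)) ∧
      ∀ φ : 𝓓(Ω', ℝ), u (TestFunction.monoCLM ℝ φ) = ∑ j, f j φ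

end Microlocal

section WaveFront

variable {W : Type*} [NormedAddCommGroup W] [NormedSpace ℝ W]
  {H : Type*} [TopologicalSpace H] (I : ModelWithCorners ℝ W H)
  (N : Type*) [TopologicalSpace N] [ChartedSpace H N]

/-- The cotangent bundle `T*N`, as a set. -/
abbrev Cotangent := Σ x : N, (TangentSpace I x →L[ℝ] ℝ)

variable {I N} [MeasureSpace W] [I.Boundaryless] [T2Space N] [IsManifold I ω N]

/-- The analytic wave front set of a distribution on an analytic manifold: `(x, ξ)` with `ξ ≠ 0`
such that in the chart `e` at `x` the covector `(e(x), ξ ∘ d(e⁻¹))` belongs to the analytic wave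
front set of the coordinate expression. -/
def ManifoldDistribution.WFa (T : ManifoldDistribution I N) : Set (Cotangent I N) :=
  {X | X.2 ≠ 0 ∧ ¬ IsMicroAnalyticAt (T.inChart X.1) (extChartAt I X.1 X.1)
    (X.2 ∘L mfderiv 𝓘(ℝ, W) I (extChartAt I X.1).symm (extChartAt I X.1 X.1))}

/-- `Γ' = {((x₁, ξ₁), (x₂, ξ₂)) : ((x₁, ξ₁), (x₂, -ξ₂)) ∈ Γ}` for `Γ ⊆ T*(N × N)`, under the
identification `T*(N × N) = T*N × T*N`. -/
def primed (Γ : Set (Cotangent (I.prod I) (N × N))) : Set (Cotangent I N × Cotangent I N) :=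
  {X | (⟨(X.1.1, X.2.1),
      X.1.2 ∘L mfderiv (I.prod I) I Prod.fst (X.1.1, X.2.1)
        - X.2.2 ∘L mfderiv (I.prod I) I Prod.snd (X.1.1, X.2.1)⟩ :
      Cotangent (I.prod I) (N × N)) ∈ Γ}

end WaveFront

/-! ## Lorentzian geometry -/

section Lorentz

/-- The model space `ℝⁿ`. -/
abbrev Eucl (n : ℕ) := EuclideanSpace ℝ (Fin n)

variable (n : ℕ) (M : Type*) [TopologicalSpace M] [ChartedSpace (Eucl n) M]
  [IsManifold 𝓘(ℝ, Eucl n) ω M]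

/-- A real analytic Lorentzian metric, of signature `(-, +, …, +)`. -/
structure LorentzMetric where
  form : ∀ x : M, TangentSpace 𝓘(ℝ, Eucl n) x →L[ℝ] TangentSpace 𝓘(ℝ, Eucl n) x →L[ℝ] ℝ
  symm : ∀ (x : M) (v w : TangentSpace 𝓘(ℝ, Eucl n) x), form x v w = form x w v
  signature : ∀ x : M, ∃ v : TangentSpace 𝓘(ℝ, Eucl n) x, form x v v < 0 ∧
    ∀ w : TangentSpace 𝓘(ℝ, Eucl n) x, form x v w = 0 → w ≠ 0 → 0 < form x w w
  contMDiff : ContMDiff 𝓘(ℝ, Eucl n)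
    (𝓘(ℝ, Eucl n).prod 𝓘(ℝ, Eucl n →L[ℝ] Eucl n →L[ℝ] ℝ)) ω
    (fun x => Bundle.TotalSpace.mk' (Eucl n →L[ℝ] Eucl n →L[ℝ] ℝ)
      (E := fun x : M => TangentSpace 𝓘(ℝ, Eucl n) x →L[ℝ] TangentSpace 𝓘(ℝ, Eucl n) x →L[ℝ] ℝ)
      x (form x))

variable {n M} (g : LorentzMetric n M)

/-- A time orientation, given by a continuous future directed timelike vector field. -/
structure TimeOrientation where
  field : ∀ x : M, TangentSpace 𝓘(ℝ, Eucl n) x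
  timelike : ∀ x, g.form x (field x) (field x) < 0
  continuous : Continuous (fun x => (⟨x, field x⟩ : TangentBundle 𝓘(ℝ, Eucl n) M))

/-- The velocity `γ'(t)`. -/
def velocity (γ : ℝ → M) (t : ℝ) : TangentSpace 𝓘(ℝ, Eucl n) (γ t) :=
  mfderiv 𝓘(ℝ, ℝ) 𝓘(ℝ, Eucl n) γ t (1 : ℝ)

/-- An inextendible (smooth) timelike curve. -/
structure IsInextendibleTimelikeCurve (γ : ℝ → M) : Prop where
  smooth : ContMDiff 𝓘(ℝ, ℝ) 𝓘(ℝ, Eucl n) ∞ γ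
  timelike : ∀ t, g.form (γ t) (velocity γ t) (velocity γ t) < 0
  not_tendsto_atTop : ¬ ∃ p, Tendsto γ atTop (𝓝 p)
  not_tendsto_atBot : ¬ ∃ p, Tendsto γ atBot (𝓝 p)

/-- A smooth spacelike hypersurface. -/
def IsSpacelikeHypersurface (S : Set M) : Prop :=
  ∀ p ∈ S, ∃ (U : Set M) (f : M → ℝ), IsOpen U ∧ p ∈ U ∧
    ContMDiffOn 𝓘(ℝ, Eucl n) 𝓘(ℝ, ℝ) ∞ f U ∧ S ∩ U = {q ∈ U | f q = 0} ∧
    mfderiv 𝓘(ℝ, Eucl n) 𝓘(ℝ, ℝ) f p ≠ 0 ∧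
    ∀ v : TangentSpace 𝓘(ℝ, Eucl n) p, v ≠ 0 →
      mfderiv 𝓘(ℝ, Eucl n) 𝓘(ℝ, ℝ) f p v = 0 → 0 < g.form p v v

/-- A Cauchy hypersurface: met exactly once by every inextendible timelike curve. -/
def IsCauchy (S : Set M) : Prop :=
  ∀ γ : ℝ → M, IsInextendibleTimelikeCurve g γ → ∃! t : ℝ, γ t ∈ S

/-- Global hyperbolicity: existence of a smooth spacelike Cauchy hypersurface. -/
def IsGloballyHyperbolic : Prop :=
  ∃ S : Set M, IsSpacelikeHypersurface g S ∧ IsCauchy g S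

variable {g} (τ : TimeOrientation g)

/-- The interior of the future solid lightcone: future directed timelike vectors. -/
def futureCone (x : M) : Set (TangentSpace 𝓘(ℝ, Eucl n) x) :=
  {v | g.form x v v < 0 ∧ g.form x (τ.field x) v < 0}

/-- The interior of the past solid lightcone: past directed timelike vectors. -/
def pastCone (x : M) : Set (TangentSpace 𝓘(ℝ, Eucl n) x) :=
  {v | g.form x v v < 0 ∧ 0 < g.form x (τ.field x) v}

/-- Future directed causal (nonzero timelike or null) vectors. -/
def IsFutureCausal (x : M) (v : TangentSpace 𝓘(ℝ, Eucl n) x) : Prop :=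
  v ≠ 0 ∧ g.form x v v ≤ 0 ∧ g.form x (τ.field x) v < 0

/-- There is a smooth future directed causal curve segment from `p` to `q`. -/
def CausalSegment (p q : M) : Prop :=
  ∃ γ : ℝ → M, ContMDiff 𝓘(ℝ, ℝ) 𝓘(ℝ, Eucl n) ∞ γ ∧ γ 0 = p ∧ γ 1 = q ∧
    ∀ t ∈ Icc (0 : ℝ) 1, IsFutureCausal τ (γ t) (velocity γ t)

/-- The causal future `J⁺(A)`: points reached from `A` by piecewise smooth future directed causal
curves, and the points of `A`. -/
def causalFuture (A : Set M) : Set M := {q | ∃ p ∈ A, Relation.ReflTransGen (CausalSegment τ) p q}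

/-- The causal past `J⁻(A)`. -/
def causalPast (A : Set M) : Set M := {q | ∃ p ∈ A, Relation.ReflTransGen (CausalSegment τ) q p}

variable (g) in
/-- The characteristic manifold `𝒩 = {ξ ≠ 0 : ξ · g⁻¹ξ = 0}`; here `v = g⁻¹ξ`. -/
def charSet : Set (Cotangent 𝓘(ℝ, Eucl n) M) :=
  {X | X.2 ≠ 0 ∧ ∃ v : TangentSpace 𝓘(ℝ, Eucl n) X.1, g.form X.1 v = X.2 ∧ X.2 v = 0}

/-- The upper energy shell `𝒩⁺`: `ξ` positive on future directed timelike vectors. -/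
def upperShell : Set (Cotangent 𝓘(ℝ, Eucl n) M) :=
  {X ∈ charSet g | ∀ v ∈ futureCone τ X.1, 0 < X.2 v}

/-- The lower energy shell `𝒩⁻`: `ξ` positive on past directed timelike vectors. -/
def lowerShell : Set (Cotangent 𝓘(ℝ, Eucl n) M) :=
  {X ∈ charSet g | ∀ v ∈ pastCone τ X.1, 0 < X.2 v}

variable (g)

/-! ### Coordinates, the volume measure and the Klein-Gordon operator -/

/-- The metric coefficients `g_{ij}(y)` in the chart at `x`. -/
def metricCoeff (x : M) (y : Eucl n) : Matrix (Fin n) (Fin n) ℝ :=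
  Matrix.of fun i j =>
    g.form ((extChartAt 𝓘(ℝ, Eucl n) x).symm y)
      (mfderiv 𝓘(ℝ, Eucl n) 𝓘(ℝ, Eucl n) (extChartAt 𝓘(ℝ, Eucl n) x).symm y
        (EuclideanSpace.single i (1 : ℝ) : Eucl n))
      (mfderiv 𝓘(ℝ, Eucl n) 𝓘(ℝ, Eucl n) (extChartAt 𝓘(ℝ, Eucl n) x).symm y
        (EuclideanSpace.single j (1 : ℝ) : Eucl n))

/-- The density `|g|^{1/2}` in the chart at `x`. -/
def volDensity (x : M) (y : Eucl n) : ℝ := √|(metricCoeff g x y).det|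

/-- `□_g f = ∇^a ∇_a f = |g|^{-1/2} ∂_i (|g|^{1/2} g^{ij} ∂_j f)`, evaluated at `x` in the chart
at `x`. -/
def dAlembert (f : M → ℂ) (x : M) : ℂ :=
  let F : Eucl n → ℂ := f ∘ (extChartAt 𝓘(ℝ, Eucl n) x).symm
  let y₀ : Eucl n := extChartAt 𝓘(ℝ, Eucl n) x x
  (((volDensity g x y₀)⁻¹ : ℝ) : ℂ) * ∑ i, ∑ j,
    fderiv ℝ (fun y => ((volDensity g x y * (metricCoeff g x y)⁻¹ i j : ℝ) : ℂ)
      * fderiv ℝ F y (EuclideanSpace.single j 1)) y₀ (EuclideanSpace.single i 1)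

/-- The Klein-Gordon operator `P = -∇^a ∇_a + V`. -/
def kleinGordon (V : M → ℝ) (f : M → ℂ) (x : M) : ℂ := -dAlembert g f x + (V x : ℂ) * f x

theorem exists_chart_cover [Nonempty M] [SecondCountableTopology M] :
    ∃ c : ℕ → M, ⋃ k, (extChartAt 𝓘(ℝ, Eucl n) (c k)).source = univ := by
  obtain ⟨s, hs, hu⟩ := TopologicalSpace.countable_cover_nhds
    (fun x : M => extChartAt_source_mem_nhds (I := 𝓘(ℝ, Eucl n)) x)
  have hne : s.Nonempty := by
    by_contra h
    rw [not_nonempty_iff_eq_empty] at h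
    rw [h, biUnion_empty] at hu
    exact empty_ne_univ hu
  obtain ⟨c, rfl⟩ := hs.exists_eq_range hne
  exact ⟨c, by simpa using hu⟩

theorem metricCoeff_change (x c : M) {y : Eucl n} (hy : y ∈ (extChartAt 𝓘(ℝ, Eucl n) c).target)
    (hy' : (extChartAt 𝓘(ℝ, Eucl n) c).symm y ∈ (extChartAt 𝓘(ℝ, Eucl n) x).source) :
    DifferentiableAt ℝ (extChartAt 𝓘(ℝ, Eucl n) x ∘ (extChartAt 𝓘(ℝ, Eucl n) c).symm) y ∧
    volDensity g c y
      = |(fderiv ℝ (extChartAt 𝓘(ℝ, Eucl n) x ∘ (extChartAt 𝓘(ℝ, Eucl n) c).symm) y).det|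
        * volDensity g x (extChartAt 𝓘(ℝ, Eucl n) x ((extChartAt 𝓘(ℝ, Eucl n) c).symm y)) := by
  set ec := extChartAt 𝓘(ℝ, Eucl n) c
  set ex := extChartAt 𝓘(ℝ, Eucl n) x
  set φ : Eucl n → Eucl n := ex ∘ ec.symm with hφ
  have hcs : MDifferentiableAt 𝓘(ℝ, Eucl n) 𝓘(ℝ, Eucl n) ec.symm y :=
    ((contMDiffOn_extChartAt_symm (n := 1) c).contMDiffAt
      ((isOpen_extChartAt_target c).mem_nhds hy)).mdifferentiableAt one_ne_zero
  have hxe : MDifferentiableAt 𝓘(ℝ, Eucl n) 𝓘(ℝ, Eucl n) ex (ec.symm y) :=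
    (contMDiffAt_extChartAt' (n := 1) (by simpa [ex] using hy')).mdifferentiableAt one_ne_zero
  have hz : φ y ∈ ex.target := ex.map_source hy'
  have hxs : MDifferentiableAt 𝓘(ℝ, Eucl n) 𝓘(ℝ, Eucl n) ex.symm (φ y) :=
    ((contMDiffOn_extChartAt_symm (n := 1) x).contMDiffAt
      ((isOpen_extChartAt_target x).mem_nhds hz)).mdifferentiableAt one_ne_zero
  have hφm : MDifferentiableAt 𝓘(ℝ, Eucl n) 𝓘(ℝ, Eucl n) φ y := hxe.comp y hcs
  have hφd : DifferentiableAt ℝ φ y := hφm.differentiableAt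
  refine ⟨hφd, ?_⟩
  have hev : (ec.symm : Eucl n → M) =ᶠ[𝓝 y] ex.symm ∘ φ := by
    have : ec.symm ⁻¹' ex.source ∈ 𝓝 y :=
      hcs.continuousAt.preimage_mem_nhds ((isOpen_extChartAt_source x).mem_nhds hy')
    filter_upwards [this] with w hw
    exact (ex.left_inv hw).symm
  have hp : ex.symm (φ y) = ec.symm y := ex.left_inv hy'
  have hD : (mfderiv 𝓘(ℝ, Eucl n) 𝓘(ℝ, Eucl n) ec.symm y : Eucl n →L[ℝ] Eucl n)
      = (mfderiv 𝓘(ℝ, Eucl n) 𝓘(ℝ, Eucl n) ex.symm (φ y) : Eucl n →L[ℝ] Eucl n) ∘L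
        (fderiv ℝ φ y) := by
    have h := (hev.mfderiv_eq).trans (mfderiv_comp y hxs hφm)
    rw [mfderiv_eq_fderiv (f := φ)] at h
    exact h
  let gE : M → Eucl n →L[ℝ] Eucl n →L[ℝ] ℝ := fun p => g.form p
  let b := (EuclideanSpace.basisFun (Fin n) ℝ).toBasis
  have hb : ∀ i, b i = EuclideanSpace.single i (1 : ℝ) := fun i => by simp [b]
  let J := LinearMap.toMatrix b b (fderiv ℝ φ y : Eucl n →ₗ[ℝ] Eucl n)
  let Dx : Eucl n →L[ℝ] Eucl n := mfderiv 𝓘(ℝ, Eucl n) 𝓘(ℝ, Eucl n) ex.symm (φ y)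
  have hJ : ∀ i, fderiv ℝ φ y (b i) = ∑ k, J k i • b k := fun i => by
    conv_lhs => rw [← b.sum_repr (fderiv ℝ φ y (b i))]
    simp [J, LinearMap.toMatrix_apply]
  have hG : metricCoeff g c y = J.transpose * metricCoeff g x (φ y) * J := by
    ext i j
    have h1 : metricCoeff g c y i j
        = gE (ec.symm y) (Dx (fderiv ℝ φ y (b i))) (Dx (fderiv ℝ φ y (b j))) := by
      rw [hb, hb]
      show gE (ec.symm y) ((mfderiv 𝓘(ℝ, Eucl n) 𝓘(ℝ, Eucl n) ec.symm y :
        Eucl n →L[ℝ] Eucl n) _) ((mfderiv 𝓘(ℝ, Eucl n) 𝓘(ℝ, Eucl n) ec.symm y :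
        Eucl n →L[ℝ] Eucl n) _) = _
      rw [hD]
      rfl
    have h2 : ∀ k l, metricCoeff g x (φ y) k l = gE (ec.symm y) (Dx (b k)) (Dx (b l)) := by
      intro k l
      rw [hb, hb, ← hp]
      rfl
    rw [h1, hJ, hJ, Matrix.mul_apply]
    simp only [Matrix.mul_apply, Matrix.transpose_apply, h2, map_sum, map_smul,
      FunLike.coe_sum, Finset.sum_apply, FunLike.coe_smul, Pi.smul_apply, smul_eq_mul,
      Finset.sum_mul, Finset.mul_sum]
    refine Finset.sum_congr rfl fun l _ => Finset.sum_congr rfl fun k _ => by ring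
  have hdet : (fderiv ℝ φ y).det = J.det := by
    rw [LinearMap.det_toMatrix]
  rw [volDensity, hG, Matrix.det_mul, Matrix.det_mul, Matrix.det_transpose, hdet, volDensity]
  have : J.det * (metricCoeff g x (φ y)).det * J.det
      = J.det ^ 2 * (metricCoeff g x (φ y)).det := by ring
  rw [this, abs_mul, abs_pow, Real.sqrt_mul (by positivity), Real.sqrt_sq (abs_nonneg _)]
  rfl

variable [MeasurableSpace M] [BorelSpace M]

theorem measurableSet_chart_image (c : M) {B : Set M} (hB : MeasurableSet B) :
    MeasurableSet ((extChartAt 𝓘(ℝ, Eucl n) c).target ∩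
      (extChartAt 𝓘(ℝ, Eucl n) c).symm ⁻¹' B) := by
  have h := (continuousOn_iff_continuous_domRestrict.mp
    (continuousOn_extChartAt_symm (I := 𝓘(ℝ, Eucl n)) c)).measurable hB
  have h2 := (isOpen_extChartAt_target (I := 𝓘(ℝ, Eucl n)) c).measurableSet.subtype_image h
  convert h2 using 1
  ext y
  simp only [mem_inter_iff, mem_preimage, mem_image, Subtype.exists, domRestrict_apply,
    exists_and_right, exists_eq_right]
  exact ⟨fun h => ⟨h.1, h.2⟩, fun ⟨h, h'⟩ => ⟨h, h'⟩⟩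

theorem lintegral_volDensity_change (x c : M) {B : Set M} (hB : MeasurableSet B)
    (hx : B ⊆ (extChartAt 𝓘(ℝ, Eucl n) x).source) (hc : B ⊆ (extChartAt 𝓘(ℝ, Eucl n) c).source) :
    ∫⁻ y in (extChartAt 𝓘(ℝ, Eucl n) c).target ∩ (extChartAt 𝓘(ℝ, Eucl n) c).symm ⁻¹' B,
        ENNReal.ofReal (volDensity g c y)
      = ∫⁻ y in (extChartAt 𝓘(ℝ, Eucl n) x).target ∩ (extChartAt 𝓘(ℝ, Eucl n) x).symm ⁻¹' B,
        ENNReal.ofReal (volDensity g x y) := by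
  have hS := measurableSet_chart_image (n := n) c hB
  have hchg := fun y (hy : y ∈ (extChartAt 𝓘(ℝ, Eucl n) c).target ∩
    (extChartAt 𝓘(ℝ, Eucl n) c).symm ⁻¹' B) => metricCoeff_change g x c hy.1 (hx hy.2)
  set ec := extChartAt 𝓘(ℝ, Eucl n) c
  set ex := extChartAt 𝓘(ℝ, Eucl n) x
  have him : (ex ∘ ec.symm) '' (ec.target ∩ ec.symm ⁻¹' B) = ex.target ∩ ex.symm ⁻¹' B := by
    ext z
    constructor
    · rintro ⟨y, ⟨_, hyB⟩, rfl⟩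
      refine ⟨ex.map_source (hx hyB), ?_⟩
      show ex.symm (ex (ec.symm y)) ∈ B
      rwa [ex.left_inv (hx hyB)]
    · rintro ⟨hz, hzB⟩
      refine ⟨ec (ex.symm z), ⟨ec.map_source (hc hzB), ?_⟩, ?_⟩
      · show ec.symm (ec (ex.symm z)) ∈ B
        rwa [ec.left_inv (hc hzB)]
      · show ex (ec.symm (ec (ex.symm z))) = z
        rw [ec.left_inv (hc hzB), ex.right_inv hz]
  have hinj : InjOn (ex ∘ ec.symm) (ec.target ∩ ec.symm ⁻¹' B) := by
    intro y hy y' hy' h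
    exact ec.symm.injOn hy.1 hy'.1 (ex.injOn (hx hy.2) (hx hy'.2) h)
  rw [← him, lintegral_image_eq_lintegral_abs_det_fderiv_mul volume hS
    (fun y hy => (hchg y hy).1.hasFDerivAt.hasFDerivWithinAt) hinj]
  refine setLIntegral_congr_fun hS fun y hy => ?_
  show ENNReal.ofReal (volDensity g c y) = _
  rw [(hchg y hy).2, ENNReal.ofReal_mul (abs_nonneg _)]
  rfl

variable [Nonempty M] [SecondCountableTopology M]

variable (n M) in
/-- The disjoint pieces of a countable cover of `M` by chart domains. -/
def piece (k : ℕ) : Set M :=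
  disjointed (fun k => (extChartAt 𝓘(ℝ, Eucl n) ((exists_chart_cover (n := n) (M := M)).choose k)).source) k

/-- The volume measure `dvol_g`: on each piece of a countable cover by chart domains it is the
measure `|g|^{1/2} dx` of the chart. -/
def volumeMeasure : Measure M :=
  Measure.sum fun k =>
    let e := extChartAt 𝓘(ℝ, Eucl n) ((exists_chart_cover (n := n) (M := M)).choose k)
    Measure.map e.symm
      ((volume.withDensity fun y => ENNReal.ofReal
          (volDensity g ((exists_chart_cover (n := n) (M := M)).choose k) y)).restrict
        (e.target ∩ e.symm ⁻¹' piece n M k))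

/-- In every chart, `dvol_g = |g|^{1/2} dx`. -/
theorem volumeMeasure_apply (x : M) {A : Set M} (hA : MeasurableSet A)
    (hAx : A ⊆ (extChartAt 𝓘(ℝ, Eucl n) x).source) :
    volumeMeasure g A
      = ∫⁻ y in (extChartAt 𝓘(ℝ, Eucl n) x).target ∩ (extChartAt 𝓘(ℝ, Eucl n) x).symm ⁻¹' A,
        ENNReal.ofReal (volDensity g x y) := by
  set c := (exists_chart_cover (n := n) (M := M)).choose with hc
  have hcov : ⋃ k, (extChartAt 𝓘(ℝ, Eucl n) (c k)).source = univ :=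
    (exists_chart_cover (n := n) (M := M)).choose_spec
  have hP : ∀ k, MeasurableSet (piece n M k) := fun k =>
    MeasurableSet.disjointed (fun k => (isOpen_extChartAt_source (c k)).measurableSet) k
  have hPs : ∀ k, piece n M k ⊆ (extChartAt 𝓘(ℝ, Eucl n) (c k)).source := fun k =>
    disjointed_subset _ k
  have hPd : Pairwise (Function.onFun Disjoint (piece n M)) := disjoint_disjointed _
  have hPu : ⋃ k, piece n M k = univ := (iUnion_disjointed).trans hcov
  have hterm : ∀ k, Measure.map (extChartAt 𝓘(ℝ, Eucl n) (c k)).symm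
      ((volume.withDensity fun y => ENNReal.ofReal (volDensity g (c k) y)).restrict
        ((extChartAt 𝓘(ℝ, Eucl n) (c k)).target ∩
          (extChartAt 𝓘(ℝ, Eucl n) (c k)).symm ⁻¹' piece n M k)) A
      = ∫⁻ y in (extChartAt 𝓘(ℝ, Eucl n) x).target ∩
          (extChartAt 𝓘(ℝ, Eucl n) x).symm ⁻¹' (A ∩ piece n M k),
        ENNReal.ofReal (volDensity g x y) := by
    intro k
    have hm := measurableSet_chart_image (n := n) (c k) (hP k)
    have hmA := measurableSet_chart_image (n := n) (c k) (hA.inter (hP k))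
    have hae := ((continuousOn_extChartAt_symm (I := 𝓘(ℝ, Eucl n)) (c k)).mono
      (inter_subset_left (t := (extChartAt 𝓘(ℝ, Eucl n) (c k)).symm ⁻¹' piece n M k))).aemeasurable
      (μ := volume.withDensity fun y => ENNReal.ofReal (volDensity g (c k) y)) hm
    rw [← lintegral_volDensity_change g x (c k) (hA.inter (hP k))
      (inter_subset_left.trans hAx) (inter_subset_right.trans (hPs k)),
      Measure.map_apply_of_aemeasurable hae hA, ← withDensity_apply _ hmA,
      Measure.restrict_apply' hm]
    congr 1
    ext y
    simp only [mem_inter_iff, mem_preimage]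
    tauto
  have hsum : volumeMeasure g A = ∑' k, ∫⁻ y in (extChartAt 𝓘(ℝ, Eucl n) x).target ∩
          (extChartAt 𝓘(ℝ, Eucl n) x).symm ⁻¹' (A ∩ piece n M k),
        ENNReal.ofReal (volDensity g x y) := by
    rw [volumeMeasure, Measure.sum_apply _ hA]
    exact tsum_congr hterm
  rw [hsum, ← lintegral_iUnion (fun k => measurableSet_chart_image (n := n) x (hA.inter (hP k)))]
  · congr 2
    rw [← inter_iUnion, ← preimage_iUnion, ← inter_iUnion, hPu, inter_univ]
  · intro k l hkl
    rw [Function.onFun, Set.disjoint_left]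
    rintro y ⟨_, hy⟩ ⟨_, hy'⟩
    exact Set.disjoint_left.mp (hPd hkl) hy.2 hy'.2

end Lorentz

/-! ## Klein-Gordon fields -/

section KleinGordon

variable {n : ℕ} {M : Type*} [TopologicalSpace M] [ChartedSpace (Eucl n) M]
  [IsManifold 𝓘(ℝ, Eucl n) ω M]
  {g : LorentzMetric n M} (τ : TimeOrientation g) (V : M → ℝ)

/-- Operators `C_c^∞(M) → C^∞(M)`. -/
abbrev Op (n : ℕ) (M : Type*) [TopologicalSpace M] [ChartedSpace (Eucl n) M] :=
  TestFn 𝓘(ℝ, Eucl n) M →ₗ[ℂ] SmoothFn 𝓘(ℝ, Eucl n) M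

/-- `E` is an inverse of `P` from `C_c^∞(M)` to `C^∞(M)` (`P E u = u` and `E P u = u`) with
`supp E u ⊆ J (supp u)`. -/
structure IsGreenOperator (g : LorentzMetric n M) (V : M → ℝ) (J : Set M → Set M) (E : Op n M) :
    Prop where
  right_inv : ∀ (u : TestFn 𝓘(ℝ, Eucl n) M) (x : M), kleinGordon g V (E u) x = u x
  left_inv : ∀ u v : TestFn 𝓘(ℝ, Eucl n) M, (∀ x, v x = kleinGordon g V u x) → ∀ x, E v x = u x
  support : ∀ u : TestFn 𝓘(ℝ, Eucl n) M, tsupport (E u) ⊆ J (tsupport u)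

/-- The retarded inverse `G_ret`: the (unique) inverse of `P` with `supp G_ret u ⊆ J⁺(supp u)`. -/
def retardedInverse : Op n M := Classical.epsilon (IsGreenOperator g V (causalFuture τ))

/-- The advanced inverse `G_adv`: the (unique) inverse of `P` with `supp G_adv u ⊆ J⁻(supp u)`. -/
def advancedInverse : Op n M := Classical.epsilon (IsGreenOperator g V (causalPast τ))

/-- The Pauli-Jordan commutator `G = G_ret - G_adv`. -/
def pauliJordan : Op n M := retardedInverse τ V - advancedInverse τ V

variable (g) in
/-- The subspace `P C_c^∞(M)` of `C_c^∞(M)`. -/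
def kleinGordonRange : Submodule ℂ (TestFn 𝓘(ℝ, Eucl n) M) :=
  Submodule.span ℂ {v | ∃ u : TestFn 𝓘(ℝ, Eucl n) M, ∀ x, v x = kleinGordon g V u x}

variable (g) in
/-- The space `𝒱 = C_c^∞(M) / P C_c^∞(M)`. -/
abbrev PhaseSpace := TestFn 𝓘(ℝ, Eucl n) M ⧸ kleinGordonRange g V

variable [Nonempty M] [SecondCountableTopology M] [MeasurableSpace M] [BorelSpace M]

variable (g) in
/-- `(u | v)_M = ∫ ū v dvol_g`. -/
def pairing (u v : M → ℂ) : ℂ := ∫ x, conj (u x) * v x ∂(volumeMeasure g)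

/-- The form `[u]‾ · Q[v] = i (u | G v)_M`. On a globally hyperbolic spacetime the right hand side
does not depend on the representatives of the classes. -/
def phaseForm (a b : PhaseSpace g V) : ℂ :=
  Complex.I * pairing g (Quotient.out a : TestFn 𝓘(ℝ, Eucl n) M)
    (pauliJordan τ V (Quotient.out b : TestFn 𝓘(ℝ, Eucl n) M))

/-- `CCR(P)`. -/
abbrev CCRP := CCR.Alg (phaseForm τ V)

/-- `Λ⁺, Λ⁻` are the spacetime covariances of the state `s`:
`(u | Λ⁺ v)_M = s(ψ[u] ψ*[v])` and `(u | Λ⁻ v)_M = s(ψ*[v] ψ[u])`. -/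
structure IsCovariance (s : CCRP τ V →ₗ[ℂ] ℂ) (Lp Lm : Op n M) : Prop where
  plus : ∀ u v : TestFn 𝓘(ℝ, Eucl n) M, pairing g u (Lp v) =
    s (CCR.psi (phaseForm τ V) (Submodule.Quotient.mk u)
      * CCR.psiStar (phaseForm τ V) (Submodule.Quotient.mk v))
  minus : ∀ u v : TestFn 𝓘(ℝ, Eucl n) M, pairing g u (Lm v) =
    s (CCR.psiStar (phaseForm τ V) (Submodule.Quotient.mk v)
      * CCR.psi (phaseForm τ V) (Submodule.Quotient.mk u))

/-- The test function `(x, y) ↦ u(x)‾ v(y)` on `M × M`. -/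
def tensorConj (u v : TestFn 𝓘(ℝ, Eucl n) M) :
    TestFn (𝓘(ℝ, Eucl n).prod 𝓘(ℝ, Eucl n)) (M × M) :=
  ⟨fun p => conj (u p.1) * v p.2, by
    have h1 : ContMDiff (𝓘(ℝ, Eucl n).prod 𝓘(ℝ, Eucl n)) 𝓘(ℝ, ℂ) ∞ (fun p : M × M => conj (u p.1)) :=
      (Complex.conjCLE.toContinuousLinearMap.contMDiff (n := ∞)).comp (u.2.1.comp contMDiff_fst)
    have h2 : ContMDiff (𝓘(ℝ, Eucl n).prod 𝓘(ℝ, Eucl n)) 𝓘(ℝ, ℂ) ∞ (fun p : M × M => v p.2) :=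
      v.2.1.comp contMDiff_snd
    have h3 : ContDiff ℝ ∞ (fun z : ℂ × ℂ => z.1 * z.2) := contDiff_fst.mul contDiff_snd
    refine ⟨h3.contMDiff.comp (h1.prodMk_space h2), ?_⟩
    · refine HasCompactSupport.intro' (u.2.2.prod v.2.2)
        ((isClosed_tsupport _).prod (isClosed_tsupport _)) ?_
      rintro ⟨x, y⟩ h
      rw [mem_prod, not_and_or] at h
      rcases h with h | h
      · simp [image_eq_zero_of_notMem_tsupport h]
      · simp [image_eq_zero_of_notMem_tsupport h]⟩

variable [T2Space M]

variable (g) in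
/-- `K ∈ 𝒟'(M × M)` is the Schwartz kernel of `A`: `⟨K, ū ⊗ v⟩ = (u | A v)_M`. -/
def IsSchwartzKernel (A : Op n M)
    (K : ManifoldDistribution (𝓘(ℝ, Eucl n).prod 𝓘(ℝ, Eucl n)) (M × M)) : Prop :=
  ∀ u v : TestFn 𝓘(ℝ, Eucl n) M, K.toLin (tensorConj u v) = pairing g u (A v)

/-- A quasi-free state on `CCR(P)` is analytic Hadamard if its spacetime covariances
`Λ^± : C_c^∞(M) → C^∞(M)`, identified with their kernels in `𝒟'(M × M)`, satisfy
`WF_a(Λ^±)' ⊆ 𝒩^± × 𝒩^±`. -/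
def IsAnalyticHadamard (s : CCRP τ V →ₗ[ℂ] ℂ) : Prop :=
  CCR.IsQuasiFree s ∧ ∃ Lp Lm : Op n M, IsCovariance τ V s Lp Lm ∧
    ∃ Kp Km : ManifoldDistribution (𝓘(ℝ, Eucl n).prod 𝓘(ℝ, Eucl n)) (M × M),
      IsSchwartzKernel g Lp Kp ∧ IsSchwartzKernel g Lm Km ∧
      primed Kp.WFa ⊆ upperShell τ ×ˢ upperShell τ ∧
      primed Km.WFa ⊆ lowerShell τ ×ˢ lowerShell τ

variable (g) in
/-- `A` has a real analytic kernel: `(A v)(x) = ∫ k(x, y) v(y) dvol_g(y)` with `k` real analytic on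
`M × M`. -/
def HasAnalyticKernel (A : Op n M) : Prop :=
  ∃ k : M × M → ℂ, ContMDiff (𝓘(ℝ, Eucl n).prod 𝓘(ℝ, Eucl n)) 𝓘(ℝ, ℂ) ω k ∧
    ∀ (v : TestFn 𝓘(ℝ, Eucl n) M) (x : M), A v x = ∫ y, k (x, y) * v y ∂(volumeMeasure g)

end KleinGordon

end

noncomputable section

set_option linter.unusedSectionVars false

/-! ## The Cauchy formula on polydiscs and Osgood's lemma -/

section Cauchy

/-! By the commutation relation, `ψ(u)ψ*(v)` and `ψ*(v)ψ(u)` differ by a scalar which does not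
depend on the state. Hence `Λ⁺ - Λ̃⁺` and `Λ⁻ - Λ̃⁻` give the same sesquilinear form on test
functions. The primed wave front set of the first difference lies over the upper energy shell, that
of the second over the lower one, and the shells are disjoint (`disjoint_upperShell_lowerShell`). So
the common difference is microlocally analytic in every codirection, and a distribution with empty
analytic wave front set is a real analytic function.

The microlocal information is used in one form only, `IsWedgeSumAt`: near `x₀` the distribution is a
finite sum of boundary values along rays `x + itv_j`, `t ↓ 0`, with `η(v_j) < 0` for every `j`. For
`η ≠ 0` the definition of microlocal analyticity provides this
(`isWedgeSumAt_of_isMicroAnalyticAt`), and the form is stable under differences. The analytic core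
is `exists_analytic_of_isWedgeSumAt`: if such a representation exists for every `η ≠ 0`, the
distribution is an analytic function near `x₀`.

The core is an FBI argument. A Gaussian in `w` is the integral of `exp(-i w·ζ - εζ²) dζ` over `ζ ∈
ℝᴺ`, and also over the contour `ζ = ξ - i⟨ξ⟩w` (`integral_fbiKernel`), where the integrand contains
the damping factor `exp(-⟨ξ⟩w²)`. Applying `T` to the cut-off integrand at frequency `ξ` gives the
plane wave component `planeWave`. Pushing `x` to `x + isv_j` with `ξ·v_j < 0` makes the phase decay
near `x₀`, while away from `x₀` the damping factor decays. The result is a bound `exp(-c|ξ|)`,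
uniform in `ε ∈ [0,1]` and in complex base points `y` near `x₀` (`WedgeRep.exists_decay`), and
compactness of the sphere makes it uniform in direction. At `ε = 0` the components therefore sum to
a holomorphic function of `y`, and letting `ε → 0` in a Gaussian regularisation identifies it with
`T`, up to the constant mass of the Gaussian.

Two further points are needed. The two differences are known to agree only on tensor products; since
Gaussians in product coordinates are tensor products, agreement near the point follows from Gaussian
approximation (`chartDiff_eq_of_tensor`). Finally the local analytic densities are converted to
kernels for `dvol_g`, agree on overlaps, and glue to a global kernel (`hasAnalyticKernel_of_local`).
-/

theorem torusMap_mem_closedBall {n : ℕ} (c : Fin n → ℂ) {R : ℝ} (hR : 0 ≤ R) (θ : Fin n → ℝ) :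
    torusMap c (fun _ => R) θ ∈ Metric.closedBall c R := by
  rw [Metric.mem_closedBall, dist_pi_le_iff hR]
  intro i
  simp [torusMap, dist_eq_norm, abs_of_nonneg hR]

theorem continuous_torusMap {n : ℕ} (c : Fin n → ℂ) (R : ℝ) :
    Continuous (torusMap c (fun _ => R)) := by
  unfold torusMap; fun_prop

theorem torusMap_sub_ne_zero {n : ℕ} {c y : Fin n → ℂ} {R : ℝ} (hR : 0 < R)
    (hy : y ∈ Metric.ball c R) (θ : Fin n → ℝ) (i : Fin n) :
    torusMap c (fun _ => R) θ i - y i ≠ 0 := by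
  intro h
  have h1 : dist (y i) (c i) < R := (dist_pi_lt_iff hR).1 hy i
  rw [← sub_eq_zero.1 h, dist_eq_norm] at h1
  simp [torusMap, abs_of_pos hR] at h1

theorem torusIntegrable_cauchy {n : ℕ} {c y : Fin n → ℂ} {R : ℝ} (hR : 0 < R)
    {g : (Fin n → ℂ) → ℂ} (hg : ContinuousOn g (Metric.closedBall c R))
    (hy : y ∈ Metric.ball c R) :
    TorusIntegrable (fun z => (∏ i, (z i - y i)⁻¹) * g z) c (fun _ => R) := by
  refine Continuous.integrableOn_Icc ?_
  refine Continuous.mul ?_ ?_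
  · refine continuous_finsetProd _ fun i _ => Continuous.inv₀ ?_ (torusMap_sub_ne_zero hR hy · i)
    have := continuous_torusMap c R
    fun_prop
  · exact hg.comp_continuous (continuous_torusMap c R) (torusMap_mem_closedBall c hR.le)

/-- One coordinate is peeled off at a time: with the first coordinate fixed, the induction
hypothesis evaluates the inner torus integral, and the one-variable Cauchy formula disposes of the
remaining circle. -/
theorem torusIntegral_cauchy {n : ℕ} {c y : Fin n → ℂ} {R : ℝ} (hR : 0 < R)
    {g : (Fin n → ℂ) → ℂ} (hg : ∀ z ∈ Metric.closedBall c R, DifferentiableAt ℂ g z)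
    (hy : y ∈ Metric.ball c R) :
    torusIntegral (fun z => (∏ i, (z i - y i)⁻¹) * g z) c (fun _ => R)
      = (2 * Real.pi * Complex.I) ^ n * g y := by
  induction n with
  | zero => simp [Subsingleton.elim c y]
  | succ n ih =>
    rw [torusIntegral_succ (torusIntegrable_cauchy hR
      (fun z hz => (hg z hz).continuousAt.continuousWithinAt) hy)]
    have hcons : ∀ x ∈ Metric.closedBall (c 0) R, ∀ z ∈ Metric.closedBall (c ∘ Fin.succ) R,
        (Fin.cons x z : Fin (n + 1) → ℂ) ∈ Metric.closedBall c R := by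
      intro x hx z hz
      rw [Metric.mem_closedBall, dist_pi_le_iff hR.le] at hz ⊢
      intro i
      refine Fin.cases ?_ (fun j => ?_) i
      · simpa using hx
      · simpa using hz j
    have hytail : y ∘ Fin.succ ∈ Metric.ball (c ∘ Fin.succ) R := by
      rw [Metric.mem_ball, dist_pi_lt_iff hR] at hy ⊢
      exact fun i => hy i.succ
    have hy0 : y 0 ∈ Metric.ball (c 0) R := (dist_pi_lt_iff hR).1 hy 0
    have hinner : ∀ x ∈ Metric.closedBall (c 0) R,
        torusIntegral (fun z : Fin n → ℂ => (∏ i, ((Fin.cons x z : Fin (n + 1) → ℂ) i - y i)⁻¹)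
          * g (Fin.cons x z)) (c ∘ Fin.succ) ((fun _ => R) ∘ Fin.succ)
        = (2 * Real.pi * Complex.I) ^ n * ((x - y 0)⁻¹ * g (Fin.cons x (y ∘ Fin.succ))) := by
      intro x hx
      have h1 := ih (c := c ∘ Fin.succ) (y := y ∘ Fin.succ)
        (g := fun z => (x - y 0)⁻¹ * g (Fin.cons x z)) (fun z hz => by
          refine DifferentiableAt.const_mul ?_ _
          refine (hg _ (hcons x hx z hz)).comp z ?_
          refine differentiableAt_pi.2 fun i => ?_
          refine Fin.cases ?_ (fun j => ?_) i
          · simp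
          · simp only [Fin.cons_succ]; fun_prop) hytail
      rw [← h1]
      congr 1
      funext z
      rw [Fin.prod_univ_succ]
      simp only [Fin.cons_zero, Fin.cons_succ, Function.comp]
      ring
    rw [circleIntegral.integral_congr hR.le
      (fun x hx => hinner x (Metric.sphere_subset_closedBall hx))]
    have hd : ∀ x ∈ Metric.closedBall (c 0) R,
        DifferentiableAt ℂ (fun x => g (Fin.cons x (y ∘ Fin.succ))) x := by
      intro x hx
      refine (hg _ (hcons x hx _ (Metric.ball_subset_closedBall hytail))).comp x ?_
      refine differentiableAt_pi.2 fun i => ?_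
      refine Fin.cases ?_ (fun j => ?_) i
      · simp
      · simp
    have h2 := (DifferentiableOn.diffContOnCl_ball (c := c 0) (R := R) (U := Metric.closedBall (c 0) R)
      (f := fun x => g (Fin.cons x (y ∘ Fin.succ)))
      (fun x hx => (hd x hx).differentiableWithinAt) subset_rfl).circleIntegral_sub_inv_smul hy0
    simp only [smul_eq_mul] at h2
    rw [circleIntegral.integral_const_mul, h2, pow_succ]
    have : (Fin.cons (y 0) (y ∘ Fin.succ) : Fin (n + 1) → ℂ) = y := Fin.cons_self_tail y
    rw [this]
    ring

/-- Cauchy integrals over a torus are analytic in the polydisc. -/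
theorem analyticOnNhd_cauchyIntegral {n : ℕ} (c : Fin n → ℂ) {R : ℝ} (hR : 0 < R)
    {a : (Fin n → ℝ) → ℂ} (ha : IntegrableOn a (Icc 0 fun _ => 2 * Real.pi)) :
    AnalyticOnNhd ℂ (fun y => ∫ θ in Icc 0 fun _ => 2 * Real.pi,
      (∏ i, (torusMap c (fun _ => R) θ i - y i)⁻¹) * a θ) (Metric.ball c R) := by
  set K : Set (Fin n → ℝ) := Icc 0 fun _ => 2 * Real.pi
  have hKc : CompactSpace K := isCompact_iff_compactSpace.1 isCompact_Icc
  let μ : Measure K := volume.comap (Subtype.val : K → Fin n → ℝ)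
  have hKm : MeasurableSet K := measurableSet_Icc
  have ha' : Integrable (fun θ : K => a θ) μ :=
    (integrableOn_iff_comap_subtypeVal hKm).1 ha
  let ℓ : C(K, ℂ) →ₗ[ℂ] ℂ :=
    { toFun := fun φ => ∫ θ : K, φ θ * a θ ∂μ
      map_add' := fun φ ψ => by
        simp only [ContinuousMap.add_apply, add_mul]
        exact integral_add (ha'.bdd_mul φ.continuous.aestronglyMeasurable
          (.of_forall φ.norm_coe_le_norm)) (ha'.bdd_mul ψ.continuous.aestronglyMeasurable
          (.of_forall ψ.norm_coe_le_norm))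
      map_smul' := fun z φ => by
        simp only [ContinuousMap.smul_apply, smul_eq_mul, mul_assoc, RingHom.id_apply]
        exact integral_const_mul _ _ }
  let ℓ' : C(K, ℂ) →L[ℂ] ℂ := ℓ.mkContinuous (∫ θ, ‖a θ‖ ∂μ) fun φ => by
    refine (norm_integral_le_of_norm_le (g := fun θ : K => ‖a θ‖ * ‖φ‖) (ha'.norm.mul_const _)
      (.of_forall fun θ => ?_)).trans_eq (integral_mul_const _ _)
    rw [norm_mul, mul_comm]
    exact mul_le_mul_of_nonneg_left (φ.norm_coe_le_norm θ) (norm_nonneg _)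
  -- The factor `torusMap - y i` is an element of the Banach algebra `C(K, ℂ)`, affine in `y`.
  -- Inversion in a Banach algebra is analytic at units, and the integral against `a` is a
  -- continuous linear functional, so no power series has to be estimated.
  let Z : Fin n → (Fin n → ℂ) → C(K, ℂ) := fun i y =>
    ⟨fun θ => torusMap c (fun _ => R) θ i, by
      have := continuous_torusMap c R; fun_prop⟩ - algebraMap ℂ C(K, ℂ) (y i)
  have hZan : ∀ i y, AnalyticAt ℂ (Z i) y := fun i y =>
    analyticAt_const.sub (((Algebra.linearMap ℂ C(K, ℂ)).toContinuousLinearMap ∘L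
      (ContinuousLinearMap.proj i : (Fin n → ℂ) →L[ℂ] ℂ)).analyticAt y)
  have hZu : ∀ y ∈ Metric.ball c R, ∀ i, IsUnit (Z i y) := fun y hy i =>
    ContinuousMap.isUnit_iff_forall_ne_zero _ |>.2 fun θ => torusMap_sub_ne_zero hR hy θ i
  have hinv : ∀ y ∈ Metric.ball c R, ∀ i (θ : K),
      Ring.inverse (Z i y) θ = (torusMap c (fun _ => R) θ i - y i)⁻¹ := by
    intro y hy i θ
    have h1 := congrArg (fun f : C(K, ℂ) => f θ) (Ring.mul_inverse_cancel _ (hZu y hy i))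
    exact eq_inv_of_mul_eq_one_right h1
  intro y hy
  have hmain : AnalyticAt ℂ (fun y => ℓ' (∏ i, Ring.inverse (Z i y))) y := by
    refine (ℓ'.analyticAt _).comp ?_
    refine Finset.analyticAt_fun_prod _ fun i _ => ?_
    obtain ⟨u, hu⟩ := hZu y hy i
    exact AnalyticAt.comp (by rw [← hu]; exact analyticAt_inverse u) (hZan i y)
  refine hmain.congr ?_
  filter_upwards [Metric.isOpen_ball.mem_nhds hy] with z hz
  show ∫ θ : K, (∏ i, Ring.inverse (Z i z)) θ * a θ ∂μ = _
  rw [← integral_subtype_comap hKm]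
  refine integral_congr_ae (.of_forall fun θ => ?_)
  simp only [ContinuousMap.prod_apply, hinv z hz]

/-- **Osgood's lemma**: complex differentiable functions on open subsets of `ℂⁿ` are analytic. -/
theorem analyticAt_of_differentiableOn_pi {n : ℕ} {U : Set (Fin n → ℂ)} (hU : IsOpen U)
    {g : (Fin n → ℂ) → ℂ} (hg : DifferentiableOn ℂ g U) {c : Fin n → ℂ} (hc : c ∈ U) :
    AnalyticAt ℂ g c := by
  obtain ⟨R, hR, hRU⟩ := Metric.nhds_basis_closedBall.mem_iff.1 (hU.mem_nhds hc)
  have hd : ∀ z ∈ Metric.closedBall c R, DifferentiableAt ℂ g z := fun z hz =>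
    hg.differentiableAt (hU.mem_nhds (hRU hz))
  have hcont : Continuous fun θ => g (torusMap c (fun _ => R) θ) :=
    ContinuousOn.comp_continuous (fun z hz => (hd z hz).continuousAt.continuousWithinAt)
      (continuous_torusMap c R) (torusMap_mem_closedBall c hR.le)
  have h := analyticOnNhd_cauchyIntegral c hR (a := fun θ =>
    (∏ i : Fin n, (R * Complex.exp (θ i * Complex.I) * Complex.I : ℂ)) *
      g (torusMap c (fun _ => R) θ)) (Continuous.integrableOn_Icc (Continuous.mul (by fun_prop) hcont)) c
      (Metric.mem_ball_self hR)
  refine ((analyticAt_const (v := ((2 * Real.pi * Complex.I) ^ n)⁻¹)).mul h).congr ?_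
  filter_upwards [Metric.ball_mem_nhds c hR] with y hy
  have h1 := torusIntegral_cauchy hR hd hy
  have h2 : (2 * Real.pi * Complex.I : ℂ) ^ n ≠ 0 := pow_ne_zero _ (by simp [Real.pi_ne_zero])
  rw [← mul_right_inj' h2, ← h1, torusIntegral]
  simp only [Pi.mul_apply]
  rw [← mul_assoc, mul_inv_cancel₀ h2, one_mul]
  refine integral_congr_ae (.of_forall fun θ => ?_)
  simp only [smul_eq_mul]
  ring

/-- Holomorphic functions on open subsets of a complexification are smooth. -/
theorem IsHolomorphicOn.contDiffAt {E : Type*} [NormedAddCommGroup E] [NormedSpace ℝ E] {N : ℕ}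
    (L : E ≃L[ℝ] (Fin N → ℝ)) {F : E × E → ℂ} {D : Set (E × E)} (hF : IsHolomorphicOn F D)
    {p : E × E} (hp : p ∈ D) {k : WithTop ℕ∞} : ContDiffAt ℝ k F p := by
  -- `Θ` sends a complex coordinate vector to the pair of its real and imaginary parts and `Ξ` is a
  -- right inverse for it. Thus `F ∘ Θ` lives on `ℂᴺ`, where the differential condition is complex
  -- linearity and Osgood's lemma applies.
  let reL : (Fin N → ℂ) →L[ℝ] (Fin N → ℝ) :=
    ContinuousLinearMap.pi fun i => Complex.reCLM ∘L ContinuousLinearMap.proj i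
  let imL : (Fin N → ℂ) →L[ℝ] (Fin N → ℝ) :=
    ContinuousLinearMap.pi fun i => Complex.imCLM ∘L ContinuousLinearMap.proj i
  let Θ : (Fin N → ℂ) →L[ℝ] E × E :=
    (L.symm.toContinuousLinearMap ∘L reL).prod (L.symm.toContinuousLinearMap ∘L imL)
  let ofL : (Fin N → ℝ) →L[ℝ] (Fin N → ℂ) :=
    ContinuousLinearMap.pi fun i => Complex.ofRealCLM ∘L ContinuousLinearMap.proj i
  let Ξ : E × E →L[ℝ] (Fin N → ℂ) :=
    (ofL ∘L L.toContinuousLinearMap) ∘L ContinuousLinearMap.fst ℝ E E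
      + Complex.I • (ofL ∘L L.toContinuousLinearMap) ∘L ContinuousLinearMap.snd ℝ E E
  have hΘΞ : ∀ q, Θ (Ξ q) = q := by
    intro q
    have h1 : reL (Ξ q) = L q.1 := by ext i; simp [reL, Ξ, ofL]
    have h2 : imL (Ξ q) = L q.2 := by ext i; simp [imL, Ξ, ofL]
    show (L.symm (reL (Ξ q)), L.symm (imL (Ξ q))) = q
    rw [h1, h2]; simp
  have hΘI : ∀ w, Θ (Complex.I • w) = (-(Θ w).2, (Θ w).1) := by
    intro w
    have h1 : reL (Complex.I • w) = - imL w := by ext i; simp [reL, imL]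
    have h2 : imL (Complex.I • w) = reL w := by ext i; simp [reL, imL]
    show (L.symm (reL (Complex.I • w)), L.symm (imL (Complex.I • w))) = _
    rw [h1, h2, map_neg]; rfl
  have hd : DifferentiableOn ℂ (F ∘ Θ) (Θ ⁻¹' D) := by
    intro w hw
    have h1 : HasFDerivAt (F ∘ Θ) (fderiv ℝ F (Θ w) ∘L Θ) w :=
      ((hF.2.1.differentiableAt (hF.1.mem_nhds hw)).hasFDerivAt).comp w Θ.hasFDerivAt
    let A : (Fin N → ℂ) →L[ℝ] ℂ := fderiv ℝ F (Θ w) ∘L Θ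
    have hA : ∀ v, A (Complex.I • v) = Complex.I * A v := by
      intro v
      show fderiv ℝ F (Θ w) (Θ (Complex.I • v)) = Complex.I * fderiv ℝ F (Θ w) (Θ v)
      rw [hΘI]
      exact hF.2.2 _ hw _ _
    let A' : (Fin N → ℂ) →ₗ[ℂ] ℂ :=
      { toFun := A
        map_add' := map_add A
        map_smul' := fun z v => by
          have : z • v = z.re • v + z.im • (Complex.I • v) := by
            ext i
            simp only [Pi.smul_apply, Pi.add_apply, smul_eq_mul, Complex.real_smul]
            conv_lhs => rw [← Complex.re_add_im z]
            ring
          rw [this, map_add, map_smul, map_smul, hA, RingHom.id_apply, smul_eq_mul]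
          conv_rhs => rw [← Complex.re_add_im z]
          simp only [Complex.real_smul]
          ring }
    have h2 : HasFDerivAt (F ∘ Θ) A'.toContinuousLinearMap w :=
      hasFDerivAt_of_restrictScalars ℝ h1 (by ext v; rfl)
    exact h2.differentiableAt.differentiableWithinAt
  have hpre : Ξ p ∈ Θ ⁻¹' D := by simpa [hΘΞ] using hp
  have h3 := (analyticAt_of_differentiableOn_pi (hF.1.preimage Θ.continuous) hd hpre).restrictScalars
    (𝕜 := ℝ)
  have h4 : F = (F ∘ Θ) ∘ Ξ := by funext q; simp [hΘΞ]
  rw [h4]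
  exact (h3.contDiffAt).comp p Ξ.contDiff.contDiffAt

end Cauchy

/-! ## Functionals represented by boundary values along a ray -/

section Wedge

variable {E : Type*} [NormedAddCommGroup E] [NormedSpace ℝ E]

/-- Complex valued test functions with support in `U`. -/
structure IsTest (U : Set E) (φ : E → ℂ) : Prop where
  contDiff : ContDiff ℝ ∞ φ
  compact : HasCompactSupport φ
  subset : tsupport φ ⊆ U

/-- The Cauchy-Riemann operator `∂_s - i ∂_v`. -/
def dbar (v : E) (Ψ : E → ℝ → ℂ) (x : E) (s : ℝ) : ℂ :=
  fderiv ℝ (Function.uncurry Ψ) (x, s) (0, 1)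
    - Complex.I * fderiv ℝ (Function.uncurry Ψ) (x, s) (v, 0)

/-- `T` is, on test functions supported in the ball, the boundary value of a temperate function
`F x t`, holomorphic in the direction `v` (`F x t` stands for `F(x + itv)`). -/
structure WedgeRep [MeasureSpace E] (T : (E → ℂ) → ℂ) (x₀ : E) (r : ℝ) (v : E) where
  F : E → ℝ → ℂ
  t₀ : ℝ
  C : ℝ
  m : ℕ
  t₀_pos : 0 < t₀
  contDiffAt : ∀ x ∈ Metric.ball x₀ r, ∀ t ∈ Ioo 0 t₀,
    ContDiffAt ℝ 1 (Function.uncurry F) (x, t)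
  dbar_eq : ∀ x ∈ Metric.ball x₀ r, ∀ t ∈ Ioo 0 t₀, dbar v F x t = 0
  bound : ∀ x ∈ Metric.ball x₀ r, ∀ t ∈ Ioo 0 t₀, ‖F x t‖ * t ^ m ≤ C
  limit : ∀ φ, IsTest (Metric.ball x₀ r) φ →
    Tendsto (fun t => ∫ x, F x t * φ x) (𝓝[>] 0) (𝓝 (T φ))

variable [FiniteDimensional ℝ E] [MeasureSpace E] [BorelSpace E]
  [(volume : Measure E).IsAddHaarMeasure]

theorem integral_lineDeriv_eq_zero {μ : Measure E} [μ.IsAddHaarMeasure] {f f' : E → ℂ} {v : E}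
    (hf : Integrable f μ) (hf' : Integrable f' μ) (h : ∀ x, HasLineDerivAt ℝ f (f' x) x v) :
    ∫ x, f' x ∂μ = 0 := by
  have := integral_bilinear_hasLineDerivAt_right_eq_neg_left_of_integrable (μ := μ)
    (f := fun _ : E => (1 : ℂ)) (f' := fun _ => 0) (g := f) (g' := f') (v := v)
    (B := ContinuousLinearMap.mul ℝ ℂ) (by simp) (by simpa using hf') (by simpa using hf)
    (fun x _ => by
      have := (hasFDerivAt_const (𝕜 := ℝ) (1 : ℂ) x).hasLineDerivAt v
      simpa using this) (fun x _ => h x)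
  simpa using this

/-- Stokes' theorem in the strip: since `F` is annihilated by `∂_s - i∂_v`, the `s`-derivative of
`FΨ` is `i∂_v(FΨ) + F · dbar Ψ`, and the integral over `x` of the first term vanishes because `Ψ`
has compact support in `x`. -/
theorem hasDerivAt_integral_mul {F Ψ : E → ℝ → ℂ} {x₀ v : E} {r t₀ : ℝ}
    (hF : ∀ x ∈ Metric.ball x₀ r, ∀ t ∈ Ioo 0 t₀, ContDiffAt ℝ 1 (Function.uncurry F) (x, t))
    (hF' : ∀ x ∈ Metric.ball x₀ r, ∀ t ∈ Ioo 0 t₀, dbar v F x t = 0)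
    {K : Set E} (hK : IsCompact K) (hKr : K ⊆ Metric.ball x₀ r)
    (hΨ : ContDiff ℝ 1 (Function.uncurry Ψ)) (hΨK : ∀ x ∉ K, ∀ s, Ψ x s = 0)
    {s : ℝ} (hs : s ∈ Ioo 0 t₀) :
    HasDerivAt (fun s => ∫ x, F x s * Ψ x s) (∫ x, F x s * dbar v Ψ x s) s := by
  set Θ : E × ℝ → ℂ := fun p => F p.1 p.2 * Ψ p.1 p.2 with hΘ
  have hzero : ∀ (G : E → ℝ → ℂ), (∀ x ∉ K, ∀ s, G x s = 0) → ∀ x ∉ K, ∀ s,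
      Function.uncurry G =ᶠ[𝓝 (x, s)] fun _ => 0 := by
    intro G hG x hx s
    have : Kᶜ ×ˢ (univ : Set ℝ) ∈ 𝓝 (x, s) :=
      prod_mem_nhds (hK.isClosed.isOpen_compl.mem_nhds hx) univ_mem
    filter_upwards [this] with q hq
    exact hG _ hq.1 _
  have hΘ0 : ∀ x ∉ K, ∀ s, Θ =ᶠ[𝓝 (x, s)] fun _ => 0 :=
    hzero (fun x s => F x s * Ψ x s) fun x hx s => by simp [hΨK x hx s]
  have hΘc : ∀ x, ∀ s ∈ Ioo 0 t₀, ContDiffAt ℝ 1 Θ (x, s) := by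
    intro x s hs
    by_cases hx : x ∈ K
    · exact (hF x (hKr hx) s hs).mul hΨ.contDiffAt
    · exact contDiffAt_const.congr_of_eventuallyEq (hΘ0 x hx s)
  have hΘd0 : ∀ x ∉ K, ∀ s, fderiv ℝ Θ (x, s) = 0 := fun x hx s => by
    rw [(hΘ0 x hx s).fderiv_eq]; simp
  have hΘd : ∀ x, ∀ s ∈ Ioo 0 t₀, HasFDerivAt Θ (fderiv ℝ Θ (x, s)) (x, s) := fun x s hs =>
    ((hΘc x s hs).differentiableAt one_ne_zero).hasFDerivAt
  have hcont : ContinuousOn (fderiv ℝ Θ) (univ ×ˢ Ioo 0 t₀) := fun p hp =>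
    ((hΘc p.1 p.2 hp.2).fderiv_right (m := 0) (by norm_num)).continuousAt.continuousWithinAt
  obtain ⟨a, ha, hsa⟩ := exists_between hs.1
  obtain ⟨b, hsb, hb⟩ := exists_between hs.2
  have hab : Icc a b ⊆ Ioo 0 t₀ := fun x hx => ⟨ha.trans_le hx.1, hx.2.trans_lt hb⟩
  obtain ⟨M, hM⟩ := (hK.prod (isCompact_Icc (a := a) (b := b))).exists_bound_of_continuousOn
    (f := fderiv ℝ Θ) (hcont.mono (prod_mono (subset_univ _) hab))
  have hM0 : ∀ x, ∀ s ∈ Icc a b, ‖fderiv ℝ Θ (x, s)‖ ≤ K.indicator (fun _ => M) x := by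
    intro x s hs
    by_cases hx : x ∈ K
    · rw [indicator_of_mem hx]; exact hM (x, s) ⟨hx, hs⟩
    · rw [indicator_of_notMem hx, hΘd0 x hx s, norm_zero]
  have hMint : Integrable (K.indicator fun _ => M) (volume : Measure E) :=
    (integrable_indicator_iff hK.isClosed.measurableSet).2
      (integrableOn_const hK.measure_lt_top.ne)
  have hslice : ∀ s ∈ Ioo 0 t₀, Continuous fun x => Θ (x, s) := fun s hs =>
    continuous_iff_continuousAt.2 fun x =>
      ContinuousAt.comp (f := fun x => (x, s)) (hΘc x s hs).continuousAt (by fun_prop)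
  have hslice' : ∀ w, Continuous fun x => fderiv ℝ Θ (x, s) w := fun w => by
    have h1 : Continuous fun x => fderiv ℝ Θ (x, s) :=
      hcont.comp_continuous (by fun_prop) fun x => ⟨mem_univ _, hs⟩
    fun_prop
  have hcs : ∀ s ∈ Ioo 0 t₀, Integrable fun x => Θ (x, s) := fun s hs =>
    (hslice s hs).integrable_of_hasCompactSupport
      (HasCompactSupport.intro hK fun x hx => (hΘ0 x hx s).self_of_nhds)
  have hcs' : ∀ w, Integrable fun x => fderiv ℝ Θ (x, s) w := fun w =>
    (hslice' w).integrable_of_hasCompactSupport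
      (HasCompactSupport.intro hK fun x hx => by simp [hΘd0 x hx s])
  have hder := (hasDerivAt_integral_of_dominated_loc_of_deriv_le (μ := volume)
    (F := fun s x => Θ (x, s)) (F' := fun s x => fderiv ℝ Θ (x, s) (0, 1))
    (bound := fun x => K.indicator (fun _ => M) x * ‖((0 : E), (1 : ℝ))‖)
    (s := Icc a b) (x₀ := s) (Icc_mem_nhds hsa hsb)
    (by
      filter_upwards [Icc_mem_nhds hsa hsb] with s hs
      exact (hslice s (hab hs)).aestronglyMeasurable)
    (hcs s hs) (hslice' _).aestronglyMeasurable
    (.of_forall fun x s hs => ContinuousLinearMap.le_of_opNorm_le _ (hM0 x s hs) _)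
    (hMint.mul_const _)
    (.of_forall fun x s hs => by
      have h1 : HasDerivAt (fun s : ℝ => (x, s)) ((0 : E), (1 : ℝ)) s :=
        (hasDerivAt_const s x).prodMk (hasDerivAt_id s)
      exact (hΘd x s (hab hs)).comp_hasDerivAt s h1)).2
  convert! hder using 1
  have hline : ∫ x, fderiv ℝ Θ (x, s) (v, 0) = 0 := by
    refine integral_lineDeriv_eq_zero (v := v) (hcs s hs) (hcs' _) fun x => ?_
    have h1 : HasFDerivAt (fun x : E => (x, s)) (ContinuousLinearMap.inl ℝ E ℝ) x :=
      hasFDerivAt_prodMk_left x s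
    exact ((hΘd x s hs).comp x h1).hasLineDerivAt v
  have hpt : ∀ x, fderiv ℝ Θ (x, s) (0, 1)
      = Complex.I * fderiv ℝ Θ (x, s) (v, 0) + F x s * dbar v Ψ x s := by
    intro x
    by_cases hx : x ∈ K
    · have hd1 := ((hF x (hKr hx) s hs).differentiableAt one_ne_zero).hasFDerivAt
      have hd2 := (hΨ.contDiffAt (x := (x, s))).differentiableAt one_ne_zero |>.hasFDerivAt
      have h3 : fderiv ℝ Θ (x, s) = _ := (hd1.mul hd2).fderiv
      have h4 := hF' x (hKr hx) s hs
      rw [dbar] at h4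
      rw [h3, dbar]
      simp only [FunLike.coe_add, FunLike.coe_smul, Pi.add_apply, Pi.smul_apply, smul_eq_mul,
        Function.uncurry]
      linear_combination Ψ x s * h4
    · have h5 : dbar v Ψ x s = 0 := by
        rw [dbar, (hzero Ψ hΨK x hx s).fderiv_eq]; simp
      rw [hΘd0 x hx s, h5]; simp
  have hint2 : Integrable fun x => F x s * dbar v Ψ x s := by
    have : (fun x => F x s * dbar v Ψ x s) = fun x => fderiv ℝ Θ (x, s) (0, 1)
        - Complex.I * fderiv ℝ Θ (x, s) (v, 0) := by
      funext x; rw [hpt x]; ring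
    rw [this]
    exact (hcs' _).sub ((hcs' _).const_mul _)
  simp_rw [hpt]
  rw [integral_add ((hcs' _).const_mul _) hint2, integral_const_mul, hline, mul_zero, zero_add]

theorem dbar_shift (v : E) (Ψ : E → ℝ → ℂ) (t : ℝ) (x : E) (s : ℝ) :
    dbar v (fun x s => Ψ x (s - t)) x s = dbar v Ψ x (s - t) := by
  have : Function.uncurry (fun x s => Ψ x (s - t))
      = fun p : E × ℝ => Function.uncurry Ψ (p + (0, -t)) := by
    funext p; simp [Function.uncurry, sub_eq_add_neg]
  rw [dbar, dbar, this, fderiv_comp_add_right]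
  simp [sub_eq_add_neg]

/-- The estimate given by the deformation of the contour from `x + itv` to `x + it₁v`. -/
theorem WedgeRep.norm_integral_le {T : (E → ℂ) → ℂ} {x₀ v : E} {r : ℝ} (W : WedgeRep T x₀ r v)
    {K : Set E} (hK : IsCompact K) (hKr : K ⊆ Metric.ball x₀ r) {t₁ : ℝ} (ht₁ : 0 < t₁)
    (ht₁' : t₁ < W.t₀) : ∃ A, 0 ≤ A ∧ ∀ (Ψ : E → ℝ → ℂ) (B : ℝ),
      ContDiff ℝ 1 (Function.uncurry Ψ) → (∀ x ∉ K, ∀ s, Ψ x s = 0) → 0 ≤ B →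
      (∀ x ∈ K, ∀ s ∈ Icc (t₁ / 2) t₁, ‖Ψ x s‖ ≤ B) →
      (∀ x ∈ K, ∀ s ∈ Icc 0 t₁, ‖dbar v Ψ x s‖ ≤ B * s ^ W.m) →
      ∀ t ∈ Ioc 0 (t₁ / 2), ‖∫ x, W.F x t * Ψ x 0‖ ≤ A * B := by
  rcases K.eq_empty_or_nonempty with rfl | ⟨z, hz⟩
  · refine ⟨0, le_rfl, fun Ψ B _ h _ _ _ t _ => ?_⟩
    simp [h _ (notMem_empty _)]
  have hC : 0 ≤ W.C := (by positivity : 0 ≤ ‖W.F z t₁‖ * t₁ ^ W.m).trans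
    (W.bound z (hKr hz) t₁ ⟨ht₁, ht₁'⟩)
  set vol := volume.real K
  refine ⟨W.C * (t₁ ^ W.m)⁻¹ * vol + W.C * vol * t₁, by positivity, ?_⟩
  intro Ψ B hΨ hΨK hB h1 h2 t ht
  have hset : ∀ G : E → ℂ, (∀ x ∉ K, G x = 0) → ∀ M, (∀ x ∈ K, ‖G x‖ ≤ M) →
      ‖∫ x, G x‖ ≤ M * vol := by
    intro G hG M hM
    rw [← setIntegral_eq_integral_of_forall_compl_eq_zero hG]
    exact norm_setIntegral_le_of_norm_le_const hK.measure_lt_top hM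
  -- The extension is shifted so that it starts at height `t`: at `s = t` it equals `Ψ x 0`, the
  -- function being tested. The integrand at the end point `t₁` and along the way then has bounds
  -- independent of `t`.
  set Ψ' : E → ℝ → ℂ := fun x s => Ψ x (s - t)
  have hΨ' : ContDiff ℝ 1 (Function.uncurry Ψ') :=
    hΨ.comp (g := Function.uncurry Ψ) (f := fun p : E × ℝ => (p.1, p.2 - t)) (by fun_prop)
  have hdb0 : ∀ x ∉ K, ∀ s, dbar v Ψ x s = 0 := by
    intro x hx s
    have : Function.uncurry Ψ =ᶠ[𝓝 (x, s)] fun _ => 0 := by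
      have : Kᶜ ×ˢ (univ : Set ℝ) ∈ 𝓝 (x, s) :=
        prod_mem_nhds (hK.isClosed.isOpen_compl.mem_nhds hx) univ_mem
      filter_upwards [this] with q hq
      exact hΨK _ hq.1 _
    rw [dbar, this.fderiv_eq]; simp
  have htt : t ≤ t₁ := by linarith [ht.2]
  have hmv := norm_image_sub_le_of_norm_deriv_le_segment' (a := t) (b := t₁)
    (f := fun s => ∫ x, W.F x s * Ψ' x s) (f' := fun s => ∫ x, W.F x s * dbar v Ψ' x s)
    (C := W.C * B * vol)
    (fun s hs => (hasDerivAt_integral_mul W.contDiffAt W.dbar_eq hK hKr hΨ'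
      (fun x hx s => hΨK x hx _) ⟨ht.1.trans_le hs.1, hs.2.trans_lt ht₁'⟩).hasDerivWithinAt)
    (fun s hs => by
      refine hset _ (fun x hx => by rw [dbar_shift, hdb0 x hx, mul_zero]) _ fun x hx => ?_
      have hs0 : 0 < s := ht.1.trans_le hs.1
      rw [dbar_shift, norm_mul]
      have h3 := h2 x hx (s - t) ⟨by linarith [hs.1], by linarith [hs.2, ht.1]⟩
      -- The vanishing of `dbar Ψ` to order `m` at height zero compensates the growth `s ^ (-m)` of
      -- `F`.
      have h4 : (s - t) ^ W.m ≤ s ^ W.m :=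
        pow_le_pow_left₀ (by linarith [hs.1]) (by linarith [ht.1]) _
      calc ‖W.F x s‖ * ‖dbar v Ψ x (s - t)‖ ≤ ‖W.F x s‖ * (B * s ^ W.m) := by gcongr; exact h3.trans (by gcongr)
        _ = (‖W.F x s‖ * s ^ W.m) * B := by ring
        _ ≤ W.C * B := by
          gcongr
          exact W.bound x (hKr hx) s ⟨hs0, hs.2.trans ht₁'⟩)
    t₁ ⟨htt, le_rfl⟩
  have hend : ‖∫ x, W.F x t₁ * Ψ' x t₁‖ ≤ W.C * (t₁ ^ W.m)⁻¹ * B * vol := by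
    refine hset _ (fun x hx => by simp [Ψ', hΨK x hx]) _ fun x hx => ?_
    rw [norm_mul]
    have h3 := h1 x hx (t₁ - t) ⟨by linarith [ht.2], by linarith [ht.1]⟩
    have h4 : ‖W.F x t₁‖ ≤ W.C * (t₁ ^ W.m)⁻¹ := by
      rw [← div_eq_mul_inv, le_div_iff₀ (by positivity)]
      exact W.bound x (hKr hx) t₁ ⟨ht₁, ht₁'⟩
    gcongr
  have hst : (fun x => W.F x t * Ψ x 0) = fun x => W.F x t * Ψ' x t := by
    funext x; simp [Ψ']
  rw [hst]
  have h5 : ‖∫ x, W.F x t * Ψ' x t‖ ≤ ‖∫ x, W.F x t₁ * Ψ' x t₁‖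
      + ‖(∫ x, W.F x t₁ * Ψ' x t₁) - ∫ x, W.F x t * Ψ' x t‖ := by
    have := norm_sub_le (∫ x, W.F x t₁ * Ψ' x t₁)
      ((∫ x, W.F x t₁ * Ψ' x t₁) - ∫ x, W.F x t * Ψ' x t)
    simpa using this
  have h6 : W.C * B * vol * (t₁ - t) ≤ W.C * B * vol * t₁ := by
    gcongr; linarith [ht.1]
  calc _ ≤ _ := h5
    _ ≤ W.C * (t₁ ^ W.m)⁻¹ * B * vol + W.C * B * vol * t₁ := add_le_add hend (hmv.trans h6)
    _ = _ := by ring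

end Wedge

/-! ### Almost analytic extensions and the Cauchy-Riemann operator. -/

section Extension

variable {E : Type*} [NormedAddCommGroup E] [NormedSpace ℝ E]

theorem dbar_eq_of_hasDerivAt {v : E} {Ψ : E → ℝ → ℂ} {x : E} {s : ℝ} {a b : ℂ}
    (h : DifferentiableAt ℝ (Function.uncurry Ψ) (x, s)) (ha : HasDerivAt (Ψ x) a s)
    (hb : HasDerivAt (fun t : ℝ => Ψ (x + t • v) s) b 0) : dbar v Ψ x s = a - Complex.I * b := by
  have h1 : HasDerivAt (fun s : ℝ => (x, s)) ((0 : E), (1 : ℝ)) s :=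
    (hasDerivAt_const s x).prodMk (hasDerivAt_id s)
  have h2 : HasDerivAt (fun t : ℝ => (x + t • v, s)) (v, (0 : ℝ)) 0 := by
    have : HasDerivAt (fun t : ℝ => x + t • v) ((1 : ℝ) • v) 0 :=
      ((hasDerivAt_id (0 : ℝ)).smul_const v).const_add x
    rw [one_smul] at this
    exact this.prodMk (hasDerivAt_const (0 : ℝ) s)
  have h3 : HasFDerivAt (Function.uncurry Ψ) (fderiv ℝ (Function.uncurry Ψ) (x, s))
      ((fun t : ℝ => (x + t • v, s)) 0) := by simpa using h.hasFDerivAt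
  have e1 := (h.hasFDerivAt.comp_hasDerivAt s h1).unique ha
  have h4 := h3.comp_hasDerivAt (0 : ℝ) h2
  have e2 := h4.unique hb
  rw [dbar, e1, e2]

theorem dbar_add {v : E} {Ψ₁ Ψ₂ : E → ℝ → ℂ} {x : E} {s : ℝ}
    (h₁ : DifferentiableAt ℝ (Function.uncurry Ψ₁) (x, s))
    (h₂ : DifferentiableAt ℝ (Function.uncurry Ψ₂) (x, s)) :
    dbar v (fun x s => Ψ₁ x s + Ψ₂ x s) x s = dbar v Ψ₁ x s + dbar v Ψ₂ x s := by
  have h := (h₁.hasFDerivAt.add h₂.hasFDerivAt).fderiv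
  have : Function.uncurry (fun x s => Ψ₁ x s + Ψ₂ x s)
      = Function.uncurry Ψ₁ + Function.uncurry Ψ₂ := rfl
  rw [dbar, this, h, dbar, dbar]
  simp only [FunLike.coe_add, Pi.add_apply]
  ring

theorem dbar_mul {v : E} {Ψ₁ Ψ₂ : E → ℝ → ℂ} {x : E} {s : ℝ}
    (h₁ : DifferentiableAt ℝ (Function.uncurry Ψ₁) (x, s))
    (h₂ : DifferentiableAt ℝ (Function.uncurry Ψ₂) (x, s)) :
    dbar v (fun x s => Ψ₁ x s * Ψ₂ x s) x s
      = dbar v Ψ₁ x s * Ψ₂ x s + Ψ₁ x s * dbar v Ψ₂ x s := by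
  have h := (h₁.hasFDerivAt.mul h₂.hasFDerivAt).fderiv
  have : Function.uncurry (fun x s => Ψ₁ x s * Ψ₂ x s)
      = Function.uncurry Ψ₁ * Function.uncurry Ψ₂ := rfl
  rw [dbar, this, h, dbar, dbar]
  simp only [FunLike.coe_add, FunLike.coe_smul, Pi.add_apply, Pi.smul_apply, smul_eq_mul,
    Function.uncurry]
  ring

/-- The derivative in the direction `v`. -/
def dirDeriv (v : E) (φ : E → ℂ) (x : E) : ℂ := fderiv ℝ φ x v

theorem contDiff_dirDeriv {v : E} {φ : E → ℂ} (hφ : ContDiff ℝ ∞ φ) :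
    ContDiff ℝ ∞ (dirDeriv v φ) :=
  (hφ.fderiv_right (m := ∞) (by simp)).clm_apply contDiff_const

theorem contDiff_dirDeriv_iterate {v : E} {φ : E → ℂ} (hφ : ContDiff ℝ ∞ φ) (k : ℕ) :
    ContDiff ℝ ∞ ((dirDeriv v)^[k] φ) := by
  induction k with
  | zero => exact hφ
  | succ k ih => rw [Function.iterate_succ_apply']; exact contDiff_dirDeriv ih

theorem dirDeriv_eventuallyEq {v : E} {φ ψ : E → ℂ} {x : E} (h : φ =ᶠ[𝓝 x] ψ) :
    dirDeriv v φ =ᶠ[𝓝 x] dirDeriv v ψ := by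
  filter_upwards [h.eventuallyEq_nhds] with y hy
  rw [dirDeriv, dirDeriv, hy.fderiv_eq]

theorem dirDeriv_iterate_eventuallyEq {v : E} {φ ψ : E → ℂ} {x : E} (h : φ =ᶠ[𝓝 x] ψ) (k : ℕ) :
    (dirDeriv v)^[k] φ =ᶠ[𝓝 x] (dirDeriv v)^[k] ψ := by
  induction k with
  | zero => exact h
  | succ k ih =>
    rw [Function.iterate_succ_apply', Function.iterate_succ_apply']
    exact dirDeriv_eventuallyEq ih

theorem dirDeriv_iterate_const {v : E} (c : ℂ) (k : ℕ) :
    (dirDeriv v)^[k + 1] (fun _ : E => c) = fun _ => 0 := by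
  induction k with
  | zero => funext x; simp [dirDeriv]
  | succ k ih =>
    rw [Function.iterate_succ_apply', ih]
    funext x; simp [dirDeriv]

theorem dirDeriv_iterate_zero {v : E} (k : ℕ) :
    (dirDeriv v)^[k] (fun _ : E => (0 : ℂ)) = fun _ => 0 := by
  cases k with
  | zero => rfl
  | succ k => exact dirDeriv_iterate_const 0 k

theorem dirDeriv_iterate_eq_zero {v : E} {φ : E → ℂ} {x : E} (hx : x ∉ tsupport φ) (k : ℕ) :
    (dirDeriv v)^[k] φ x = 0 := by
  have h : φ =ᶠ[𝓝 x] fun _ => 0 := notMem_tsupport_iff_eventuallyEq.1 hx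
  rw [(dirDeriv_iterate_eventuallyEq h k).self_of_nhds, dirDeriv_iterate_zero]

/-- The almost analytic extension `∑_{k ≤ m} (is)^k/k! ∂_v^k φ` of `φ` in the direction `v`. -/
def almostAnalytic (v : E) (m : ℕ) (φ : E → ℂ) (x : E) (s : ℝ) : ℂ :=
  ∑ k ∈ Finset.range (m + 1), (Complex.I * s) ^ k / (k.factorial : ℂ) * (dirDeriv v)^[k] φ x

theorem contDiff_almostAnalytic {v : E} {m : ℕ} {φ : E → ℂ} (hφ : ContDiff ℝ ∞ φ) :
    ContDiff ℝ ∞ (Function.uncurry (almostAnalytic v m φ)) := by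
  unfold Function.uncurry almostAnalytic
  refine ContDiff.sum fun k _ => ?_
  have h1 : ContDiff ℝ ∞ fun p : E × ℝ => (p.2 : ℂ) :=
    Complex.ofRealCLM.contDiff.comp contDiff_snd
  have h2 : ContDiff ℝ ∞ fun p : E × ℝ => (dirDeriv v)^[k] φ p.1 :=
    (contDiff_dirDeriv_iterate hφ k).comp contDiff_fst
  exact (((contDiff_const.mul h1).pow k).div_const _).mul h2

theorem almostAnalytic_zero (v : E) (m : ℕ) (φ : E → ℂ) (x : E) :
    almostAnalytic v m φ x 0 = φ x := by
  rw [almostAnalytic, Finset.sum_eq_single 0]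
  · simp
  · intro k _ hk; simp [hk]
  · simp

theorem almostAnalytic_eq_zero {v : E} {m : ℕ} {φ : E → ℂ} {x : E} (hx : x ∉ tsupport φ) (s : ℝ) :
    almostAnalytic v m φ x s = 0 :=
  Finset.sum_eq_zero fun k _ => by rw [dirDeriv_iterate_eq_zero hx, mul_zero]

/-- The sum telescopes: the `s`-derivative of each term cancels `i∂_v` of the preceding one, and
only `∂_v` of the last term survives, which is of order `s ^ m`. -/
theorem dbar_almostAnalytic {v : E} {φ : E → ℂ} (hφ : ContDiff ℝ ∞ φ) (m : ℕ) (x : E) (s : ℝ) :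
    dbar v (almostAnalytic v m φ) x s
      = -Complex.I * ((Complex.I * s) ^ m / (m.factorial : ℂ)) * (dirDeriv v)^[m + 1] φ x := by
  have hline : ∀ k, HasDerivAt (fun t : ℝ => (dirDeriv v)^[k] φ (x + t • v))
      ((dirDeriv v)^[k + 1] φ x) 0 := by
    intro k
    have h1 := ((contDiff_dirDeriv_iterate (v := v) hφ k).differentiable (by simp) x).hasFDerivAt
    rw [Function.iterate_succ_apply']
    exact h1.hasLineDerivAt v
  have hpow : ∀ k : ℕ, HasDerivAt (fun s : ℝ => (Complex.I * s) ^ (k + 1) / ((k + 1).factorial : ℂ))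
      (Complex.I * ((Complex.I * s) ^ k / (k.factorial : ℂ))) s := by
    intro k
    have h1 : HasDerivAt (fun s : ℝ => Complex.I * (s : ℂ)) (Complex.I * 1) s :=
      (Complex.ofRealCLM.hasDerivAt (x := s)).const_mul _
    convert! (h1.pow (k + 1)).div_const ((k + 1).factorial : ℂ) using 1
    have : ((k : ℂ) + 1) ≠ 0 := Nat.cast_add_one_ne_zero k
    have h3 : (k.factorial : ℂ) ≠ 0 := by exact_mod_cast k.factorial_ne_zero
    rw [Nat.factorial_succ]; push_cast
    field_simp
    try simp
  induction m with
  | zero =>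
    have h0 : almostAnalytic v 0 φ = fun x _ => φ x := by
      funext x s; simp [almostAnalytic]
    have hc0 : ContDiff ℝ ∞ (Function.uncurry fun (x : E) (_ : ℝ) => φ x) :=
      hφ.comp contDiff_fst
    rw [h0, dbar_eq_of_hasDerivAt (a := 0) (b := (dirDeriv v)^[1] φ x)
      (hc0.differentiable (by simp) _) (hasDerivAt_const _ _) (hline 0)]
    simp
  | succ m ih =>
    have hs : almostAnalytic v (m + 1) φ = fun x s => almostAnalytic v m φ x s
        + (Complex.I * s) ^ (m + 1) / ((m + 1).factorial : ℂ) * (dirDeriv v)^[m + 1] φ x := by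
      funext x s; exact Finset.sum_range_succ _ _
    have hc : ContDiff ℝ ∞ (Function.uncurry fun (x : E) (s : ℝ) =>
        (Complex.I * s) ^ (m + 1) / ((m + 1).factorial : ℂ) * (dirDeriv v)^[m + 1] φ x) := by
      have h1 : ContDiff ℝ ∞ fun p : E × ℝ => (p.2 : ℂ) :=
        Complex.ofRealCLM.contDiff.comp contDiff_snd
      exact (((contDiff_const.mul h1).pow _).div_const _).mul
        ((contDiff_dirDeriv_iterate hφ _).comp contDiff_fst)
    rw [hs, dbar_add ((contDiff_almostAnalytic hφ).differentiable (by simp) _)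
      (hc.differentiable (by simp) _), ih,
      dbar_eq_of_hasDerivAt (hc.differentiable (by simp) _) ((hpow m).mul_const _)
        ((hline (m + 1)).const_mul _)]
    ring

variable {N : ℕ} (L : E ≃L[ℝ] (Fin N → ℝ))

/-- The complex coordinates of `x + isv`. -/
def cpt (v : E) (x : E) (s : ℝ) : Fin N → ℂ := fun i => (L x i : ℂ) + Complex.I * s * (L v i : ℂ)

theorem contDiff_cpt (v : E) {k : WithTop ℕ∞} : ContDiff ℝ k (Function.uncurry (cpt L v)) := by
  refine contDiff_pi.2 fun i => ?_
  have h1 : ContDiff ℝ k fun p : E × ℝ => (p.2 : ℂ) := Complex.ofRealCLM.contDiff.comp contDiff_snd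
  have h2 : ContDiff ℝ k fun p : E × ℝ => ((L p.1 i : ℝ) : ℂ) :=
    (Complex.ofRealCLM ∘L ContinuousLinearMap.proj i ∘L L.toContinuousLinearMap).contDiff.comp
      contDiff_fst
  exact h2.add ((contDiff_const.mul h1).mul contDiff_const)

theorem contDiff_real_of_differentiable {e : (Fin N → ℂ) → ℂ} (he : Differentiable ℂ e)
    {k : WithTop ℕ∞} : ContDiff ℝ k e :=
  contDiff_iff_contDiffAt.2 fun c => ((analyticAt_of_differentiableOn_pi isOpen_univ
    he.differentiableOn (mem_univ c)).restrictScalars (𝕜 := ℝ)).contDiffAt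

theorem dbar_comp_cpt {e : (Fin N → ℂ) → ℂ} (he : Differentiable ℂ e) (v x : E) (s : ℝ) :
    dbar v (fun x s => e (cpt L v x s)) x s = 0 := by
  have hd : DifferentiableAt ℝ (Function.uncurry fun x s => e (cpt L v x s)) (x, s) :=
    ((contDiff_real_of_differentiable he (k := 1)).comp (contDiff_cpt L v)).differentiable
      one_ne_zero _
  have hE : HasFDerivAt e ((fderiv ℂ e (cpt L v x s)).restrictScalars ℝ) (cpt L v x s) :=
    (he _).hasFDerivAt.restrictScalars ℝ
  have h1 : HasDerivAt (cpt L v x) (Complex.I • fun i => (L v i : ℂ)) s := by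
    refine hasDerivAt_pi.2 fun i => ?_
    have h1 : HasDerivAt (fun s : ℝ => Complex.I * (s : ℂ)) (Complex.I * 1) s :=
      (Complex.ofRealCLM.hasDerivAt (x := s)).const_mul _
    simpa [cpt] using! (h1.mul_const (L v i : ℂ)).const_add (L x i : ℂ)
  have h2 : HasDerivAt (fun t : ℝ => cpt L v (x + t • v) s) (fun i => (L v i : ℂ)) 0 := by
    refine hasDerivAt_pi.2 fun i => ?_
    have h1 : HasDerivAt (fun t : ℝ => (t : ℂ) * (L v i : ℂ)) (1 * (L v i : ℂ)) 0 :=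
      (Complex.ofRealCLM.hasDerivAt (x := (0 : ℝ))).mul_const _
    have h3 := (h1.const_add (L x i : ℂ)).add_const (Complex.I * s * (L v i : ℂ))
    simpa [cpt] using h3
  have hE' : HasFDerivAt e ((fderiv ℂ e (cpt L v x s)).restrictScalars ℝ)
      ((fun t : ℝ => cpt L v (x + t • v) s) 0) := by simpa using hE
  rw [dbar_eq_of_hasDerivAt hd (hE.comp_hasDerivAt s h1) (hE'.comp_hasDerivAt (0 : ℝ) h2)]
  simp

end Extension

/-! ### Bounds for boundary values, and exchange with parameter integrals. -/

section WedgeEstimates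

variable {E : Type*} [NormedAddCommGroup E] [NormedSpace ℝ E]

theorem exists_bound_dirDeriv {φ : E → ℂ} (hφ : ContDiff ℝ ∞ φ) {K : Set E} (hK : IsCompact K)
    (v : E) (k : ℕ) : ∃ C, 0 ≤ C ∧ ∀ x ∈ K, ‖(dirDeriv v)^[k] φ x‖ ≤ C := by
  obtain ⟨C, hC⟩ := hK.exists_bound_of_continuousOn
    (contDiff_dirDeriv_iterate (v := v) hφ k).continuous.continuousOn
  exact ⟨max C 0, le_max_right _ _, fun x hx => (hC x hx).trans (le_max_left _ _)⟩

theorem exists_bound_almostAnalytic {φ : E → ℂ} (hφ : ContDiff ℝ ∞ φ) {K : Set E}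
    (hK : IsCompact K) (v : E) (m : ℕ) (t₁ : ℝ) :
    ∃ C, 0 ≤ C ∧ ∀ x ∈ K, ∀ s ∈ Icc 0 t₁, ‖almostAnalytic v m φ x s‖ ≤ C := by
  obtain ⟨C, hC⟩ := (hK.prod (isCompact_Icc (a := 0) (b := t₁))).exists_bound_of_continuousOn
    (contDiff_almostAnalytic (v := v) (m := m) hφ).continuous.continuousOn
  exact ⟨max C 0, le_max_right _ _, fun x hx s hs => (hC (x, s) ⟨hx, hs⟩).trans (le_max_left _ _)⟩

theorem norm_dbar_almostAnalytic_le {v : E} {φ : E → ℂ} (hφ : ContDiff ℝ ∞ φ) (m : ℕ) (x : E)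
    {s : ℝ} (hs : 0 ≤ s) :
    ‖dbar v (almostAnalytic v m φ) x s‖ ≤ ‖(dirDeriv v)^[m + 1] φ x‖ * s ^ m := by
  rw [dbar_almostAnalytic hφ]
  simp only [norm_mul, norm_neg, Complex.norm_I, one_mul, norm_div, norm_pow, Complex.norm_real,
    Real.norm_eq_abs, abs_of_nonneg hs, Complex.norm_natCast]
  rw [mul_comm]
  refine mul_le_mul_of_nonneg_left (div_le_self (by positivity) ?_) (norm_nonneg _)
  exact_mod_cast Nat.one_le_iff_ne_zero.2 m.factorial_ne_zero

theorem cpt_zero {N : ℕ} (L : E ≃L[ℝ] (Fin N → ℝ)) (v x : E) :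
    cpt L v x 0 = fun i => (L x i : ℂ) := by
  funext i; simp [cpt]

variable [FiniteDimensional ℝ E] [MeasureSpace E] [BorelSpace E]
  [(volume : Measure E).IsAddHaarMeasure]

variable {N : ℕ} (L : E ≃L[ℝ] (Fin N → ℝ))

/-- The source of all exponential decay. The extension used is that of `χ` times the holomorphic
`e`, so `dbar` falls only on the cutoff and vanishes where `χ = 1`. Hence `e` has to be small only
near the top of the deformed contour or at distance at least `σ` from `x₀`, and not at the real
point `x₀` itself. -/
theorem WedgeRep.norm_integral_holomorphic_le {T : (E → ℂ) → ℂ} {x₀ v : E} {r : ℝ}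
    (W : WedgeRep T x₀ r v) {χ : E → ℂ} (hχ : IsTest (Metric.ball x₀ r) χ) {σ : ℝ}
    (hσ : ∀ x ∈ Metric.ball x₀ σ, χ x = 1) {t₁ : ℝ} (ht₁ : 0 < t₁) (ht₁' : t₁ < W.t₀) :
    ∃ A, 0 ≤ A ∧ ∀ (e : (Fin N → ℂ) → ℂ) (B : ℝ), Differentiable ℂ e → 0 ≤ B →
      (∀ x ∈ tsupport χ, ∀ s ∈ Icc 0 t₁, t₁ / 2 ≤ s ∨ σ ≤ dist x x₀ → ‖e (cpt L v x s)‖ ≤ B) →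
      ∀ t ∈ Ioc 0 (t₁ / 2), ‖∫ x, W.F x t * (χ x * e (fun i => (L x i : ℂ)))‖ ≤ A * B := by
  have hK : IsCompact (tsupport χ) := hχ.compact
  obtain ⟨A, hA0, hA⟩ := W.norm_integral_le hK hχ.subset ht₁ ht₁'
  obtain ⟨C₁, hC₁0, hC₁⟩ := exists_bound_almostAnalytic hχ.contDiff hK v W.m t₁
  obtain ⟨C₂, hC₂0, hC₂⟩ := exists_bound_dirDeriv hχ.contDiff hK v (W.m + 1)
  refine ⟨A * (C₁ + C₂), by positivity, fun e B he hB h t ht => ?_⟩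
  have hee : ContDiff ℝ ∞ (Function.uncurry fun x s => e (cpt L v x s)) :=
    (contDiff_real_of_differentiable he).comp (contDiff_cpt L v)
  have haa := contDiff_almostAnalytic (v := v) (m := W.m) hχ.contDiff
  have hΨ : ContDiff ℝ ∞ (Function.uncurry fun x s =>
      almostAnalytic v W.m χ x s * e (cpt L v x s)) := haa.mul hee
  have := hA (fun x s => almostAnalytic v W.m χ x s * e (cpt L v x s)) ((C₁ + C₂) * B)
    (hΨ.of_le (by simp))
    (fun x hx s => by simp only [almostAnalytic_eq_zero hx, zero_mul]) (by positivity)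
    (fun x hx s hs => by
      have hs' : s ∈ Icc 0 t₁ := ⟨by linarith [hs.1], hs.2⟩
      rw [norm_mul]
      refine mul_le_mul ?_ (h x hx s hs' (Or.inl hs.1)) (norm_nonneg _) (by positivity)
      linarith [hC₁ x hx s hs'])
    (fun x hx s hs => by
      rw [dbar_mul (haa.differentiable (by simp) _) (hee.differentiable (by simp) _),
        dbar_comp_cpt L he, mul_zero, add_zero, norm_mul]
      have h1 := norm_dbar_almostAnalytic_le (v := v) hχ.contDiff W.m x hs.1
      rcases lt_or_ge (dist x x₀) σ with hx' | hx'
      · have h2 : χ =ᶠ[𝓝 x] fun _ => 1 := by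
          filter_upwards [Metric.isOpen_ball.mem_nhds (Metric.mem_ball.2 hx')] with y hy
          exact hσ y hy
        rw [(dirDeriv_iterate_eventuallyEq h2 _).self_of_nhds, dirDeriv_iterate_const] at h1
        have h3 : ‖dbar v (almostAnalytic v W.m χ) x s‖ = 0 :=
          le_antisymm (by simpa using h1) (norm_nonneg _)
        rw [h3, zero_mul]
        have := hs.1
        positivity
      · have h2 := h x hx s hs (Or.inr hx')
        have hs0 := hs.1
        calc _ ≤ ((C₁ + C₂) * s ^ W.m) * B := by
              refine mul_le_mul (h1.trans ?_) h2 (norm_nonneg _) (by positivity)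
              gcongr
              linarith [hC₂ x hx]
          _ = _ := by ring)
    t ht
  simp only [almostAnalytic_zero, cpt_zero] at this
  rwa [mul_assoc]

/-- The finite order of a temperate boundary value: a smooth factor, not assumed holomorphic, enters
through its derivatives along `v` up to order `m + 1`, because it too is replaced by its almost
analytic extension. -/
theorem WedgeRep.norm_integral_mul_le {T : (E → ℂ) → ℂ} {x₀ v : E} {r : ℝ}
    (W : WedgeRep T x₀ r v) {χ : E → ℂ} (hχ : IsTest (Metric.ball x₀ r) χ) :
    ∃ t₁ A, 0 < t₁ ∧ 0 ≤ A ∧ ∀ (ψ : E → ℂ) (B : ℝ), ContDiff ℝ ∞ ψ → 0 ≤ B →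
      (∀ x, ∀ k ≤ W.m + 1, ‖(dirDeriv v)^[k] ψ x‖ ≤ B) →
      ∀ t ∈ Ioc 0 t₁, ‖∫ x, W.F x t * (χ x * ψ x)‖ ≤ A * B := by
  have hK : IsCompact (tsupport χ) := hχ.compact
  have ht₁ : 0 < W.t₀ / 2 := half_pos W.t₀_pos
  set t₁ := W.t₀ / 2
  obtain ⟨A, hA0, hA⟩ := W.norm_integral_le hK hχ.subset ht₁ (half_lt_self W.t₀_pos)
  obtain ⟨C₁, hC₁0, hC₁⟩ := exists_bound_almostAnalytic hχ.contDiff hK v W.m t₁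
  obtain ⟨C₂, hC₂0, hC₂⟩ := exists_bound_dirDeriv hχ.contDiff hK v (W.m + 1)
  set S : ℝ := ∑ k ∈ Finset.range (W.m + 1), t₁ ^ k with hS
  have hS0 : 0 ≤ S := Finset.sum_nonneg fun k _ => by positivity
  refine ⟨t₁ / 2, A * (C₁ * S + C₂ * S + C₁), by positivity, by positivity,
    fun ψ B hψ hB h t ht => ?_⟩
  have haa := contDiff_almostAnalytic (v := v) (m := W.m) hχ.contDiff
  have hbb := contDiff_almostAnalytic (v := v) (m := W.m) hψ
  have hΨ : ContDiff ℝ ∞ (Function.uncurry fun x s =>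
      almostAnalytic v W.m χ x s * almostAnalytic v W.m ψ x s) := haa.mul hbb
  have hψb : ∀ x, ∀ s ∈ Icc 0 t₁, ‖almostAnalytic v W.m ψ x s‖ ≤ S * B := by
    intro x s hs
    rw [almostAnalytic, hS, Finset.sum_mul]
    refine norm_sum_le_of_le _ fun k hk => ?_
    rw [norm_mul]
    refine mul_le_mul ?_ (h x k (Nat.le_succ_of_le (Nat.lt_succ_iff.1 (Finset.mem_range.1 hk))))
      (norm_nonneg _) (by positivity)
    simp only [norm_mul, Complex.norm_I, one_mul, norm_div, norm_pow, Complex.norm_real,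
      Real.norm_eq_abs, abs_of_nonneg hs.1, Complex.norm_natCast]
    refine (div_le_self (pow_nonneg hs.1 _) ?_).trans (pow_le_pow_left₀ hs.1 hs.2 _)
    exact_mod_cast Nat.one_le_iff_ne_zero.2 k.factorial_ne_zero
  have := hA (fun x s => almostAnalytic v W.m χ x s * almostAnalytic v W.m ψ x s)
    ((C₁ * S + C₂ * S + C₁) * B) (hΨ.of_le (by simp))
    (fun x hx s => by simp only [almostAnalytic_eq_zero hx, zero_mul]) (by positivity)
    (fun x hx s hs => by
      have hs' : s ∈ Icc 0 t₁ := ⟨by linarith [hs.1], hs.2⟩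
      rw [norm_mul]
      calc _ ≤ C₁ * (S * B) := mul_le_mul (hC₁ x hx s hs') (hψb x s hs') (norm_nonneg _) hC₁0
        _ ≤ _ := by nlinarith [mul_nonneg (mul_nonneg hC₂0 hS0) hB, mul_nonneg hC₁0 hB])
    (fun x hx s hs => by
      have hs0 := hs.1
      rw [dbar_mul (haa.differentiable (by simp) _) (hbb.differentiable (by simp) _)]
      have h1 := norm_dbar_almostAnalytic_le (v := v) hχ.contDiff W.m x hs.1
      have h2 := norm_dbar_almostAnalytic_le (v := v) hψ W.m x hs.1
      have h3 : ‖dbar v (almostAnalytic v W.m χ) x s‖ ≤ C₂ * s ^ W.m :=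
        h1.trans (by gcongr; exact hC₂ x hx)
      have h4 : ‖dbar v (almostAnalytic v W.m ψ) x s‖ ≤ B * s ^ W.m :=
        h2.trans (by gcongr; exact h x _ le_rfl)
      refine (norm_add_le _ _).trans ?_
      rw [norm_mul, norm_mul]
      calc _ ≤ (C₂ * s ^ W.m) * (S * B) + C₁ * (B * s ^ W.m) :=
            add_le_add (mul_le_mul h3 (hψb x s hs) (norm_nonneg _) (by positivity))
              (mul_le_mul (hC₁ x hx s hs) h4 (norm_nonneg _) hC₁0)
        _ ≤ _ := by
            have : 0 ≤ C₁ * S * B * s ^ W.m := by positivity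
            nlinarith)
    t ht
  simp only [almostAnalytic_zero] at this
  rwa [mul_assoc]

theorem WedgeRep.norm_apply_le {T : (E → ℂ) → ℂ} {x₀ v : E} {r : ℝ} (W : WedgeRep T x₀ r v)
    {φ : E → ℂ} (hφ : IsTest (Metric.ball x₀ r) φ) {t₁ B : ℝ} (ht₁ : 0 < t₁)
    (h : ∀ t ∈ Ioc 0 t₁, ‖∫ x, W.F x t * φ x‖ ≤ B) : ‖T φ‖ ≤ B :=
  le_of_tendsto (W.limit φ hφ).norm (by
    filter_upwards [Ioc_mem_nhdsGT ht₁] with t ht using h t ht)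

/-- Integration over a parameter commutes with `T`. -/
theorem WedgeRep.integral_comm {T : (E → ℂ) → ℂ} {x₀ v : E} {r : ℝ} (W : WedgeRep T x₀ r v)
    {P : Type*} [MeasurableSpace P] {μ : Measure P} [SFinite μ] {Φ : P → E → ℂ}
    (hΦ : ∀ p, IsTest (Metric.ball x₀ r) (Φ p)) {φ : E → ℂ} (hφ : IsTest (Metric.ball x₀ r) φ)
    (hφΦ : ∀ x, φ x = ∫ p, Φ p x ∂μ) {t₁ : ℝ} (ht₁ : 0 < t₁) {b : P → ℝ} (hb : Integrable b μ)
    (hbound : ∀ᵐ p ∂μ, ∀ t ∈ Ioc 0 t₁, ‖∫ x, W.F x t * Φ p x‖ ≤ b p)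
    (hint : ∀ t ∈ Ioc 0 t₁, Integrable (fun q : P × E => W.F q.2 t * Φ q.1 q.2) (μ.prod volume)) :
    Integrable (fun p => T (Φ p)) μ ∧ ∫ p, T (Φ p) ∂μ = T φ := by
  -- Heights are taken along a sequence, so that measurability of `p ↦ T (Φ p)` follows as a
  -- countable pointwise limit. At each positive height the exchange is Fubini; the limit is by
  -- domination by `b`.
  obtain ⟨u, -, hu0, hu⟩ := exists_seq_strictAnti_tendsto' (half_pos ht₁)
  have hu1 : ∀ n, u n ∈ Ioc 0 t₁ := fun n => ⟨(hu0 n).1, by linarith [(hu0 n).2]⟩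
  have hu' : Tendsto u atTop (𝓝[>] 0) :=
    tendsto_nhdsWithin_iff.2 ⟨hu, .of_forall fun n => (hu0 n).1⟩
  have hmeas : ∀ n, AEStronglyMeasurable (fun p => ∫ x, W.F x (u n) * Φ p x) μ := fun n =>
    (hint _ (hu1 n)).integral_prod_left.aestronglyMeasurable
  have hlim : ∀ p, Tendsto (fun n => ∫ x, W.F x (u n) * Φ p x) atTop (𝓝 (T (Φ p))) := fun p =>
    (W.limit _ (hΦ p)).comp hu'
  have h1 := tendsto_integral_of_dominated_convergence b hmeas hb
    (fun n => hbound.mono fun p hp => hp _ (hu1 n)) (.of_forall hlim)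
  have hm : AEStronglyMeasurable (fun p => T (Φ p)) μ :=
    aestronglyMeasurable_of_tendsto_ae atTop hmeas (.of_forall hlim)
  refine ⟨hb.mono' hm (hbound.mono fun p hp => W.norm_apply_le (hΦ p) ht₁ hp), ?_⟩
  refine tendsto_nhds_unique h1 (((W.limit φ hφ).comp hu').congr fun n => ?_)
  have h2 := integral_integral_swap (f := fun p x => W.F x (u n) * Φ p x) (hint _ (hu1 n))
  simp only [Function.comp]
  rw [h2]
  congr 1
  funext x
  rw [integral_const_mul, hφΦ]

end WedgeEstimates

/-! ## The plane wave decomposition of the Gaussian kernel -/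

section Kernel

variable {N : ℕ}

/-- `⟨ξ⟩ = (1 + |ξ|²)^{1/2}`. -/
def jap (ξ : Fin N → ℝ) : ℝ := √(1 + ∑ i, ξ i ^ 2)

/-- The bilinear pairing of a covector with a complex vector. -/
def dotC (ξ : Fin N → ℝ) (w : Fin N → ℂ) : ℂ := ∑ i, (ξ i : ℂ) * w i

/-- The holomorphic square `∑ wᵢ²`. -/
def sqC (w : Fin N → ℂ) : ℂ := ∑ i, w i ^ 2

/-- The exponential in the plane wave decomposition. -/
def fbiExp (ε κ : ℝ) (ξ : Fin N → ℝ) (w : Fin N → ℂ) : ℂ :=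
  Complex.exp (-Complex.I * dotC ξ w - κ * jap ξ * sqC w
    - ε * ((jap ξ : ℂ) ^ 2 - 1 - 2 * Complex.I * κ * jap ξ * dotC ξ w
      - κ ^ 2 * (jap ξ : ℂ) ^ 2 * sqC w))

/-- The pullback of `exp(-i w·ζ - εζ²) dζ` to the contour `ζ = ξ - iκ⟨ξ⟩w`. -/
def fbiKernel (ε κ : ℝ) (ξ : Fin N → ℝ) (w : Fin N → ℂ) : ℂ :=
  (1 - Complex.I * κ * dotC ξ w / jap ξ) * fbiExp ε κ ξ w

theorem jap_sq (ξ : Fin N → ℝ) : jap ξ ^ 2 = 1 + ∑ i, ξ i ^ 2 :=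
  Real.sq_sqrt (by positivity)

theorem one_le_jap (ξ : Fin N → ℝ) : 1 ≤ jap ξ :=
  Real.one_le_sqrt.2 (le_add_of_nonneg_right (by positivity))

theorem jap_pos (ξ : Fin N → ℝ) : 0 < jap ξ := one_pos.trans_le (one_le_jap ξ)

theorem continuous_jap : Continuous (jap (N := N)) := by unfold jap; fun_prop

theorem norm_le_jap (ξ : Fin N → ℝ) : ‖ξ‖ ≤ jap ξ := by
  refine (pi_norm_le_iff_of_nonneg (jap_pos ξ).le).2 fun i => Real.abs_le_sqrt ?_
  have := Finset.single_le_sum (f := fun i => ξ i ^ 2) (fun i _ => sq_nonneg _) (Finset.mem_univ i)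
  linarith

theorem jap_le (ξ : Fin N → ℝ) : jap ξ ≤ 1 + N * ‖ξ‖ := by
  refine Real.sqrt_le_iff.2 ⟨by positivity, ?_⟩
  have h1 : ∑ i, ξ i ^ 2 ≤ ∑ _i : Fin N, ‖ξ‖ ^ 2 := Finset.sum_le_sum fun i _ =>
    sq_le_sq' (by linarith [neg_abs_le (ξ i), norm_le_pi_norm ξ i, Real.norm_eq_abs (ξ i)])
      ((le_abs_self _).trans (norm_le_pi_norm ξ i))
  simp only [Finset.sum_const, Finset.card_univ, Fintype.card_fin, nsmul_eq_mul] at h1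
  rcases Nat.eq_zero_or_pos N with rfl | hN
  · simp
  · have h2 : (1 : ℝ) ≤ N := by exact_mod_cast hN
    have h3 : 0 ≤ (N : ℝ) * ‖ξ‖ := by positivity
    have h4 : (N : ℝ) * ‖ξ‖ ^ 2 ≤ (N * ‖ξ‖) ^ 2 := by
      nlinarith [mul_nonneg (sq_nonneg ‖ξ‖) (Nat.cast_nonneg (α := ℝ) N)]
    nlinarith

theorem dotC_norm_le (ξ : Fin N → ℝ) {w : Fin N → ℂ} {M : ℝ} (hM : 0 ≤ M)
    (hw : ∑ i, ‖w i‖ ^ 2 ≤ M ^ 2) : ‖dotC ξ w‖ ≤ M * jap ξ := by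
  have h1 : ‖dotC ξ w‖ ≤ ∑ i, |ξ i| * ‖w i‖ :=
    (norm_sum_le _ _).trans_eq (by simp)
  have h2 := Finset.sum_mul_sq_le_sq_mul_sq Finset.univ (fun i => |ξ i|) (fun i => ‖w i‖)
  simp only [sq_abs] at h2
  refine h1.trans (abs_le_of_sq_le_sq' ?_ (by have := jap_pos ξ; positivity)).2
  rw [mul_pow, jap_sq, mul_comm]
  refine h2.trans (mul_le_mul (by linarith) hw (by positivity) (by positivity))

/-- The power is absorbed by `exp ⟨ξ⟩`, and completing the square gives `(A+1)⟨ξ⟩ ≤ (A+1)²/(2ε) +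
(ε/2)⟨ξ⟩²`, which leaves half of the Gaussian. -/
theorem integrable_jap_exp (k : ℕ) (A : ℝ) {ε : ℝ} (hε : 0 < ε) :
    Integrable fun ξ : Fin N → ℝ => jap ξ ^ k * Real.exp (A * jap ξ - ε * jap ξ ^ 2) := by
  have h1 : Integrable fun ξ : Fin N → ℝ => Real.exp (-(ε / 2) * ∑ i, ξ i ^ 2) := by
    have := (GaussianFourier.integrable_cexp_neg_mul_sum_add (ι := Fin N) (b := ((ε / 2 : ℝ) : ℂ))
      (by simpa using hε) 0).norm
    refine this.congr (.of_forall fun ξ => ?_)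
    simp only [Complex.norm_exp]
    congr 1
    have : (-((ε / 2 : ℝ) : ℂ) * ∑ i, (ξ i : ℂ) ^ 2 + ∑ i, (0 : Fin N → ℂ) i * ξ i)
      = ((-(ε / 2) * ∑ i, ξ i ^ 2 : ℝ) : ℂ) := by push_cast; simp
    rw [this, Complex.ofReal_re]
  have hc := continuous_jap (N := N)
  refine (h1.const_mul (k.factorial * Real.exp ((A + 1) ^ 2 / (2 * ε)))).mono'
    (Continuous.aestronglyMeasurable (by fun_prop)) (.of_forall fun ξ => ?_)
  have hj := jap_pos ξ
  rw [Real.norm_of_nonneg (by positivity)]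
  have h2 : jap ξ ^ k ≤ k.factorial * Real.exp (jap ξ) := by
    have := Real.pow_div_factorial_le_exp (jap ξ) hj.le k
    rwa [div_le_iff₀ (by positivity), mul_comm] at this
  calc _ ≤ (k.factorial * Real.exp (jap ξ)) * Real.exp (A * jap ξ - ε * jap ξ ^ 2) := by gcongr
    _ = k.factorial * Real.exp (jap ξ + (A * jap ξ - ε * jap ξ ^ 2)) := by
        rw [Real.exp_add]; ring
    _ ≤ k.factorial * Real.exp ((A + 1) ^ 2 / (2 * ε) + -(ε / 2) * ∑ i, ξ i ^ 2) := by
        refine mul_le_mul_of_nonneg_left (Real.exp_le_exp.2 ?_) (by positivity)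
        have h3 : (∑ i, ξ i ^ 2) = jap ξ ^ 2 - 1 := by rw [jap_sq]; ring
        rw [h3]
        have h4 : (A + 1) * jap ξ ≤ (A + 1) ^ 2 / (2 * ε) + ε / 2 * jap ξ ^ 2 := by
          have : 0 ≤ ((A + 1) - ε * jap ξ) ^ 2 / (2 * ε) := by positivity
          have h5 : ((A + 1) - ε * jap ξ) ^ 2 / (2 * ε)
            = (A + 1) ^ 2 / (2 * ε) + ε / 2 * jap ξ ^ 2 - (A + 1) * jap ξ := by
            field_simp; ring
          linarith
        nlinarith
    _ = _ := by rw [Real.exp_add]; ring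

theorem differentiable_dotC (ξ : Fin N → ℝ) : Differentiable ℂ (dotC ξ) := by
  unfold dotC; fun_prop

theorem differentiable_sqC : Differentiable ℂ (sqC (N := N)) := by
  unfold sqC; fun_prop

theorem differentiable_fbiKernel (ε κ : ℝ) (ξ : Fin N → ℝ) :
    Differentiable ℂ (fbiKernel ε κ ξ) := by
  have h1 := differentiable_dotC ξ
  have h2 := differentiable_sqC (N := N)
  unfold fbiKernel fbiExp
  fun_prop

theorem continuous_dotC : Continuous fun q : (Fin N → ℝ) × (Fin N → ℂ) => dotC q.1 q.2 := by
  unfold dotC; fun_prop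

theorem continuous_fbiKernel (ε κ : ℝ) :
    Continuous fun q : (Fin N → ℝ) × (Fin N → ℂ) => fbiKernel ε κ q.1 q.2 := by
  have h1 := continuous_dotC (N := N)
  have h2 := (differentiable_sqC (N := N)).continuous
  have h3 := continuous_jap (N := N)
  unfold fbiKernel fbiExp
  refine Continuous.mul (continuous_const.sub (Continuous.div (by fun_prop) (by fun_prop)
    fun q => ?_)) (by fun_prop)
  exact_mod_cast (jap_pos q.1).ne'

/-- The Gaussian `∫ exp(-i w·ξ - εξ²) dξ`. -/
def gaussKernel (ε : ℝ) (w : Fin N → ℂ) : ℂ :=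
  (Real.pi / ε : ℂ) ^ (N / 2 : ℂ) * Complex.exp (-sqC w / (4 * ε))

theorem differentiable_gaussKernel (ε : ℝ) : Differentiable ℂ (gaussKernel (N := N) ε) := by
  have h2 := differentiable_sqC (N := N)
  unfold gaussKernel
  fun_prop

theorem integral_fbiKernel_zero {ε : ℝ} (hε : 0 < ε) (w : Fin N → ℂ) :
    ∫ ξ, fbiKernel ε 0 ξ w = gaussKernel ε w := by
  have h := GaussianFourier.integral_cexp_neg_mul_sum_add (ι := Fin N) (b := (ε : ℂ))
    (by simpa using hε) (fun i => -Complex.I * w i)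
  rw [gaussKernel]
  simp only [Fintype.card_fin] at h
  convert h using 3 with ξ
  · simp only [fbiKernel, fbiExp, dotC, Complex.ofReal_zero, mul_zero, zero_mul, zero_div, sub_zero,
      one_mul]
    congr 1
    have h3 : (jap ξ : ℂ) ^ 2 = 1 + ∑ i, (ξ i : ℂ) ^ 2 := by exact_mod_cast jap_sq ξ
    simp only [h3, Finset.mul_sum, mul_assoc]
    have : ∀ i, Complex.I * ((ξ i : ℂ) * w i) = Complex.I * (w i * ξ i) := fun i => by ring
    simp only [this, neg_mul, Finset.sum_neg_distrib, ← Finset.mul_sum]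
    ring
  · simp [sqC, mul_pow]

/-- For `|κ| ≤ 2` and `w² ≤ 1/8` one has `κ²w² ≤ 1/2`, so bending the contour consumes at most half
of the damping `ε⟨ξ⟩²`. Allowing `|κ|` up to 2 leaves room around the interval `[0, 1]` on which the
contour is moved. -/
theorem norm_fbiExp_ofReal {ε : ℝ} (hε : 0 < ε) {κ : ℝ} (hκ : |κ| ≤ 2) (ξ w : Fin N → ℝ)
    (hw : ∑ i, w i ^ 2 ≤ 1 / 8) :
    ‖fbiExp ε κ ξ (fun i => (w i : ℂ))‖ ≤ Real.exp ε * Real.exp (1 * jap ξ - ε / 2 * jap ξ ^ 2) := by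
  rw [fbiExp, Complex.norm_exp, ← Real.exp_add]
  have hd : dotC ξ (fun i => (w i : ℂ)) = ((∑ i, ξ i * w i : ℝ) : ℂ) := by
    simp [dotC]
  have hs : sqC (fun i => (w i : ℂ)) = ((∑ i, w i ^ 2 : ℝ) : ℂ) := by simp [sqC]
  rw [hd, hs]
  set p := ∑ i, ξ i * w i
  set W := ∑ i, w i ^ 2 with hW
  have hW0 : 0 ≤ W := by positivity
  have hre : (-Complex.I * (p : ℂ) - κ * jap ξ * (W : ℂ) - ε * ((jap ξ : ℂ) ^ 2 - 1
      - 2 * Complex.I * κ * jap ξ * (p : ℂ) - κ ^ 2 * (jap ξ : ℂ) ^ 2 * (W : ℂ))).re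
      = -κ * jap ξ * W - ε * (jap ξ ^ 2 - 1 - κ ^ 2 * jap ξ ^ 2 * W) := by
    have : (-Complex.I * (p : ℂ) - κ * jap ξ * (W : ℂ) - ε * ((jap ξ : ℂ) ^ 2 - 1
      - 2 * Complex.I * κ * jap ξ * (p : ℂ) - κ ^ 2 * (jap ξ : ℂ) ^ 2 * (W : ℂ)))
      = ((-κ * jap ξ * W - ε * (jap ξ ^ 2 - 1 - κ ^ 2 * jap ξ ^ 2 * W) : ℝ) : ℂ)
        + ((-p + 2 * ε * κ * jap ξ * p : ℝ) : ℂ) * Complex.I := by push_cast; ring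
    rw [this, Complex.add_re, Complex.re_ofReal_mul, Complex.I_re, mul_zero, add_zero,
      Complex.ofReal_re]
  rw [hre]
  gcongr
  have hj := jap_pos ξ
  have h1 : -κ * W ≤ 1 := by nlinarith [abs_le.1 hκ]
  have h2 : κ ^ 2 * W ≤ 1 / 2 := by
    have : κ ^ 2 ≤ 4 := by nlinarith [abs_le.1 hκ]
    nlinarith
  nlinarith [mul_le_mul_of_nonneg_right h1 hj.le,
    mul_le_mul_of_nonneg_left h2 (by positivity : 0 ≤ ε * jap ξ ^ 2)]

theorem hasDerivAt_jap_line (ξ w : Fin N → ℝ) (t : ℝ) :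
    HasDerivAt (fun t : ℝ => jap (ξ + t • w)) ((∑ i, (ξ + t • w) i * w i) / jap (ξ + t • w)) t := by
  have h1 : HasDerivAt (fun t : ℝ => 1 + ∑ i, (ξ + t • w) i ^ 2)
      (∑ i, 2 * ((ξ + t • w) i * w i)) t := by
    refine HasDerivAt.const_add _ (HasDerivAt.fun_sum fun i _ => ?_)
    have h2 : HasDerivAt (fun t : ℝ => ξ i + t * w i) (1 * w i) t :=
      ((hasDerivAt_id t).mul_const _).const_add _
    convert! h2.pow 2 using 1
    simp; ring
  have h3 := h1.sqrt (by positivity)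
  convert! h3 using 1
  rw [← Finset.mul_sum]
  exact (mul_div_mul_left _ _ two_ne_zero).symm

/-- The contour `ζ = ξ - iκ⟨ξ⟩w` may be moved to the real domain. -/
theorem integral_fbiKernel {ε : ℝ} (hε : 0 < ε) (w : Fin N → ℝ) (hw : ∑ i, w i ^ 2 ≤ 1 / 8) :
    (Integrable fun ξ => fbiKernel ε 1 ξ (fun i => (w i : ℂ))) ∧
    ∫ ξ, fbiKernel ε 1 ξ (fun i => (w i : ℂ)) = gaussKernel ε fun i => (w i : ℂ) := by
  set wc : Fin N → ℂ := fun i => (w i : ℂ) with hwc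
  set W : ℝ := ∑ i, w i ^ 2 with hW
  have hW0 : 0 ≤ W := by positivity
  set p : (Fin N → ℝ) → ℝ := fun ξ => ∑ i, ξ i * w i with hp
  have hd : ∀ ξ, dotC ξ wc = (p ξ : ℂ) := fun ξ => by simp [dotC, hwc, hp]
  have hs : sqC wc = (W : ℂ) := by simp [sqC, hwc, hW]
  have hpj : ∀ ξ, |p ξ| ≤ jap ξ := by
    intro ξ
    have h1 : ∑ i, ‖wc i‖ ^ 2 ≤ (1 : ℝ) ^ 2 := by
      simp only [hwc, Complex.norm_real, Real.norm_eq_abs, sq_abs]; linarith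
    have := dotC_norm_le ξ zero_le_one h1
    rwa [hd, Complex.norm_real, one_mul] at this
  have hjc : ∀ ξ : Fin N → ℝ, (jap ξ : ℂ) ≠ 0 := fun ξ => by exact_mod_cast (jap_pos ξ).ne'
  -- `dQ` is the derivative in `κ` of the exponent, `dK` that of the whole kernel.
  let dQ : ℝ → (Fin N → ℝ) → ℂ := fun κ ξ =>
    -jap ξ * W - ε * (-2 * Complex.I * jap ξ * p ξ - 2 * κ * (jap ξ : ℂ) ^ 2 * W)
  let dK : ℝ → (Fin N → ℝ) → ℂ := fun κ ξ =>
    (-Complex.I * p ξ / jap ξ + (1 - Complex.I * κ * p ξ / jap ξ) * dQ κ ξ) * fbiExp ε κ ξ wc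
  have hderK : ∀ ξ κ, HasDerivAt (fun κ => fbiKernel ε κ ξ wc) (dK κ ξ) κ := by
    intro ξ κ
    have hk : HasDerivAt (fun κ : ℝ => (κ : ℂ)) 1 κ := Complex.ofRealCLM.hasDerivAt (x := κ)
    have hQ : HasDerivAt (fun κ => fbiExp ε κ ξ wc) (fbiExp ε κ ξ wc * dQ κ ξ) κ := by
      simp only [fbiExp, hd, hs]
      refine HasDerivAt.cexp ?_
      have h1 := ((hk.mul_const ((jap ξ : ℂ))).mul_const (W : ℂ)).const_sub (-Complex.I * (p ξ : ℂ))
      have h2 := (((hk.const_mul (2 * Complex.I)).mul_const (jap ξ : ℂ)).mul_const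
        (p ξ : ℂ)).const_sub ((jap ξ : ℂ) ^ 2 - 1)
      have h3 := (((hk.pow 2).mul_const ((jap ξ : ℂ) ^ 2)).mul_const (W : ℂ))
      convert! h1.sub ((h2.sub h3).const_mul (ε : ℂ)) using 1
      simp only [dQ]; push_cast; ring
    have h4 : HasDerivAt (fun κ : ℝ => 1 - Complex.I * κ * (p ξ : ℂ) / jap ξ)
        (-(Complex.I * 1 * (p ξ : ℂ) / jap ξ)) κ :=
      (((hk.const_mul Complex.I).mul_const (p ξ : ℂ)).div_const (jap ξ : ℂ)).const_sub 1
    simp only [fbiKernel, hd]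
    convert! h4.mul hQ using 1
    simp only [dK]; ring
  have hexpc : ∀ κ, Continuous fun ξ => fbiExp ε κ ξ wc := by
    intro κ
    have h3 := continuous_jap (N := N)
    have : Continuous p := by fun_prop
    simp only [fbiExp, hd, hs]
    fun_prop
  have hKc : ∀ κ, Continuous fun ξ => fbiKernel ε κ ξ wc := fun κ =>
    (continuous_fbiKernel ε κ).comp (f := fun ξ => (ξ, wc)) (by fun_prop)
  have hpc : Continuous p := by fun_prop
  have hdKc : ∀ κ, Continuous (dK κ) := by
    intro κ
    have h3 := continuous_jap (N := N)
    have h4 := hexpc κ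
    simp only [dK, dQ]
    refine Continuous.mul (Continuous.add (Continuous.div (by fun_prop) (by fun_prop) hjc)
      (Continuous.mul (continuous_const.sub (Continuous.div (by fun_prop) (by fun_prop) hjc))
      (by fun_prop))) h4
  have hq : ∀ ξ, ‖(p ξ : ℂ) / jap ξ‖ ≤ 1 := by
    intro ξ
    rw [norm_div, Complex.norm_real, Complex.norm_real, Real.norm_eq_abs, Real.norm_eq_abs,
      abs_of_pos (jap_pos ξ), div_le_one (jap_pos ξ)]
    exact hpj ξ
  have hpre : ∀ κ : ℝ, |κ| ≤ 2 → ∀ ξ, ‖1 - Complex.I * κ * (p ξ : ℂ) / jap ξ‖ ≤ 3 := by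
    intro κ hκ ξ
    refine (norm_sub_le _ _).trans ?_
    rw [mul_div_assoc, norm_mul, norm_mul, Complex.norm_I, Complex.norm_real, norm_one, one_mul,
      Real.norm_eq_abs]
    nlinarith [hq ξ, norm_nonneg ((p ξ : ℂ) / jap ξ), abs_nonneg κ]
  set G : (Fin N → ℝ) → ℝ := fun ξ => Real.exp ε * Real.exp (1 * jap ξ - ε / 2 * jap ξ ^ 2) with hG
  have hdKb : ∀ κ : ℝ, |κ| ≤ 2 → ∀ ξ, ‖dK κ ξ‖ ≤ (4 + 18 * ε) * jap ξ ^ 2 * G ξ := by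
    intro κ hκ ξ
    have hj := one_le_jap ξ
    have hj2 : jap ξ ≤ jap ξ ^ 2 := by nlinarith
    have h1 : ‖dQ κ ξ‖ ≤ (1 + 6 * ε) * jap ξ ^ 2 := by
      refine (norm_sub_le _ _).trans ?_
      have h2 : ‖-2 * Complex.I * jap ξ * p ξ - 2 * κ * (jap ξ : ℂ) ^ 2 * W‖ ≤ 6 * jap ξ ^ 2 := by
        refine (norm_sub_le _ _).trans ?_
        simp only [norm_mul, norm_neg, Complex.norm_I, Complex.norm_real, Real.norm_eq_abs,
          norm_pow, RCLike.norm_ofNat, mul_one, abs_of_pos (jap_pos ξ), abs_of_nonneg hW0]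
        have h3 : jap ξ * |p ξ| ≤ jap ξ * jap ξ := mul_le_mul_of_nonneg_left (hpj ξ) (jap_pos ξ).le
        have h4 : |κ| * W ≤ 2 := by nlinarith [abs_nonneg κ]
        nlinarith [mul_le_mul_of_nonneg_right h4 (sq_nonneg (jap ξ))]
      rw [norm_mul, norm_mul, norm_neg, Complex.norm_real, Complex.norm_real, Complex.norm_real,
        Real.norm_eq_abs, Real.norm_eq_abs, Real.norm_eq_abs, abs_of_pos (jap_pos ξ),
        abs_of_nonneg hW0, abs_of_pos hε]
      nlinarith [mul_le_mul_of_nonneg_left h2 hε.le]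
    have h5 : ‖-Complex.I * p ξ / jap ξ‖ ≤ jap ξ ^ 2 := by
      rw [mul_div_assoc, norm_mul, norm_neg, Complex.norm_I, one_mul]
      exact (hq ξ).trans (by nlinarith)
    simp only [dK]
    rw [norm_mul]
    refine mul_le_mul ?_ (norm_fbiExp_ofReal hε hκ ξ w hw) (norm_nonneg _) (by positivity)
    refine (norm_add_le _ _).trans ?_
    rw [norm_mul]
    have := mul_le_mul (hpre κ hκ ξ) h1 (norm_nonneg _) (by norm_num)
    linarith
  have hGint : Integrable fun ξ => jap ξ ^ 2 * G ξ := by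
    refine ((integrable_jap_exp 2 1 (half_pos hε)).const_mul (Real.exp ε)).congr
      (.of_forall fun ξ => ?_)
    simp only [hG]; ring
  have hGle : ∀ ξ, G ξ ≤ jap ξ ^ 2 * G ξ := fun ξ => by
    have hj := one_le_jap ξ
    exact le_mul_of_one_le_left (by positivity) (one_le_pow₀ hj)
  have hKint : ∀ κ : ℝ, |κ| ≤ 2 → Integrable fun ξ => fbiKernel ε κ ξ wc := by
    intro κ hκ
    refine (hGint.const_mul 3).mono' (hKc κ).aestronglyMeasurable (.of_forall fun ξ => ?_)
    rw [fbiKernel, hd, norm_mul]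
    exact (mul_le_mul (hpre κ hκ ξ) (norm_fbiExp_ofReal hε hκ ξ w hw) (norm_nonneg _)
      (by norm_num)).trans (mul_le_mul_of_nonneg_left (hGle ξ) (by norm_num))
  refine ⟨hKint 1 (by norm_num), ?_⟩
  have hzero : ∀ κ : ℝ, |κ| ≤ 2 → ∫ ξ, dK κ ξ = 0 := by
    intro κ hκ
    -- The integrand is a closed holomorphic form, so its variation along the moving contour is
    -- exact: `dK` is the derivative along `w`, in the variable `ξ`, of `-i⟨ξ⟩` times the
    -- exponential. Its integral therefore vanishes.
    have hline : ∀ ξ, HasLineDerivAt ℝ (fun ξ => -Complex.I * (fbiExp ε κ ξ wc * jap ξ))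
        (dK κ ξ) ξ w := by
      intro ξ
      have hj : HasDerivAt (fun t : ℝ => (jap (ξ + t • w) : ℂ)) ((p ξ / jap ξ : ℝ) : ℂ) 0 := by
        have := (hasDerivAt_jap_line ξ w 0).ofReal_comp
        have e : (∑ i, (ξ + (0 : ℝ) • w) i * w i) / jap (ξ + (0 : ℝ) • w) = p ξ / jap ξ := by
          simp [hp]
        rwa [e] at this
      have hpl : HasDerivAt (fun t : ℝ => (p (ξ + t • w) : ℂ)) (W : ℂ) 0 := by
        have h1 : HasDerivAt (fun t : ℝ => p (ξ + t • w)) W 0 := by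
          refine HasDerivAt.fun_sum fun i _ => ?_
          have h2 : HasDerivAt (fun t : ℝ => ξ i + t * w i) (1 * w i) 0 :=
            ((hasDerivAt_id (0 : ℝ)).mul_const _).const_add _
          convert! h2.mul_const (w i) using 1
        exact h1.ofReal_comp
      have hQ : HasDerivAt (fun t : ℝ => fbiExp ε κ (ξ + t • w) wc) (fbiExp ε κ ξ wc *
          (-Complex.I * W - κ * (p ξ / jap ξ) * W - ε * (2 * p ξ
            - 2 * Complex.I * κ * ((p ξ / jap ξ) * p ξ + jap ξ * W) - 2 * κ ^ 2 * p ξ * W))) 0 := by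
        have hv : fbiExp ε κ ξ wc = fbiExp ε κ (ξ + (0 : ℝ) • w) wc := by simp
        rw [hv]
        simp only [fbiExp, hd, hs]
        refine HasDerivAt.cexp ?_
        have h1 := (hpl.const_mul (-Complex.I)).sub ((hj.const_mul (κ : ℂ)).mul_const (W : ℂ))
        have h2 := ((hj.pow 2).sub_const 1).sub (((hj.const_mul (2 * Complex.I * κ)).mul hpl))
        have h3 := ((hj.pow 2).const_mul ((κ : ℂ) ^ 2)).mul_const (W : ℂ)
        convert! h1.sub ((h2.sub h3).const_mul (ε : ℂ)) using 1
        have := hjc ξ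
        simp only [zero_smul, add_zero]
        push_cast
        field_simp
      have h5 := (hQ.mul hj).const_mul (-Complex.I)
      show HasDerivAt (fun t : ℝ => -Complex.I * (fbiExp ε κ (ξ + t • w) wc * jap (ξ + t • w)))
        (dK κ ξ) 0
      convert! h5 using 1
      simp only [dK, dQ, zero_smul, add_zero]
      push_cast
      have := hjc ξ
      field_simp
      linear_combination (fbiExp ε κ ξ wc * (-(jap ξ : ℂ) ^ 2 * W + 2 * (jap ξ : ℂ) ^ 3 * κ * W * ε)) * Complex.I_sq
    refine integral_lineDeriv_eq_zero ?_ ?_ hline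
    · have h3 := continuous_jap (N := N)
      have h4 := hexpc κ
      refine hGint.mono' (Continuous.aestronglyMeasurable (by fun_prop)) (.of_forall fun ξ => ?_)
      rw [norm_mul, norm_neg, Complex.norm_I, one_mul, norm_mul, Complex.norm_real,
        Real.norm_of_nonneg (jap_pos ξ).le, mul_comm]
      have hj := one_le_jap ξ
      exact mul_le_mul (by nlinarith) (norm_fbiExp_ofReal hε hκ ξ w hw) (norm_nonneg _)
        (by positivity)
    · refine (hGint.const_mul (4 + 18 * ε)).mono' (hdKc κ).aestronglyMeasurable
        (.of_forall fun ξ => (hdKb κ hκ ξ).trans_eq (by ring))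
  -- The open interval contains `[0, 1]` in its interior, so the derivative is two-sided at both end
  -- points; `κ = 0` is the classical Gaussian Fourier integral.
  have hJ : ∀ κ ∈ Ioo (-2 : ℝ) 2, HasDerivAt (fun κ => ∫ ξ, fbiKernel ε κ ξ wc) 0 κ := by
    intro κ hκ
    have habs : ∀ κ ∈ Ioo (-2 : ℝ) 2, |κ| ≤ 2 := fun κ hκ => abs_le.2 ⟨hκ.1.le, hκ.2.le⟩
    have := (hasDerivAt_integral_of_dominated_loc_of_deriv_le (μ := volume)
      (F := fun κ ξ => fbiKernel ε κ ξ wc) (F' := dK) (s := Ioo (-2 : ℝ) 2) (x₀ := κ)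
      (bound := fun ξ => (4 + 18 * ε) * (jap ξ ^ 2 * G ξ)) (Ioo_mem_nhds hκ.1 hκ.2)
      (.of_forall fun κ => (hKc κ).aestronglyMeasurable) (hKint κ (habs κ hκ))
      (hdKc κ).aestronglyMeasurable
      (.of_forall fun ξ κ hκ => (hdKb κ (habs κ hκ) ξ).trans_eq (by ring))
      (hGint.const_mul _) (.of_forall fun ξ κ _ => hderK ξ κ)).2
    rwa [hzero κ (habs κ hκ)] at this
  have hconst := (convex_Icc (0 : ℝ) 1).is_const_of_fderivWithin_eq_zero (𝕜 := ℝ)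
    (f := fun κ => ∫ ξ, fbiKernel ε κ ξ wc)
    (fun κ hκ => (hJ κ ⟨by linarith [hκ.1], by linarith [hκ.2]⟩).differentiableAt.differentiableWithinAt)
    (fun κ hκ => by
      have h1 := (hJ κ ⟨by linarith [hκ.1], by linarith [hκ.2]⟩).hasFDerivAt.hasFDerivWithinAt
        (s := Icc 0 1)
      rw [h1.fderivWithin (uniqueDiffOn_Icc one_pos κ hκ)]
      ext; simp)
    (right_mem_Icc.2 zero_le_one) (left_mem_Icc.2 zero_le_one)
  rw [hconst, integral_fbiKernel_zero hε]

end Kernel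

/-! ### Test functions of the form cutoff times holomorphic function. -/

section HolomorphicTest

variable {E : Type*} [NormedAddCommGroup E] [NormedSpace ℝ E] [FiniteDimensional ℝ E]
  [MeasureSpace E] [BorelSpace E] [(volume : Measure E).IsAddHaarMeasure]

variable {N : ℕ} (L : E ≃L[ℝ] (Fin N → ℝ))

/-- The complexification of the coordinates of `x`. -/
def cx (x : E) : Fin N → ℂ := fun i => (L x i : ℂ)

theorem continuous_cx : Continuous (cx L) := by
  unfold cx
  have := L.continuous
  fun_prop

/-- The test function `χ(x) e(x)`, with `e` holomorphic. -/
def holoTest (χ : E → ℂ) (e : (Fin N → ℂ) → ℂ) (x : E) : ℂ := χ x * e (cx L x)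

theorem IsTest.mul_contDiff {U : Set E} {χ ψ : E → ℂ} (hχ : IsTest U χ) (hψ : ContDiff ℝ ∞ ψ) :
    IsTest U fun x => χ x * ψ x where
  contDiff := hχ.contDiff.mul hψ
  compact := hχ.compact.mul_right
  subset := (tsupport_mul_subset_left (f := χ) (g := ψ)).trans hχ.subset

theorem contDiff_comp_cx {e : (Fin N → ℂ) → ℂ} (he : Differentiable ℂ e) :
    ContDiff ℝ ∞ fun x => e (cx L x) := by
  refine (contDiff_real_of_differentiable he).comp (contDiff_pi.2 fun i => ?_)
  exact (Complex.ofRealCLM ∘L ContinuousLinearMap.proj i ∘L L.toContinuousLinearMap).contDiff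

theorem isTest_holoTest {U : Set E} {χ : E → ℂ} (hχ : IsTest U χ) {e : (Fin N → ℂ) → ℂ}
    (he : Differentiable ℂ e) : IsTest U (holoTest L χ e) :=
  hχ.mul_contDiff (contDiff_comp_cx L he)

theorem continuous_cpt (v : E) : Continuous fun q : E × ℝ => cpt L v q.1 q.2 :=
  (contDiff_cpt L v (k := 0)).continuous

variable {T : (E → ℂ) → ℂ} {x₀ v : E} {r : ℝ}

theorem WedgeRep.continuous_mul_test (W : WedgeRep T x₀ r v) {φ : E → ℂ}
    (hφ : IsTest (Metric.ball x₀ r) φ) {t : ℝ} (ht : t ∈ Ioo 0 W.t₀) :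
    Continuous fun x => W.F x t * φ x := by
  refine continuous_iff_continuousAt.2 fun x => ?_
  by_cases hx : x ∈ tsupport φ
  · have h1 : ContinuousAt (fun x => W.F x t) x :=
      ContinuousAt.comp (f := fun x => (x, t)) (g := Function.uncurry W.F)
        (W.contDiffAt x (hφ.subset hx) t ht).continuousAt (by fun_prop)
    exact h1.mul hφ.contDiff.continuous.continuousAt
  · have h : φ =ᶠ[𝓝 x] fun _ => 0 := notMem_tsupport_iff_eventuallyEq.1 hx
    refine (continuousAt_const (y := (0 : ℂ))).congr ?_
    filter_upwards [h] with y hy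
    rw [hy, mul_zero]

theorem WedgeRep.integrable_mul_test (W : WedgeRep T x₀ r v) {φ : E → ℂ}
    (hφ : IsTest (Metric.ball x₀ r) φ) {t : ℝ} (ht : t ∈ Ioo 0 W.t₀) :
    Integrable fun x => W.F x t * φ x :=
  (W.continuous_mul_test hφ ht).integrable_of_hasCompactSupport hφ.compact.mul_left

theorem IsTest.add {U : Set E} {φ ψ : E → ℂ} (hφ : IsTest U φ) (hψ : IsTest U ψ) :
    IsTest U (fun x => φ x + ψ x) where
  contDiff := hφ.contDiff.add hψ.contDiff
  compact := hφ.compact.add hψ.compact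
  subset := (tsupport_add φ ψ).trans (union_subset hφ.subset hψ.subset)

theorem IsTest.const_mul {U : Set E} {φ : E → ℂ} (hφ : IsTest U φ) (c : ℂ) :
    IsTest U (fun x => c * φ x) where
  contDiff := contDiff_const.mul hφ.contDiff
  compact := hφ.compact.mul_left
  subset := (tsupport_mul_subset_right (f := fun _ => c) (g := φ)).trans hφ.subset

theorem WedgeRep.map_add (W : WedgeRep T x₀ r v) {φ ψ : E → ℂ}
    (hφ : IsTest (Metric.ball x₀ r) φ) (hψ : IsTest (Metric.ball x₀ r) ψ) :
    T (fun x => φ x + ψ x) = T φ + T ψ := by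
  refine tendsto_nhds_unique (W.limit _ (hφ.add hψ)) (((W.limit _ hφ).add (W.limit _ hψ)).congr' ?_)
  filter_upwards [Ioo_mem_nhdsGT W.t₀_pos] with t ht
  rw [← integral_add (W.integrable_mul_test hφ ht) (W.integrable_mul_test hψ ht)]
  simp only [mul_add]

theorem WedgeRep.map_const_mul (W : WedgeRep T x₀ r v) {φ : E → ℂ}
    (hφ : IsTest (Metric.ball x₀ r) φ) (c : ℂ) : T (fun x => c * φ x) = c * T φ := by
  refine tendsto_nhds_unique (W.limit _ (hφ.const_mul c)) (((W.limit _ hφ).const_mul c).congr ?_)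
  intro t
  rw [← integral_const_mul]
  congr 1; funext x; ring

theorem WedgeRep.map_sub (W : WedgeRep T x₀ r v) {φ ψ : E → ℂ}
    (hφ : IsTest (Metric.ball x₀ r) φ) (hψ : IsTest (Metric.ball x₀ r) ψ) :
    T (fun x => φ x - ψ x) = T φ - T ψ := by
  have := W.map_add hφ (hψ.const_mul (-1))
  rw [W.map_const_mul hψ] at this
  simpa [sub_eq_add_neg] using this

theorem WedgeRep.norm_holoTest_le (W : WedgeRep T x₀ r v) {χ : E → ℂ}
    (hχ : IsTest (Metric.ball x₀ r) χ) {t₁ : ℝ} (ht₁ : 0 < t₁) (ht₁' : t₁ < W.t₀) :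
    ∃ A, 0 ≤ A ∧ ∀ (e : (Fin N → ℂ) → ℂ) (B : ℝ), Differentiable ℂ e → 0 ≤ B →
      (∀ x ∈ tsupport χ, ∀ s ∈ Icc 0 t₁, ‖e (cpt L v x s)‖ ≤ B) →
      ∀ t ∈ Ioc 0 (t₁ / 2), ‖∫ x, W.F x t * holoTest L χ e x‖ ≤ A * B := by
  obtain ⟨A, hA0, hA⟩ := W.norm_integral_holomorphic_le L hχ (σ := 0) (by simp) ht₁ ht₁'
  exact ⟨A, hA0, fun e B he hB h t ht => hA e B he hB (fun x hx s hs _ => h x hx s hs) t ht⟩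

/-- On cutoffs times holomorphic functions, `T` is bounded by the supremum of the holomorphic factor
on a compact set of complex points. Continuity in the parameter thus needs only uniform convergence
there, and no convergence of derivatives. -/
theorem WedgeRep.continuous_family (W : WedgeRep T x₀ r v) {χ : E → ℂ}
    (hχ : IsTest (Metric.ball x₀ r) χ) {P : Type*} [TopologicalSpace P]
    {e : P → (Fin N → ℂ) → ℂ} (he : ∀ p, Differentiable ℂ (e p))
    (hec : Continuous (Function.uncurry e)) : Continuous fun p => T (holoTest L χ (e p)) := by
  have ht : 0 < W.t₀ / 2 := half_pos W.t₀_pos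
  obtain ⟨A, hA0, hA⟩ := W.norm_holoTest_le L hχ ht (half_lt_self W.t₀_pos)
  refine continuous_iff_continuousAt.2 fun p => Metric.tendsto_nhds.2 fun ε hε => ?_
  set K : Set (Fin N → ℂ) := (fun q : E × ℝ => cpt L v q.1 q.2) '' (tsupport χ ×ˢ Icc 0 (W.t₀ / 2))
  have hK : IsCompact K := (hχ.compact.prod isCompact_Icc).image (continuous_cpt L v)
  have hδ : 0 < ε / (2 * (A + 1)) := by positivity
  obtain ⟨V, hV, hVe⟩ := hK.mem_uniformity_of_prod (f := e) (s := univ) (q := p)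
    (hec.continuousOn) (mem_univ p) (Metric.dist_mem_uniformity hδ)
  rw [nhdsWithin_univ] at hV
  filter_upwards [hV] with q hq
  have hsub : T (holoTest L χ (e q)) - T (holoTest L χ (e p))
      = T (holoTest L χ fun w => e q w - e p w) := by
    rw [← W.map_sub (isTest_holoTest L hχ (he q)) (isTest_holoTest L hχ (he p))]
    congr 1; funext x; simp only [holoTest]; ring
  have hd : Differentiable ℂ fun w => e q w - e p w := (he q).sub (he p)
  rw [dist_eq_norm, hsub]
  refine (W.norm_apply_le (isTest_holoTest L hχ hd) (half_pos ht)
    (hA _ (ε / (2 * (A + 1))) hd hδ.le fun x hx s hs => ?_)).trans_lt ?_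
  · have := hVe q hq _ (mem_image_of_mem _ (show (x, s) ∈ _ from ⟨hx, hs⟩))
    rw [mem_ofPred_eq, dist_eq_norm] at this
    exact this.le
  · rw [mul_div_assoc', div_lt_iff₀ (by positivity)]
    nlinarith

/-- For holomorphic families the contour estimate supplies the dominating function: a supremum bound
`b p` on the complex contour bounds the integrals at all small heights by a multiple of `b p`. -/
theorem WedgeRep.integral_comm_holoTest (W : WedgeRep T x₀ r v) {χ : E → ℂ}
    (hχ : IsTest (Metric.ball x₀ r) χ) {P : Type*} [TopologicalSpace P] [SecondCountableTopology P]
    [MeasurableSpace P] [OpensMeasurableSpace P] {μ : Measure P} [SFinite μ]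
    {e : P → (Fin N → ℂ) → ℂ} (he : ∀ p, Differentiable ℂ (e p))
    (hec : Continuous (Function.uncurry e)) {φ : E → ℂ} (hφ : IsTest (Metric.ball x₀ r) φ)
    (hφe : ∀ x, φ x = ∫ p, holoTest L χ (e p) x ∂μ) {t₁ : ℝ} (ht₁ : 0 < t₁) (ht₁' : t₁ < W.t₀)
    {b : P → ℝ} (hb : Integrable b μ)
    (hbound : ∀ᵐ p ∂μ, ∀ x ∈ tsupport χ, ∀ s ∈ Icc 0 t₁, ‖e p (cpt L v x s)‖ ≤ b p) :
    Integrable (fun p => T (holoTest L χ (e p))) μ ∧ ∫ p, T (holoTest L χ (e p)) ∂μ = T φ := by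
  rcases (tsupport χ).eq_empty_or_nonempty with h0 | ⟨z, hz⟩
  · have hχ0 : χ = 0 := tsupport_eq_empty_iff.1 h0
    have h1 : ∀ e : (Fin N → ℂ) → ℂ, holoTest L χ e = fun _ => 0 := fun e => by
      funext x; simp [holoTest, hχ0]
    have h2 : φ = fun _ => 0 := by funext x; rw [hφe]; simp [h1]
    have h3 : T (fun _ => 0) = 0 := by
      have := W.map_const_mul hφ 0
      simpa using this
    simp [h1, h2, h3]
  have hb0 : ∀ᵐ p ∂μ, 0 ≤ b p := hbound.mono fun p hp =>
    (norm_nonneg _).trans (hp z hz 0 ⟨le_rfl, ht₁.le⟩)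
  obtain ⟨A, hA0, hA⟩ := W.norm_holoTest_le L hχ ht₁ ht₁'
  refine W.integral_comm (fun p => isTest_holoTest L hχ (he p)) hφ hφe (half_pos ht₁)
    (hb.const_mul A) ?_ fun t ht => ?_
  · filter_upwards [hbound, hb0] with p hp hp0 t ht
    exact hA _ _ (he p) hp0 hp t ht
  · have htt : t ∈ Ioo 0 W.t₀ := ⟨ht.1, by linarith [ht.2]⟩
    have hc1 := W.continuous_mul_test hχ htt
    have hi1 := W.integrable_mul_test hχ htt
    have hmeas : Continuous fun q : P × E => W.F q.2 t * holoTest L χ (e q.1) q.2 := by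
      have h1 : Continuous fun q : P × E => e q.1 (cx L q.2) :=
        hec.comp (continuous_fst.prodMk ((continuous_cx L).comp continuous_snd))
      have : (fun q : P × E => W.F q.2 t * holoTest L χ (e q.1) q.2)
          = fun q => (W.F q.2 t * χ q.2) * e q.1 (cx L q.2) := by
        funext q; simp only [holoTest]; ring
      rw [this]
      exact (hc1.comp continuous_snd).mul h1
    refine (hb.norm.mul_prod hi1.norm).mono' hmeas.aestronglyMeasurable ?_
    have h2 : ∀ᵐ q ∂μ.prod (volume : Measure E), ∀ x ∈ tsupport χ,
        ‖e q.1 (cx L x)‖ ≤ b q.1 := by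
      have : ∀ᵐ p ∂μ, ∀ x ∈ tsupport χ, ‖e p (cx L x)‖ ≤ b p := hbound.mono fun p hp x hx => by
        have := hp x hx 0 ⟨le_rfl, ht₁.le⟩
        rwa [cpt_zero] at this
      exact Measure.quasiMeasurePreserving_fst.ae this
    filter_upwards [h2] with q hq
    by_cases hx : q.2 ∈ tsupport χ
    · have h3 := (hq _ hx).trans (le_abs_self _)
      simp only [holoTest, norm_mul, Real.norm_eq_abs]
      rw [← mul_assoc, mul_comm]
      gcongr
    · simp only [holoTest, image_eq_zero_of_notMem_tsupport hx, zero_mul, mul_zero, norm_zero, le_refl]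

end HolomorphicTest

/-! ### Exponential decay of plane wave components. -/

section Decay

/-- For `|w|² ≤ 1/4` the Jacobian factor is at most 2 and `Re ζ² ≥ ⟨ξ⟩²/4 - 1/2`. The `ε`-term then
contributes only a factor bounded for `ε ∈ [0,1]`, and the first exponential, which does not involve
`ε`, carries the decay used later. -/
theorem norm_fbiKernel_le {N : ℕ} {ε : ℝ} (hε : 0 ≤ ε) (ξ : Fin N → ℝ) (w : Fin N → ℂ)
    (hw : ∑ i, ‖w i‖ ^ 2 ≤ 1 / 4) :
    ‖fbiKernel ε 1 ξ w‖ ≤ 2 * Real.exp (∑ i, ξ i * (w i).im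
      - jap ξ * (∑ i, (w i).re ^ 2 - ∑ i, (w i).im ^ 2)) *
        Real.exp (ε / 2 - ε / 4 * jap ξ ^ 2) := by
  have hj := jap_pos ξ
  have hd := dotC_norm_le ξ (M := 1 / 2) (by norm_num) (hw.trans_eq (by norm_num))
  rw [fbiKernel, norm_mul, mul_assoc 2, ← Real.exp_add]
  refine mul_le_mul ?_ ?_ (norm_nonneg _) (by norm_num)
  · refine (norm_sub_le _ _).trans ?_
    have : ‖Complex.I * (1 : ℝ) * dotC ξ w / jap ξ‖ ≤ 1 := by
      rw [norm_div, norm_mul, norm_mul, Complex.norm_I, Complex.norm_real, Complex.norm_real,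
        norm_one, one_mul, one_mul, Real.norm_of_nonneg hj.le, div_le_one hj]
      linarith only [hd, hj]
    rw [norm_one]
    linarith only [this]
  · rw [fbiExp, Complex.norm_exp]
    refine Real.exp_le_exp.2 ?_
    set p := ∑ i, ξ i * (w i).re
    set b := ∑ i, ξ i * (w i).im with hb
    set A := ∑ i, (w i).re ^ 2
    set B := ∑ i, (w i).im ^ 2 with hB
    set C := ∑ i, (w i).re * (w i).im
    have hdot : dotC ξ w = (p : ℂ) + (b : ℂ) * Complex.I := by
      apply Complex.ext <;> simp [dotC, p, b]
    have hsq : sqC w = ((A - B : ℝ) : ℂ) + ((2 * C : ℝ) : ℂ) * Complex.I := by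
      apply Complex.ext
      · simp [sqC, A, B, sq, Finset.sum_sub_distrib]
      · simp only [sqC, C, sq, Complex.im_sum, Complex.mul_im, Complex.add_im, Complex.ofReal_im,
          Complex.ofReal_re, Complex.I_im, Complex.I_re, mul_one, mul_zero, add_zero, zero_add,
          Finset.mul_sum]
        exact Finset.sum_congr rfl fun i _ => by ring
    have hAB : A + B ≤ 1 / 4 := by
      refine le_of_eq_of_le ?_ hw
      rw [← Finset.sum_add_distrib]
      exact Finset.sum_congr rfl fun i _ => by rw [Complex.sq_norm, Complex.normSq_apply]; ring
    have hre : (-Complex.I * dotC ξ w - (1 : ℝ) * jap ξ * sqC w - ε * ((jap ξ : ℂ) ^ 2 - 1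
        - 2 * Complex.I * (1 : ℝ) * jap ξ * dotC ξ w
        - ((1 : ℝ) : ℂ) ^ 2 * (jap ξ : ℂ) ^ 2 * sqC w)).re
        = b - jap ξ * (A - B) - ε * (jap ξ ^ 2 - 1 + 2 * jap ξ * b - jap ξ ^ 2 * (A - B)) := by
      rw [hdot, hsq]
      have : (-Complex.I * ((p : ℂ) + (b : ℂ) * Complex.I) - (1 : ℝ) * jap ξ *
          (((A - B : ℝ) : ℂ) + ((2 * C : ℝ) : ℂ) * Complex.I) - ε * ((jap ξ : ℂ) ^ 2 - 1
          - 2 * Complex.I * (1 : ℝ) * jap ξ * ((p : ℂ) + (b : ℂ) * Complex.I)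
          - ((1 : ℝ) : ℂ) ^ 2 * (jap ξ : ℂ) ^ 2 *
            (((A - B : ℝ) : ℂ) + ((2 * C : ℝ) : ℂ) * Complex.I)))
          = ((b - jap ξ * (A - B) - ε * (jap ξ ^ 2 - 1 + 2 * jap ξ * b
              - jap ξ ^ 2 * (A - B)) : ℝ) : ℂ)
            + ((-p - jap ξ * (2 * C) - ε * (-2 * jap ξ * p - jap ξ ^ 2 * (2 * C)) : ℝ) : ℂ)
              * Complex.I := by
        push_cast
        linear_combination (-(b : ℂ) + 2 * ε * jap ξ * b) * Complex.I_sq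
      rw [this, Complex.add_re, Complex.re_ofReal_mul, Complex.I_re, mul_zero, add_zero,
        Complex.ofReal_re]
    rw [hre]
    have hS : ∑ i, ξ i ^ 2 = jap ξ ^ 2 - 1 := by rw [jap_sq]; ring
    -- The squares `(ξ_i + 2⟨ξ⟩ Im w_i)²` control the cross term `2⟨ξ⟩ ξ·Im w`, the only indefinite
    -- contribution to `Re ζ²`.
    have hcs : 0 ≤ (∑ i, ξ i ^ 2) / 2 + 2 * jap ξ * b + 2 * jap ξ ^ 2 * B := by
      have : (∑ i, ξ i ^ 2) / 2 + 2 * jap ξ * b + 2 * jap ξ ^ 2 * B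
          = ∑ i, (ξ i + 2 * jap ξ * (w i).im) ^ 2 / 2 := by
        rw [hb, hB, Finset.sum_div, Finset.mul_sum, Finset.mul_sum, ← Finset.sum_add_distrib,
          ← Finset.sum_add_distrib]
        exact Finset.sum_congr rfl fun i _ => by ring
      rw [this]
      positivity
    rw [hS] at hcs
    have h1 : jap ξ ^ 2 / 4 - 1 / 2
        ≤ jap ξ ^ 2 - 1 + 2 * jap ξ * b - jap ξ ^ 2 * (A - B) := by
      nlinarith [mul_le_mul_of_nonneg_left hAB (sq_nonneg (jap ξ))]
    nlinarith [mul_le_mul_of_nonneg_left h1 hε]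

variable {E : Type*} [NormedAddCommGroup E] [NormedSpace ℝ E] [FiniteDimensional ℝ E]
  [MeasureSpace E] [BorelSpace E] [(volume : Measure E).IsAddHaarMeasure]

variable {N : ℕ} (L : E ≃L[ℝ] (Fin N → ℝ))

/-- `|L(x - x₀)|²`. -/
def coordSq (x x₀ : E) : ℝ := ∑ i, (L x i - L x₀ i) ^ 2

theorem exists_coordSq_lower (x₀ : E) {σ : ℝ} (hσ : 0 < σ) :
    ∃ q, 0 < q ∧ ∀ x, σ ≤ dist x x₀ → q ≤ coordSq L x x₀ := by
  obtain ⟨C, hC, h⟩ := L.symm.toContinuousLinearMap.bound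
  refine ⟨(σ / C) ^ 2, by positivity, fun x hx => ?_⟩
  have h1 : dist x x₀ ≤ C * ‖L x - L x₀‖ := by
    have := h (L x - L x₀)
    simpa [dist_eq_norm, ← _root_.map_sub] using this
  have h2 : σ / C ≤ ‖L x - L x₀‖ := by rw [div_le_iff₀' hC]; exact hx.trans h1
  have h3 : ‖L x - L x₀‖ ≤ √(coordSq L x x₀) := by
    refine (pi_norm_le_iff_of_nonneg (Real.sqrt_nonneg _)).2 fun i => ?_
    refine Real.abs_le_sqrt ?_
    exact Finset.single_le_sum (f := fun i => (L x i - L x₀ i) ^ 2) (fun i _ => sq_nonneg _)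
      (Finset.mem_univ i)
  have h4 := h2.trans h3
  have h5 := pow_le_pow_left₀ (by positivity) h4 2
  have h6 : 0 ≤ coordSq L x x₀ := Finset.sum_nonneg fun i _ => sq_nonneg _
  rwa [Real.sq_sqrt h6] at h5

section Estimates

variable (v : E) {x x₀ : E} {y : Fin N → ℂ} {s δ : ℝ}

/-- Writing `cpt - y` as the undisplaced contour point minus the displacement `y - cx L x₀`, whose
components are at most `δ`, the squares are compared by elementary quadratic inequalities. The last
bound isolates `s ξ·v`, the term which gives decay. -/
theorem shifted_bounds (hy : ‖y - cx L x₀‖ ≤ δ) (ξ : Fin N → ℝ) :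
    (∑ i, ((cpt L v x s - y) i).im ^ 2 ≤ 2 * s ^ 2 * (∑ i, L v i ^ 2) + 2 * N * δ ^ 2) ∧
    (coordSq L x x₀ / 2 - N * δ ^ 2 ≤ ∑ i, ((cpt L v x s - y) i).re ^ 2) ∧
    (∑ i, ((cpt L v x s - y) i).re ^ 2 ≤ 2 * coordSq L x x₀ + 2 * N * δ ^ 2) ∧
    (∑ i, ξ i * ((cpt L v x s - y) i).im ≤ s * (∑ i, ξ i * L v i) + N * δ * ‖ξ‖) := by
  have hδ : 0 ≤ δ := (norm_nonneg _).trans hy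
  have hre : ∀ i, ((cpt L v x s - y) i).re = (L x i - L x₀ i) - ((y - cx L x₀) i).re := by
    intro i; simp [cpt, cx]
  have him : ∀ i, ((cpt L v x s - y) i).im = s * L v i - ((y - cx L x₀) i).im := by
    intro i; simp [cpt, cx]
  have h1 : ∀ i, |((y - cx L x₀) i).re| ≤ δ := fun i =>
    (Complex.abs_re_le_norm _).trans ((norm_le_pi_norm _ i).trans hy)
  have h2 : ∀ i, |((y - cx L x₀) i).im| ≤ δ := fun i =>
    (Complex.abs_im_le_norm _).trans ((norm_le_pi_norm _ i).trans hy)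
  have h1' : ∀ i, ((y - cx L x₀) i).re ^ 2 ≤ δ ^ 2 := fun i => sq_le_sq' (abs_le.1 (h1 i)).1
    (abs_le.1 (h1 i)).2
  have h2' : ∀ i, ((y - cx L x₀) i).im ^ 2 ≤ δ ^ 2 := fun i => sq_le_sq' (abs_le.1 (h2 i)).1
    (abs_le.1 (h2 i)).2
  have hN : ∀ c : ℝ, ∑ _i : Fin N, c = N * c := fun c => by simp
  simp only [hre, him]
  refine ⟨?_, ?_, ?_, ?_⟩
  · rw [mul_assoc 2 (N : ℝ), ← hN, Finset.mul_sum, Finset.mul_sum, ← Finset.sum_add_distrib]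
    refine Finset.sum_le_sum fun i _ => ?_
    nlinarith [h2' i, sq_nonneg (s * L v i + ((y - cx L x₀) i).im)]
  · rw [coordSq, ← hN, Finset.sum_div, ← Finset.sum_sub_distrib]
    refine Finset.sum_le_sum fun i _ => ?_
    nlinarith [h1' i, sq_nonneg ((L x i - L x₀ i) - 2 * ((y - cx L x₀) i).re)]
  · rw [coordSq, mul_assoc 2 (N : ℝ), ← hN, Finset.mul_sum, Finset.mul_sum,
      ← Finset.sum_add_distrib]
    refine Finset.sum_le_sum fun i _ => ?_
    nlinarith [h1' i, sq_nonneg ((L x i - L x₀ i) + ((y - cx L x₀) i).re)]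
  · rw [mul_assoc (N : ℝ), ← hN, Finset.mul_sum, ← Finset.sum_add_distrib]
    refine Finset.sum_le_sum fun i _ => ?_
    have h3 : -(ξ i * ((y - cx L x₀) i).im) ≤ δ * ‖ξ‖ := by
      refine (neg_le_abs _).trans ?_
      rw [abs_mul, mul_comm]
      exact mul_le_mul (h2 i) (norm_le_pi_norm ξ i) (abs_nonneg _) hδ
    nlinarith

theorem sum_norm_sq_le (hy : ‖y - cx L x₀‖ ≤ δ) (hx : coordSq L x x₀ ≤ 1 / 32)
    (h1 : s ^ 2 * (∑ i, L v i ^ 2) ≤ 1 / 32) (h2 : N * δ ^ 2 ≤ 1 / 32) :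
    ∑ i, ‖(cpt L v x s - y) i‖ ^ 2 ≤ 1 / 4 := by
  obtain ⟨ha, -, hb, -⟩ := shifted_bounds L v (x := x) (s := s) hy (0 : Fin N → ℝ)
  have : ∑ i, ‖(cpt L v x s - y) i‖ ^ 2 = ∑ i, ((cpt L v x s - y) i).re ^ 2
      + ∑ i, ((cpt L v x s - y) i).im ^ 2 := by
    rw [← Finset.sum_add_distrib]
    exact Finset.sum_congr rfl fun i _ => by rw [Complex.sq_norm, Complex.normSq_apply]; ring
  rw [this]
  nlinarith

end Estimates

variable {T : (E → ℂ) → ℂ} {x₀ v : E} {r : ℝ}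

/-- Exponential decay of the plane wave components in the directions in which `T` is a boundary
value from a wedge. -/
theorem WedgeRep.exists_decay (W : WedgeRep T x₀ r v) {χ : E → ℂ}
    (hχ : IsTest (Metric.ball x₀ r) χ) {σ : ℝ} (hσ0 : 0 < σ)
    (hσ : ∀ x ∈ Metric.ball x₀ σ, χ x = 1) (hr : ∀ x ∈ tsupport χ, coordSq L x x₀ ≤ 1 / 32)
    {c₀ : ℝ} (hc₀ : 0 < c₀) :
    ∃ A c δ : ℝ, 0 < c ∧ 0 < δ ∧ ∀ ξ : Fin N → ℝ, ∑ i, ξ i * L v i ≤ -c₀ * ‖ξ‖ →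
      ∀ ε ∈ Icc (0 : ℝ) 1, ∀ y : Fin N → ℂ, ‖y - cx L x₀‖ ≤ δ →
        ‖T (holoTest L χ fun w => fbiKernel ε 1 ξ (w - y))‖ ≤ A * Real.exp (-c * ‖ξ‖) := by
  obtain ⟨q, hq0, hq⟩ := exists_coordSq_lower L x₀ hσ0
  set V : ℝ := ∑ i, L v i ^ 2 with hV
  have hV0 : 0 ≤ V := by positivity
  have ev : ∀ f : ℝ → ℝ, Continuous f → f 0 = 0 → ∀ M > 0, ∀ᶠ t in 𝓝[>] (0 : ℝ), f t < M :=
    fun f hf h0 M hM => (hf.tendsto' 0 0 h0).mono_left nhdsWithin_le_nhds |>.eventually_lt_const hM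
  -- The gain `ξ·v` is linear in the height while the loss `⟨ξ⟩(Im w)²` is quadratic, so for small
  -- `t₁` the gain wins by the last condition. The bound `q / 32` protects the damping away from
  -- `x₀`, and `1 / 32` keeps the argument in the region where the kernel bound holds.
  obtain ⟨t₁, ht₁0, ht₁, ht₁V, ht₁q, ht₁c⟩ : ∃ t₁ : ℝ, 0 < t₁ ∧ t₁ < W.t₀ ∧
      t₁ ^ 2 * V < 1 / 32 ∧ t₁ ^ 2 * V < q / 32 ∧ N * (t₁ * V) < c₀ / 32 := by
    have := (eventually_mem_nhdsWithin (a := (0 : ℝ)) (s := Ioi 0)).and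
      ((ev id continuous_id rfl _ W.t₀_pos).and ((ev (fun t => t ^ 2 * V) (by fun_prop) (by simp)
      (1 / 32) (by norm_num)).and ((ev (fun t => t ^ 2 * V) (by fun_prop) (by simp) (q / 32)
      (by positivity)).and (ev (fun t => N * (t * V)) (by fun_prop) (by simp) (c₀ / 32)
      (by positivity)))))
    exact this.exists
  -- The complex displacement of the base point is chosen after `t₁`, small compared with both
  -- gains, `t₁c₀` and `q`.
  obtain ⟨δ, hδ0, hδ1, hδ2, hδ3, hδ4, hδ5⟩ : ∃ δ : ℝ, 0 < δ ∧ N * δ ^ 2 < 1 / 32 ∧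
      N * δ ^ 2 < q / 64 ∧ N * δ < t₁ * c₀ / 16 ∧ N * δ < q / 16 ∧
      N * (N * δ ^ 2) < t₁ * c₀ / 32 := by
    have := (eventually_mem_nhdsWithin (a := (0 : ℝ)) (s := Ioi 0)).and
      ((ev (fun t => N * t ^ 2) (by fun_prop) (by simp) (1 / 32) (by norm_num)).and
      ((ev (fun t => N * t ^ 2) (by fun_prop) (by simp) (q / 64) (by positivity)).and
      ((ev (fun t => N * t) (by fun_prop) (by simp) (t₁ * c₀ / 16) (by positivity)).and
      ((ev (fun t => N * t) (by fun_prop) (by simp) (q / 16) (by positivity)).and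
      (ev (fun t => N * (N * t ^ 2)) (by fun_prop) (by simp) (t₁ * c₀ / 32) (by positivity))))))
    exact this.exists
  obtain ⟨A, hA0, hA⟩ := W.norm_integral_holomorphic_le L hχ hσ ht₁0 ht₁
  set c : ℝ := min (t₁ * c₀ / 8) (q / 16) with hc
  have hc0 : 0 < c := by positivity
  refine ⟨A * (2 * Real.exp 1 * Real.exp 1), c, δ, hc0, hδ0, fun ξ hξ ε hε y hy => ?_⟩
  have hd : Differentiable ℂ fun w => fbiKernel ε 1 ξ (w - y) :=
    (differentiable_fbiKernel ε 1 ξ).comp (by fun_prop)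
  refine W.norm_apply_le (isTest_holoTest L hχ hd) (half_pos ht₁0) fun t ht => ?_
  rw [mul_assoc A]
  refine hA _ _ hd (by positivity) (fun x hx s hs hor => ?_) t ht
  have hs0 := hs.1
  have hs2 : s ^ 2 * V ≤ t₁ ^ 2 * V := by
    have := hs.2
    gcongr
  obtain ⟨b1, b2, b3, b4⟩ := shifted_bounds L v (x := x) hy ξ
  rw [← hV] at b1
  refine (norm_fbiKernel_le hε.1 ξ _ (sum_norm_sq_le L v hy (hr x hx)
    (by rw [← hV]; linarith) hδ1.le)).trans ?_
  set a := ∑ i, ((cpt L v x s - y) i).re ^ 2 with ha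
  set b := ∑ i, ((cpt L v x s - y) i).im ^ 2
  have ha0 : 0 ≤ a := by positivity
  have hn := norm_nonneg ξ
  have hj1 := one_le_jap ξ
  have hj2 := jap_le ξ
  have hj3 := norm_le_jap ξ
  have he2 : Real.exp (ε / 2 - ε / 4 * jap ξ ^ 2) ≤ Real.exp 1 := by
    refine Real.exp_le_exp.2 ?_
    have := mul_nonneg hε.1 (sq_nonneg (jap ξ))
    linarith [hε.2]
  have hmain : ∑ i, ξ i * ((cpt L v x s - y) i).im - jap ξ * (a - b) ≤ 1 + -c * ‖ξ‖ := by
    -- Near the top of the contour, `s ≥ t₁/2` and the phase contributes at most `-(t₁/2)c₀‖ξ‖`.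
    -- Away from `x₀` the damping contributes at most `-(q/4)‖ξ‖`, while the phase term is not
    -- positive.
    rcases hor with h | h
    · have hc1 : c ≤ t₁ * c₀ / 8 := min_le_left _ _
      have hb : b ≤ 2 * (t₁ ^ 2 * V) + 2 * (N * δ ^ 2) := by linarith
      have hb0 : 0 ≤ 2 * (t₁ ^ 2 * V) + 2 * (N * δ ^ 2) := by positivity
      have e1 : jap ξ * b ≤ (1 + N * ‖ξ‖) * (2 * (t₁ ^ 2 * V) + 2 * (N * δ ^ 2)) :=
        mul_le_mul hj2 hb (by positivity) (by positivity)
      have e1' : (1 + N * ‖ξ‖) * (2 * (t₁ ^ 2 * V) + 2 * (N * δ ^ 2)) = 2 * (t₁ ^ 2 * V)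
        + 2 * (N * δ ^ 2) + N * ‖ξ‖ * (2 * (t₁ ^ 2 * V)) + N * ‖ξ‖ * (2 * (N * δ ^ 2)) := by ring
      have e2 : s * (∑ i, ξ i * L v i) ≤ -(t₁ / 2) * c₀ * ‖ξ‖ := by
        have := mul_le_mul_of_nonneg_left hξ hs0
        have h7 : t₁ / 2 * (c₀ * ‖ξ‖) ≤ s * (c₀ * ‖ξ‖) := by gcongr
        linarith
      have e3 : (N : ℝ) * ‖ξ‖ * (2 * (t₁ ^ 2 * V)) ≤ t₁ * c₀ / 16 * ‖ξ‖ := by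
        have := mul_le_mul_of_nonneg_left ht₁c.le (by positivity : 0 ≤ 2 * t₁ * ‖ξ‖)
        linarith
      have e4 : (N : ℝ) * ‖ξ‖ * (2 * (N * δ ^ 2)) ≤ t₁ * c₀ / 16 * ‖ξ‖ := by
        have := mul_le_mul_of_nonneg_left hδ5.le (by positivity : 0 ≤ 2 * ‖ξ‖)
        linarith
      have e5 : N * δ * ‖ξ‖ ≤ t₁ * c₀ / 16 * ‖ξ‖ := by gcongr
      have e6 : c * ‖ξ‖ ≤ t₁ * c₀ / 8 * ‖ξ‖ := by gcongr
      have e7 : 0 ≤ jap ξ * a := by positivity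
      have e8 : 0 ≤ t₁ * c₀ * ‖ξ‖ := by positivity
      have e9 : jap ξ * (a - b) = jap ξ * a - jap ξ * b := by ring
      linarith
    · have hc1 : c ≤ q / 16 := min_le_right _ _
      have hqx := hq x h
      have hab : q / 4 ≤ a - b := by linarith
      have e1 : ‖ξ‖ * (q / 4) ≤ jap ξ * (a - b) := mul_le_mul hj3 hab (by positivity) (by positivity)
      have e2 : s * (∑ i, ξ i * L v i) ≤ 0 := by
        have : -c₀ * ‖ξ‖ ≤ 0 := by nlinarith
        exact mul_nonpos_of_nonneg_of_nonpos hs0 (hξ.trans this)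
      have e5 : N * δ * ‖ξ‖ ≤ q / 16 * ‖ξ‖ := by gcongr
      have e6 : c * ‖ξ‖ ≤ q / 16 * ‖ξ‖ := by gcongr
      have e7 : 0 ≤ q * ‖ξ‖ := by positivity
      linarith
  calc _ ≤ 2 * Real.exp (1 + -c * ‖ξ‖) * Real.exp 1 := by gcongr
    _ = _ := by rw [Real.exp_add]; ring

end Decay

/-! ### Finite sums of boundary values. -/

section WedgeSum

theorem exists_pos_forall_le {ι : Type*} [Finite ι] (f : ι → ℝ) (hf : ∀ j, 0 < f j) :
    ∃ c, 0 < c ∧ ∀ j, c ≤ f j := by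
  have h1 : ∀ᶠ c in 𝓝[>] (0 : ℝ), ∀ j, c ≤ f j := eventually_all.2 fun j => by
    filter_upwards [Ioc_mem_nhdsGT (hf j)] with c hc using hc.2
  exact ((eventually_mem_nhdsWithin (a := (0 : ℝ)) (s := Ioi 0)).and h1).exists

variable {E : Type*} [NormedAddCommGroup E] [NormedSpace ℝ E]

theorem IsTest.mono {U U' : Set E} {φ : E → ℂ} (hφ : IsTest U φ) (h : U ⊆ U') : IsTest U' φ :=
  ⟨hφ.contDiff, hφ.compact, hφ.subset.trans h⟩

variable [MeasureSpace E]

/-- Restriction to a smaller ball. -/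
def WedgeRep.mono {T : (E → ℂ) → ℂ} {x₀ v : E} {r r' : ℝ} (W : WedgeRep T x₀ r v) (h : r' ≤ r) :
    WedgeRep T x₀ r' v where
  F := W.F
  t₀ := W.t₀
  C := W.C
  m := W.m
  t₀_pos := W.t₀_pos
  contDiffAt x hx := W.contDiffAt x (Metric.ball_subset_ball h hx)
  dbar_eq x hx := W.dbar_eq x (Metric.ball_subset_ball h hx)
  bound x hx := W.bound x (Metric.ball_subset_ball h hx)
  limit φ hφ := W.limit φ (hφ.mono (Metric.ball_subset_ball h))

/-- Finite sums of boundary values. -/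
structure WedgeSum (T : (E → ℂ) → ℂ) (x₀ : E) (r : ℝ) where
  m : ℕ
  S : Fin m → (E → ℂ) → ℂ
  v : Fin m → E
  rep : ∀ j, WedgeRep (S j) x₀ r (v j)
  eq : ∀ φ, IsTest (Metric.ball x₀ r) φ → T φ = ∑ j, S j φ

/-- Restriction to a smaller ball. -/
def WedgeSum.mono {T : (E → ℂ) → ℂ} {x₀ : E} {r r' : ℝ} (D : WedgeSum T x₀ r) (h : r' ≤ r) :
    WedgeSum T x₀ r' where
  m := D.m
  S := D.S
  v := D.v
  rep j := (D.rep j).mono h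
  eq φ hφ := D.eq φ (hφ.mono (Metric.ball_subset_ball h))

/-- `T` is near `x₀` a sum of boundary values from wedges in directions on which `η` is negative. -/
def IsWedgeSumAt (T : (E → ℂ) → ℂ) (x₀ : E) (η : E →L[ℝ] ℝ) : Prop :=
  ∃ r, 0 < r ∧ ∃ D : WedgeSum T x₀ r, ∀ j, η (D.v j) < 0

variable [FiniteDimensional ℝ E] [BorelSpace E] [(volume : Measure E).IsAddHaarMeasure]
variable {N : ℕ} (L : E ≃L[ℝ] (Fin N → ℝ))
variable {T : (E → ℂ) → ℂ} {x₀ : E} {r : ℝ}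

theorem WedgeSum.continuous_family (D : WedgeSum T x₀ r) {χ : E → ℂ}
    (hχ : IsTest (Metric.ball x₀ r) χ) {P : Type*} [TopologicalSpace P]
    {e : P → (Fin N → ℂ) → ℂ} (he : ∀ p, Differentiable ℂ (e p))
    (hec : Continuous (Function.uncurry e)) : Continuous fun p => T (holoTest L χ (e p)) := by
  simp only [D.eq _ (isTest_holoTest L hχ (he _))]
  exact continuous_finsetSum _ fun j _ => (D.rep j).continuous_family L hχ he hec

theorem norm_cpt_sub_le (v x : E) {s t ρ : ℝ} (hs : s ∈ Icc 0 t) (h : t * ‖L v‖ ≤ ρ) :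
    ‖cpt L v x s - cx L x‖ ≤ ρ := by
  have hρ : 0 ≤ ρ := (mul_nonneg (hs.1.trans hs.2) (norm_nonneg _)).trans h
  refine (pi_norm_le_iff_of_nonneg hρ).2 fun i => ?_
  have : (cpt L v x s - cx L x) i = Complex.I * s * (L v i : ℂ) := by simp [cpt, cx]
  rw [this, norm_mul, norm_mul, Complex.norm_I, one_mul, Complex.norm_real, Complex.norm_real,
    Real.norm_of_nonneg hs.1]
  exact (mul_le_mul hs.2 (norm_le_pi_norm (L v) i) (norm_nonneg _) (hs.1.trans hs.2)).trans h

/-- The summands have different directions and heights, so the hypothesis is a bound on a complex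
tube around the support; every ray stays in the tube at small heights. -/
theorem WedgeSum.integral_comm (D : WedgeSum T x₀ r) {χ : E → ℂ}
    (hχ : IsTest (Metric.ball x₀ r) χ) {P : Type*} [TopologicalSpace P] [SecondCountableTopology P]
    [MeasurableSpace P] [OpensMeasurableSpace P] {μ : Measure P} [SFinite μ]
    {e : P → (Fin N → ℂ) → ℂ} (he : ∀ p, Differentiable ℂ (e p))
    (hec : Continuous (Function.uncurry e)) {φ : E → ℂ} (hφ : IsTest (Metric.ball x₀ r) φ)
    (hφe : ∀ x, φ x = ∫ p, holoTest L χ (e p) x ∂μ) {ρ : ℝ} (hρ : 0 < ρ)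
    {b : P → ℝ} (hb : Integrable b μ)
    (hbound : ∀ᵐ p ∂μ, ∀ x ∈ tsupport χ, ∀ w, ‖w - cx L x‖ ≤ ρ → ‖e p w‖ ≤ b p) :
    Integrable (fun p => T (holoTest L χ (e p))) μ ∧ ∫ p, T (holoTest L χ (e p)) ∂μ = T φ := by
  have key : ∀ j, Integrable (fun p => D.S j (holoTest L χ (e p))) μ ∧
      ∫ p, D.S j (holoTest L χ (e p)) ∂μ = D.S j φ := by
    intro j
    obtain ⟨t, ht0, ht1, ht2⟩ : ∃ t, 0 < t ∧ t < (D.rep j).t₀ ∧ t * ‖L (D.v j)‖ ≤ ρ := by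
      have h1 : Tendsto (fun t : ℝ => t * ‖L (D.v j)‖) (𝓝[>] 0) (𝓝 0) :=
        ((by fun_prop : Continuous fun t : ℝ => t * ‖L (D.v j)‖).tendsto' 0 0 (by simp)).mono_left
          nhdsWithin_le_nhds
      have h0 : ∀ᶠ t in 𝓝[>] (0 : ℝ), t ∈ Ioo 0 (D.rep j).t₀ := Ioo_mem_nhdsGT (D.rep j).t₀_pos
      obtain ⟨t, h2, h3⟩ := (h0.and (h1.eventually_lt_const hρ)).exists
      exact ⟨t, h2.1, h2.2, h3.le⟩
    refine (D.rep j).integral_comm_holoTest L hχ he hec hφ hφe ht0 ht1 hb ?_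
    filter_upwards [hbound] with p hp x hx s hs
    exact hp x hx _ (norm_cpt_sub_le L _ x hs ht2)
  simp only [D.eq _ (isTest_holoTest L hχ (he _)), D.eq φ hφ]
  refine ⟨integrable_finsetSum _ fun j _ => (key j).1, ?_⟩
  rw [integral_finsetSum _ fun j _ => (key j).1]
  exact Finset.sum_congr rfl fun j _ => (key j).2

theorem isCompact_tube {K : Set E} (hK : IsCompact K) (ρ : ℝ) :
    IsCompact {w : Fin N → ℂ | ∃ x ∈ K, ‖w - cx L x‖ ≤ ρ} := by
  have h := (hK.prod (isCompact_closedBall (0 : Fin N → ℂ) ρ)).image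
    (f := fun q : E × (Fin N → ℂ) => cx L q.1 + q.2)
    (((continuous_cx L).comp continuous_fst).add continuous_snd)
  convert h using 1
  ext w
  constructor
  · rintro ⟨x, hx, hw⟩
    exact ⟨(x, w - cx L x), ⟨hx, by simpa using hw⟩, by simp⟩
  · rintro ⟨⟨x, u⟩, ⟨hx, hu⟩, rfl⟩
    exact ⟨x, hx, by simpa using hu⟩

/-- The order `k` only has to exceed `m + 1` for every summand, which the sum of these numbers does.
-/
theorem WedgeSum.exists_norm_mul_le (D : WedgeSum T x₀ r) {χ : E → ℂ}
    (hχ : IsTest (Metric.ball x₀ r) χ) : ∃ A k, ∀ (ψ : E → ℂ) (B : ℝ), ContDiff ℝ ∞ ψ → 0 ≤ B →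
      (∀ j x, ∀ i ≤ k, ‖(dirDeriv (D.v j))^[i] ψ x‖ ≤ B) → ‖T (fun x => χ x * ψ x)‖ ≤ A * B := by
  choose t A ht hA0 hA using fun j => (D.rep j).norm_integral_mul_le hχ
  refine ⟨∑ j, A j, ∑ j, ((D.rep j).m + 1), fun ψ B hψ hB h => ?_⟩
  rw [D.eq _ (hχ.mul_contDiff hψ), Finset.sum_mul]
  refine norm_sum_le_of_le _ fun j _ => ?_
  refine (D.rep j).norm_apply_le (hχ.mul_contDiff hψ) (ht j) (hA j ψ B hψ hB fun x i hi => ?_)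
  exact h j x i (hi.trans (Finset.single_le_sum (f := fun j => (D.rep j).m + 1)
    (fun _ _ => Nat.zero_le _) (Finset.mem_univ j)))

end WedgeSum

/-! ## Gaussian regularisation -/

section Gauss

variable {E : Type*} [NormedAddCommGroup E] [NormedSpace ℝ E] [FiniteDimensional ℝ E]
  [MeasureSpace E] [BorelSpace E] [(volume : Measure E).IsAddHaarMeasure]

variable {N : ℕ} (L : E ≃L[ℝ] (Fin N → ℝ))

theorem finrank_eq_of_coord (L : E ≃L[ℝ] (Fin N → ℝ)) : Module.finrank ℝ E = N := by
  simpa using L.toLinearEquiv.finrank_eq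

theorem cx_sub (x y : E) : cx L (x - y) = cx L x - cx L y := by
  funext i; simp [cx]

theorem integrable_comp_coord {f : (Fin N → ℝ) → ℝ} (hf : Integrable f) :
    Integrable fun x : E => f (L x) := by
  have h2 : Measure.map L (volume : Measure E)
      = Measure.addHaarScalarFactor (Measure.map L (volume : Measure E)) volume • volume :=
    Measure.isAddLeftInvariant_eq_smul _ _
  have h3 : Integrable f (Measure.map L (volume : Measure E)) := by
    rw [h2]
    exact hf.smul_measure_nnreal
  exact (L.toHomeomorph.measurableEmbedding.integrable_map_iff).1 h3

theorem gaussKernel_cx (ε : ℝ) (hε : 0 < ε) (x : E) : gaussKernel ε (cx L x)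
    = (((Real.pi / ε) ^ ((N : ℝ) / 2) * Real.exp (-(∑ i, L x i ^ 2) / (4 * ε)) : ℝ) : ℂ) := by
  have h : (0 : ℝ) ≤ Real.pi / ε := by positivity
  rw [gaussKernel, Complex.ofReal_mul, Complex.ofReal_cpow h]
  congr 1
  · push_cast; rfl
  · push_cast [sqC, cx]
    rfl

/-- All Gaussians are rescalings of the one with `ε = 1/4`, whose exponent is `-|x|²`. This reduces
limits `ε → 0` to dilations by `2√ε`. -/
theorem gaussKernel_scale {ε : ℝ} (hε : 0 < ε) (x : E) :
    ((2 * √ε) ^ N : ℝ) * gaussKernel ε (cx L ((2 * √ε) • x)) = gaussKernel (1 / 4) (cx L x) := by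
  rw [gaussKernel_cx L ε hε, gaussKernel_cx L _ (by norm_num), ← Complex.ofReal_mul]
  congr 1
  rw [← mul_assoc]
  congr 1
  · have h1 : (2 * √ε) ^ N = (4 * ε) ^ ((N : ℝ) / 2) := by
      rw [← Real.rpow_natCast, show (2 * √ε) = (4 * ε) ^ ((1 : ℝ) / 2) by
        rw [← Real.sqrt_eq_rpow, Real.sqrt_mul (by norm_num), show (4 : ℝ) = 2 ^ 2 by norm_num,
          Real.sqrt_sq (by norm_num)], ← Real.rpow_mul (by positivity)]
      congr 1; ring
    rw [h1, ← Real.mul_rpow (by positivity) (by positivity)]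
    congr 1
    field_simp
  · congr 1
    have : ∀ i, L ((2 * √ε) • x) i ^ 2 = 4 * ε * L x i ^ 2 := fun i => by
      rw [map_smul, Pi.smul_apply, smul_eq_mul, mul_pow, mul_pow, Real.sq_sqrt hε.le]; ring
    simp only [this, ← Finset.mul_sum]
    field_simp

theorem continuous_gaussKernel_cx (ε : ℝ) : Continuous fun x : E => gaussKernel ε (cx L x) :=
  (differentiable_gaussKernel ε).continuous.comp (continuous_cx L)

theorem integrable_gaussKernel_mul_norm (k : ℕ) :
    Integrable fun x : E => ‖gaussKernel (1 / 4) (cx L x)‖ * ‖x‖ ^ k := by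
  have h1 := (integrable_comp_coord L
    (integrable_jap_exp (N := N) k 0 (one_pos (α := ℝ)))).const_mul
      ((Real.pi / (1 / 4)) ^ ((N : ℝ) / 2) * Real.exp 1 * (‖(L.symm : (Fin N → ℝ) →L[ℝ] E)‖ ^ k))
  refine h1.mono' ?_ (ae_of_all _ fun x => ?_)
  · exact ((continuous_gaussKernel_cx L _).norm.mul (continuous_norm.pow k)).aestronglyMeasurable
  · rw [norm_mul, norm_norm, gaussKernel_cx L _ (by norm_num), Complex.norm_real,
      Real.norm_of_nonneg (by positivity), norm_pow, norm_norm]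
    have h2 : ‖x‖ ≤ ‖(L.symm : (Fin N → ℝ) →L[ℝ] E)‖ * jap (L x) := by
      have := (L.symm : (Fin N → ℝ) →L[ℝ] E).le_opNorm (L x)
      simp only [ContinuousLinearEquiv.coe_coe, ContinuousLinearEquiv.symm_apply_apply] at this
      exact this.trans (by gcongr; exact norm_le_jap _)
    have h3 := pow_le_pow_left₀ (norm_nonneg x) h2 k
    rw [mul_pow] at h3
    have h4 : Real.exp (-(∑ i, L x i ^ 2) / (4 * (1 / 4)))
        = Real.exp 1 * Real.exp (0 * jap (L x) - 1 * jap (L x) ^ 2) := by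
      rw [← Real.exp_add, jap_sq]; congr 1; ring
    rw [h4]
    calc _ ≤ (Real.pi / (1 / 4)) ^ ((N : ℝ) / 2) * (Real.exp 1 *
          Real.exp (0 * jap (L x) - 1 * jap (L x) ^ 2)) *
          (‖(L.symm : (Fin N → ℝ) →L[ℝ] E)‖ ^ k * jap (L x) ^ k) := by gcongr
      _ = _ := by ring

/-- Convolution with the Gaussian kernel. -/
def gaussConv (ε : ℝ) (φ : E → ℂ) (x : E) : ℂ := ∫ t, gaussKernel ε (cx L t) * φ (x - t)

/-- The total mass of the Gaussian kernels. -/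
def gaussMass : ℂ := ∫ x : E, gaussKernel (1 / 4) (cx L x)

/-- Nonzero because the kernel is positive on real points. The value is not needed and depends on
the normalisation of the Haar measure relative to the coordinates. -/
theorem gaussMass_ne_zero : gaussMass L ≠ 0 := by
  have h1 := integrable_gaussKernel_mul_norm L 0
  simp only [pow_zero, mul_one, gaussKernel_cx L (1 / 4) (by norm_num), Complex.norm_real] at h1
  have h2 : ∀ x : E, ‖(Real.pi / (1 / 4)) ^ ((N : ℝ) / 2) *
      Real.exp (-(∑ i, L x i ^ 2) / (4 * (1 / 4)))‖ = (Real.pi / (1 / 4)) ^ ((N : ℝ) / 2) *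
      Real.exp (-(∑ i, L x i ^ 2) / (4 * (1 / 4))) := fun x => Real.norm_of_nonneg (by positivity)
  simp only [h2] at h1
  have h0 : 0 < (Real.pi / (1 / 4)) ^ ((N : ℝ) / 2) := by positivity
  have h3 := (integrable_const_mul_iff h0.ne'.isUnit _).1 h1
  have h4 := integral_exp_pos h3
  simp only [gaussMass, gaussKernel_cx L (1 / 4) (by norm_num), integral_complex_ofReal]
  rw [integral_const_mul]
  exact_mod_cast (mul_pos h0 h4).ne'

theorem integral_gaussKernel_mul {ε : ℝ} (hε : 0 < ε) (f : E → ℂ) :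
    ∫ t, gaussKernel ε (cx L t) * f t = ∫ t, gaussKernel (1 / 4) (cx L t) * f ((2 * √ε) • t) := by
  have hδ : 0 < 2 * √ε := by positivity
  have h := Measure.integral_comp_smul volume (fun t => gaussKernel ε (cx L t) * f t) (2 * √ε)
  rw [finrank_eq_of_coord L, abs_of_pos (by positivity)] at h
  have h2 : ∫ t, gaussKernel ε (cx L t) * f t = ((2 * √ε) ^ N : ℝ) •
      ∫ t : E, gaussKernel ε (cx L ((2 * √ε) • t)) * f ((2 * √ε) • t) := by
    rw [h, smul_smul, mul_inv_cancel₀ (by positivity), one_smul]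
  rw [h2, ← integral_smul]
  congr 1; funext t
  rw [← gaussKernel_scale L hε, Complex.real_smul, mul_assoc]

theorem integrable_gaussKernel : Integrable fun x : E => gaussKernel (1 / 4) (cx L x) := by
  have h := integrable_gaussKernel_mul_norm L 0
  simp only [pow_zero, mul_one] at h
  exact (integrable_norm_iff (continuous_gaussKernel_cx L _).aestronglyMeasurable).1 h

/-- After rescaling, the error is the average of `φ(x - 2√ε t) - φ(x)`; the Lipschitz bound and the
finite first moment of the Gaussian give the rate `√ε`. -/
theorem exists_gaussConv_sub_le {φ : E → ℂ} (hφ : ContDiff ℝ ∞ φ) (hc : HasCompactSupport φ) :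
    ∃ C, 0 ≤ C ∧ ∀ ε, 0 < ε → ∀ x, ‖gaussConv L ε φ x - gaussMass L * φ x‖ ≤ C * √ε := by
  obtain ⟨K, hK⟩ := hφ.lipschitzWith_of_hasCompactSupport hc (by simp)
  refine ⟨2 * K * ∫ t : E, ‖gaussKernel (1 / 4) (cx L t)‖ * ‖t‖ ^ 1, by positivity,
    fun ε hε x => ?_⟩
  have hi : Integrable fun t => gaussKernel (1 / 4) (cx L t) * φ (x - (2 * √ε) • t) := by
    obtain ⟨C, hC⟩ := hφ.continuous.bounded_above_of_compact_support hc
    refine (integrable_gaussKernel L).mul_bdd (c := C) ?_ (ae_of_all _ fun t => hC _)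
    have := hφ.continuous
    exact Continuous.aestronglyMeasurable (by fun_prop)
  rw [gaussConv, integral_gaussKernel_mul L hε (fun t => φ (x - t)), gaussMass,
    ← integral_mul_const, ← integral_sub hi ((integrable_gaussKernel L).mul_const _)]
  have h1 := (integrable_gaussKernel_mul_norm L 1).const_mul (2 * √ε * K)
  refine (norm_integral_le_of_norm_le h1 (ae_of_all _ fun t => ?_)).trans_eq ?_
  · rw [← mul_sub, norm_mul, pow_one]
    have h2 : ‖φ (x - (2 * √ε) • t) - φ x‖ ≤ K * (2 * √ε * ‖t‖) := by
      have := hK.dist_le_mul (x - (2 * √ε) • t) x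
      rwa [dist_eq_norm, dist_eq_norm, sub_sub_cancel_left, norm_neg, norm_smul,
        Real.norm_of_nonneg (by positivity)] at this
    calc _ ≤ ‖gaussKernel (1 / 4) (cx L t)‖ * (K * (2 * √ε * ‖t‖)) := by gcongr
      _ = _ := by ring
  · rw [integral_const_mul]; ring

theorem gaussConv_eq_convolution (ε : ℝ) (φ : E → ℂ) : gaussConv L ε φ
    = MeasureTheory.convolution (fun t => gaussKernel ε (cx L t)) φ
      (ContinuousLinearMap.mul ℝ ℂ) volume := rfl

theorem contDiff_gaussConv (ε : ℝ) {φ : E → ℂ} (hφ : ContDiff ℝ ∞ φ) (hc : HasCompactSupport φ) :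
    ContDiff ℝ ∞ (gaussConv L ε φ) := by
  rw [gaussConv_eq_convolution]
  exact hc.contDiff_convolution_right _ (continuous_gaussKernel_cx L ε).locallyIntegrable hφ

theorem dirDeriv_gaussConv (ε : ℝ) (v : E) {φ : E → ℂ} (hφ : ContDiff ℝ ∞ φ)
    (hc : HasCompactSupport φ) : dirDeriv v (gaussConv L ε φ) = gaussConv L ε (dirDeriv v φ) := by
  funext x
  have hl := (continuous_gaussKernel_cx L ε).locallyIntegrable (μ := volume)
  have h := hc.hasFDerivAt_convolution_right (ContinuousLinearMap.mul ℝ ℂ) hl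
    (hφ.of_le (by simp)) x
  rw [dirDeriv, gaussConv_eq_convolution, h.fderiv,
    convolution_precompR_apply _ hl (hc.fderiv ℝ) (hφ.continuous_fderiv (by simp))]
  rfl

/-- The regularisation error. -/
def gaussErr (ε : ℝ) (φ : E → ℂ) (x : E) : ℂ := gaussConv L ε φ x - gaussMass L * φ x

theorem contDiff_gaussErr (ε : ℝ) {φ : E → ℂ} (hφ : ContDiff ℝ ∞ φ) (hc : HasCompactSupport φ) :
    ContDiff ℝ ∞ (gaussErr L ε φ) :=
  (contDiff_gaussConv L ε hφ hc).sub (contDiff_const.mul hφ)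

theorem dirDeriv_gaussErr (ε : ℝ) (v : E) {φ : E → ℂ} (hφ : ContDiff ℝ ∞ φ)
    (hc : HasCompactSupport φ) : dirDeriv v (gaussErr L ε φ) = gaussErr L ε (dirDeriv v φ) := by
  funext x
  have h1 := (contDiff_gaussConv L ε hφ hc).differentiable (by simp) x
  have h2 := hφ.differentiable (by simp) x
  have h3 := congrFun (dirDeriv_gaussConv L ε v hφ hc) x
  simp only [dirDeriv] at h3
  simp only [dirDeriv, gaussErr]
  rw [show gaussErr L ε φ = fun x => gaussConv L ε φ x - gaussMass L * φ x from rfl,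
    fderiv_fun_sub h1 (h2.const_mul _), fderiv_const_mul h2]
  simp only [sub_apply, smul_apply, smul_eq_mul, h3]

theorem hasCompactSupport_dirDeriv {v : E} {φ : E → ℂ} (hc : HasCompactSupport φ) :
    HasCompactSupport (dirDeriv v φ) :=
  (hc.fderiv ℝ).comp_left (g := fun A : E →L[ℝ] ℂ => A v) rfl

theorem dirDeriv_iterate_gaussErr (ε : ℝ) (v : E) (k : ℕ) {φ : E → ℂ} (hφ : ContDiff ℝ ∞ φ)
    (hc : HasCompactSupport φ) : (ContDiff ℝ ∞ ((dirDeriv v)^[k] φ) ∧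
      HasCompactSupport ((dirDeriv v)^[k] φ)) ∧
      (dirDeriv v)^[k] (gaussErr L ε φ) = gaussErr L ε ((dirDeriv v)^[k] φ) := by
  induction k with
  | zero => exact ⟨⟨hφ, hc⟩, rfl⟩
  | succ k ih =>
    simp only [Function.iterate_succ_apply']
    exact ⟨⟨contDiff_dirDeriv ih.1.1, hasCompactSupport_dirDeriv ih.1.2⟩, by
      rw [ih.2, dirDeriv_gaussErr L ε v ih.1.1 ih.1.2]⟩

variable {T : (E → ℂ) → ℂ} {x₀ : E} {r : ℝ}

theorem WedgeSum.map_const_mul (D : WedgeSum T x₀ r) {φ : E → ℂ}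
    (hφ : IsTest (Metric.ball x₀ r) φ) (c : ℂ) : T (fun x => c * φ x) = c * T φ := by
  rw [D.eq _ (hφ.const_mul c), D.eq φ hφ, Finset.mul_sum]
  exact Finset.sum_congr rfl fun j _ => (D.rep j).map_const_mul hφ c

theorem WedgeSum.map_sub (D : WedgeSum T x₀ r) {φ ψ : E → ℂ}
    (hφ : IsTest (Metric.ball x₀ r) φ) (hψ : IsTest (Metric.ball x₀ r) ψ) :
    T (fun x => φ x - ψ x) = T φ - T ψ := by
  have h : IsTest (Metric.ball x₀ r) fun x => φ x - ψ x := by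
    simpa [sub_eq_add_neg] using hφ.add (hψ.const_mul (-1))
  rw [D.eq _ h, D.eq φ hφ, D.eq ψ hψ, ← Finset.sum_sub_distrib]
  exact Finset.sum_congr rfl fun j _ => (D.rep j).map_sub hφ hψ

/-- The regularisation error commutes with directional derivatives, so its derivatives up to the
order of `T` are all `O(√ε)`. The cutoff does not disturb the limit, being 1 on the support of `φ`.
-/
theorem WedgeSum.tendsto_gaussConv (D : WedgeSum T x₀ r) {χ : E → ℂ}
    (hχ : IsTest (Metric.ball x₀ r) χ) {σ : ℝ} (hσ : ∀ x ∈ Metric.ball x₀ σ, χ x = 1)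
    (hσr : σ ≤ r) {φ : E → ℂ} (hφ : IsTest (Metric.ball x₀ σ) φ) :
    Tendsto (fun ε => T fun x => χ x * gaussConv L ε φ x) (𝓝[>] 0) (𝓝 (gaussMass L * T φ)) := by
  have hφr := hφ.mono (Metric.ball_subset_ball hσr)
  obtain ⟨A, k, hA⟩ := D.exists_norm_mul_le hχ
  choose C hC0 hC using fun q : Fin D.m × ℕ => exists_gaussConv_sub_le L
    (dirDeriv_iterate_gaussErr L 1 (D.v q.1) q.2 hφ.contDiff hφ.compact).1.1
    (dirDeriv_iterate_gaussErr L 1 (D.v q.1) q.2 hφ.contDiff hφ.compact).1.2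
  set S := ∑ q ∈ (Finset.univ : Finset (Fin D.m)) ×ˢ Finset.range (k + 1), C q with hS
  have hS0 : 0 ≤ S := Finset.sum_nonneg fun q _ => hC0 q
  have hlim : Tendsto (fun ε : ℝ => A * (S * √ε)) (𝓝[>] 0) (𝓝 0) :=
    ((by fun_prop : Continuous fun ε : ℝ => A * (S * √ε)).tendsto' 0 0 (by simp)).mono_left
      nhdsWithin_le_nhds
  rw [tendsto_iff_norm_sub_tendsto_zero]
  refine squeeze_zero_norm' ?_ hlim
  filter_upwards [self_mem_nhdsWithin] with ε (hε : 0 < ε)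
  rw [norm_norm, ← D.map_const_mul hφr, ← D.map_sub
    (hχ.mul_contDiff (contDiff_gaussConv L ε hφ.contDiff hφ.compact)) (hφr.const_mul _)]
  have h1 : (fun x => χ x * gaussConv L ε φ x - gaussMass L * φ x)
      = fun x => χ x * gaussErr L ε φ x := by
    funext x
    by_cases hx : x ∈ tsupport φ
    · simp [hσ x (hφ.subset hx), gaussErr]
    · simp [image_eq_zero_of_notMem_tsupport hx, gaussErr]
  rw [h1]
  refine hA _ _ (contDiff_gaussErr L ε hφ.contDiff hφ.compact) (by positivity) fun j x i hi => ?_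
  rw [(dirDeriv_iterate_gaussErr L ε (D.v j) i hφ.contDiff hφ.compact).2]
  refine (hC (j, i) ε hε x).trans ?_
  gcongr
  exact Finset.single_le_sum (fun q _ => hC0 q) (by simp; omega)

/-- The integral over `y` is moved inside `T`, where it becomes the cut-off convolution of the
Gaussian with `φ`. Consequently `T` is determined near `x₀` by its values on cut-off Gaussians. -/
theorem WedgeSum.tendsto_integral_gauss (D : WedgeSum T x₀ r) {χ : E → ℂ}
    (hχ : IsTest (Metric.ball x₀ r) χ) {σ : ℝ} (hσ : ∀ x ∈ Metric.ball x₀ σ, χ x = 1)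
    (hσr : σ ≤ r) {φ : E → ℂ} (hφ : IsTest (Metric.ball x₀ σ) φ) :
    Tendsto (fun ε => ∫ y, φ y * T (holoTest L χ fun w => gaussKernel ε (w - cx L y)))
      (𝓝[>] 0) (𝓝 (gaussMass L * T φ)) := by
  refine (D.tendsto_gaussConv L hχ hσ hσr hφ).congr' ?_
  filter_upwards [self_mem_nhdsWithin] with ε (hε : 0 < ε)
  have he : ∀ y : E, Differentiable ℂ fun w : Fin N → ℂ => φ y * gaussKernel ε (w - cx L y) :=
    fun y => ((differentiable_gaussKernel ε).comp (differentiable_id.sub_const _)).const_mul _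
  have hec : Continuous (Function.uncurry fun (y : E) (w : Fin N → ℂ) =>
      φ y * gaussKernel ε (w - cx L y)) :=
    (hφ.contDiff.continuous.comp continuous_fst).mul ((differentiable_gaussKernel ε).continuous.comp
      (continuous_snd.sub ((continuous_cx L).comp continuous_fst)))
  have hcomp := (isCompact_tube L hχ.compact 1).prod hφ.compact
  obtain ⟨B, hB⟩ := hcomp.exists_bound_of_continuousOn
    (f := fun q : (Fin N → ℂ) × E => gaussKernel ε (q.1 - cx L q.2))
    ((differentiable_gaussKernel ε).continuous.comp
      (continuous_fst.sub ((continuous_cx L).comp continuous_snd))).continuousOn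
  have hφi : Integrable φ := hφ.contDiff.continuous.integrable_of_hasCompactSupport hφ.compact
  have h := (D.integral_comm L hχ he hec (μ := volume)
    (hχ.mul_contDiff (contDiff_gaussConv L ε hφ.contDiff hφ.compact)) (fun x => ?_) one_pos
    (hφi.norm.mul_const B) (ae_of_all _ fun y x hx w hw => ?_)).2
  · rw [← h]
    congr 1; funext y
    have hd : Differentiable ℂ fun w : Fin N → ℂ => gaussKernel ε (w - cx L y) :=
      (differentiable_gaussKernel ε).comp (differentiable_id.sub_const _)
    rw [← D.map_const_mul (isTest_holoTest L hχ hd)]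
    congr 1; funext x; simp only [holoTest]; ring
  · simp only [holoTest]
    rw [integral_const_mul, gaussConv,
      ← integral_sub_left_eq_self (fun t => gaussKernel ε (cx L t) * φ (x - t)) volume x]
    congr 2; funext y
    rw [cx_sub, sub_sub_cancel, mul_comm]
  · rw [norm_mul]
    by_cases hy : y ∈ tsupport φ
    · gcongr
      exact hB (w, y) ⟨⟨x, hx, hw⟩, hy⟩
    · simp [image_eq_zero_of_notMem_tsupport hy]

/-- Two sums of boundary values which agree on Gaussians agree. -/
theorem WedgeSum.eq_of_gauss {T' : (E → ℂ) → ℂ} (D : WedgeSum T x₀ r) (D' : WedgeSum T' x₀ r)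
    {χ : E → ℂ} (hχ : IsTest (Metric.ball x₀ r) χ) {σ : ℝ}
    (hσ : ∀ x ∈ Metric.ball x₀ σ, χ x = 1) (hσr : σ ≤ r)
    (h : ∀ ε > 0, ∀ y, T (holoTest L χ fun w => gaussKernel ε (w - cx L y))
      = T' (holoTest L χ fun w => gaussKernel ε (w - cx L y)))
    {φ : E → ℂ} (hφ : IsTest (Metric.ball x₀ σ) φ) : T φ = T' φ := by
  refine mul_left_cancel₀ (gaussMass_ne_zero L) (tendsto_nhds_unique
    (D.tendsto_integral_gauss L hχ hσ hσr hφ) ((D'.tendsto_integral_gauss L hχ hσ hσr hφ).congr' ?_))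
  filter_upwards [self_mem_nhdsWithin] with ε (hε : 0 < ε)
  simp only [h ε hε]

end Gauss

/-! ## Plane wave components -/

section PlaneWave

variable {N : ℕ}

theorem continuous_fbiKernel_param :
    Continuous fun q : ℝ × (Fin N → ℝ) × (Fin N → ℂ) => fbiKernel q.1 1 q.2.1 q.2.2 := by
  have h1 : Continuous fun q : ℝ × (Fin N → ℝ) × (Fin N → ℂ) => dotC q.2.1 q.2.2 :=
    (continuous_dotC (N := N)).comp continuous_snd
  have h2 := (differentiable_sqC (N := N)).continuous
  have h3 := continuous_jap (N := N)
  unfold fbiKernel fbiExp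
  refine Continuous.mul (continuous_const.sub (Continuous.div (by fun_prop) (by fun_prop)
    fun q => ?_)) (by fun_prop)
  exact_mod_cast (jap_pos q.2.1).ne'

theorem integrable_exp_neg_norm {c : ℝ} (hc : 0 < c) :
    Integrable fun ξ : Fin N → ℝ => Real.exp (-c * ‖ξ‖) := by
  have h1 : Integrable fun ξ : Fin N → ℝ => (1 + ‖ξ‖) ^ (-((N + 1 : ℕ) : ℝ)) :=
    integrable_one_add_norm (by simp)
  refine (h1.const_mul (Real.exp c * (N + 1).factorial / c ^ (N + 1))).mono'
    (by fun_prop) (ae_of_all _ fun ξ => ?_)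
  have hp : 0 < 1 + ‖ξ‖ := by positivity
  rw [Real.norm_of_nonneg (Real.exp_pos _).le, Real.rpow_neg hp.le, Real.rpow_natCast]
  have h2 := Real.pow_div_factorial_le_exp (c * (1 + ‖ξ‖)) (by positivity) (N + 1)
  have h3 : Real.exp (-c * ‖ξ‖) = Real.exp c / Real.exp (c * (1 + ‖ξ‖)) := by
    rw [← Real.exp_sub]; congr 1; ring
  rw [h3, div_le_iff₀ (Real.exp_pos _)]
  calc Real.exp c = Real.exp c * (N + 1).factorial / c ^ (N + 1) * ((1 + ‖ξ‖) ^ (N + 1))⁻¹ *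
        ((c * (1 + ‖ξ‖)) ^ (N + 1) / (N + 1).factorial) := by
        rw [mul_pow]; field_simp
    _ ≤ _ := by gcongr

/-- A crude bound for a fixed `ε > 0`, used only as an integrable majorant in `ξ`; it degenerates as
`ε → 0`, where the decay of the components takes over. -/
theorem norm_fbiKernel_le_jap {ε : ℝ} (hε : 0 ≤ ε) (ξ : Fin N → ℝ) (w : Fin N → ℂ)
    (hw : ∑ i, ‖w i‖ ^ 2 ≤ 1 / 4) :
    ‖fbiKernel ε 1 ξ w‖ ≤ 2 * Real.exp (ε / 2) *
      (jap ξ ^ 0 * Real.exp (1 * jap ξ - ε / 4 * jap ξ ^ 2)) := by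
  have him : ∑ i, (w i).im ^ 2 ≤ 1 / 4 := (Finset.sum_le_sum fun i _ => by
    rw [← Complex.normSq_eq_norm_sq, Complex.normSq_apply]
    nlinarith [sq_nonneg (w i).re]).trans hw
  have h1 : ∑ i, ξ i * (w i).im ≤ 1 / 2 * jap ξ := by
    have h := dotC_norm_le ξ (w := fun i => ((w i).im : ℂ)) (M := 1 / 2) (by norm_num) (by
      simp only [Complex.norm_real, Real.norm_eq_abs, sq_abs]; linarith)
    have h' : dotC ξ (fun i => ((w i).im : ℂ)) = ((∑ i, ξ i * (w i).im : ℝ) : ℂ) := by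
      simp [dotC]
    rw [h', Complex.norm_real] at h
    exact (le_abs_self _).trans h
  have h2 : 0 ≤ ∑ i, (w i).re ^ 2 := by positivity
  have h3 := jap_pos ξ
  refine (norm_fbiKernel_le hε ξ w hw).trans ?_
  rw [pow_zero, one_mul, one_mul, mul_assoc, mul_assoc, ← Real.exp_add, ← Real.exp_add]
  refine mul_le_mul_of_nonneg_left (Real.exp_le_exp.2 ?_) two_pos.le
  nlinarith [mul_nonneg h3.le h2, mul_le_mul_of_nonneg_left him h3.le]

variable {E : Type*} [NormedAddCommGroup E] [NormedSpace ℝ E] [FiniteDimensional ℝ E]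
  [MeasureSpace E] [BorelSpace E] [(volume : Measure E).IsAddHaarMeasure]
  (L : E ≃L[ℝ] (Fin N → ℝ))
variable {T : (E → ℂ) → ℂ} {x₀ : E} {r : ℝ}

theorem continuous_coordSq (x₀ : E) : Continuous fun x => coordSq L x x₀ := by
  have := L.continuous
  unfold coordSq
  fun_prop

theorem coordSq_sub_le {x y : E} (hx : coordSq L x x₀ ≤ 1 / 32) (hy : coordSq L y x₀ ≤ 1 / 32) :
    ∑ i, (L x i - L y i) ^ 2 ≤ 1 / 8 := by
  have h : ∑ i, (L x i - L y i) ^ 2 ≤ ∑ i, (2 * (L x i - L x₀ i) ^ 2 + 2 * (L y i - L x₀ i) ^ 2) :=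
    Finset.sum_le_sum fun i _ => by nlinarith [sq_nonneg (L x i - L x₀ i + (L y i - L x₀ i))]
  rw [Finset.sum_add_distrib, ← Finset.mul_sum, ← Finset.mul_sum] at h
  unfold coordSq at hx hy
  linarith

/-- With `(a + b)² ≤ 3a²/2 + 3b²` the budget is `3/16` for the real separation and at most `1/16`
for the displacement in the tube, together `1/4`, the range of `norm_fbiKernel_le`. -/
theorem sum_norm_sq_tube_le {x y : E} (h : ∑ i, (L x i - L y i) ^ 2 ≤ 1 / 8) {w : Fin N → ℂ}
    (hw : ‖w - cx L x‖ ≤ 1 / (8 * (N + 1))) : ∑ i, ‖(w - cx L y) i‖ ^ 2 ≤ 1 / 4 := by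
  have h1 : ∀ i, ‖(w - cx L y) i‖ ^ 2
      ≤ 3 / 2 * (L x i - L y i) ^ 2 + 3 * (1 / (8 * (N + 1) : ℝ)) ^ 2 := by
    intro i
    have h2 : ‖(w - cx L y) i‖ ≤ |L x i - L y i| + 1 / (8 * (N + 1)) := by
      have h3 : (w - cx L y) i = ((L x i - L y i : ℝ) : ℂ) + (w - cx L x) i := by
        simp [cx]
      rw [h3]
      refine (norm_add_le _ _).trans (add_le_add ?_ ((norm_le_pi_norm _ i).trans hw))
      rw [Complex.norm_real, Real.norm_eq_abs]
    have h4 := pow_le_pow_left₀ (norm_nonneg _) h2 2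
    have h5 := sq_abs (L x i - L y i)
    nlinarith [sq_nonneg (|L x i - L y i| - 2 * (1 / (8 * (N + 1) : ℝ)))]
  refine (Finset.sum_le_sum fun i _ => h1 i).trans ?_
  rw [Finset.sum_add_distrib, ← Finset.mul_sum]
  have h6 : ∑ _i : Fin N, 3 * (1 / (8 * (N + 1) : ℝ)) ^ 2 ≤ 1 / 16 := by
    simp only [Finset.sum_const, Finset.card_univ, Fintype.card_fin, nsmul_eq_mul]
    have hN : (0 : ℝ) ≤ N := Nat.cast_nonneg N
    rw [div_pow, one_pow, mul_one_div, mul_div_assoc', div_le_div_iff₀ (by positivity) (by norm_num)]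
    nlinarith
  linarith

/-- The plane wave components of `T`. -/
def planeWave (T : (E → ℂ) → ℂ) (χ : E → ℂ) (ε : ℝ) (ξ : Fin N → ℝ) (y : Fin N → ℂ) : ℂ :=
  T (holoTest L χ fun w => fbiKernel ε 1 ξ (w - y))

theorem WedgeSum.continuous_planeWave (D : WedgeSum T x₀ r) {χ : E → ℂ}
    (hχ : IsTest (Metric.ball x₀ r) χ) : Continuous fun q : ℝ × (Fin N → ℝ) × (Fin N → ℂ) =>
      planeWave L T χ q.1 q.2.1 q.2.2 := by
  refine D.continuous_family L hχ (e := fun (q : ℝ × (Fin N → ℝ) × (Fin N → ℂ)) w =>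
    fbiKernel q.1 1 q.2.1 (w - q.2.2))
    (fun q => (differentiable_fbiKernel _ _ _).comp (differentiable_id.sub_const _)) ?_
  exact continuous_fbiKernel_param.comp (f := fun p : (ℝ × (Fin N → ℝ) × (Fin N → ℂ)) ×
    (Fin N → ℂ) => (p.1.1, p.1.2.1, p.2 - p.1.2.2)) (by fun_prop)

/-- The Gaussian transform is the superposition of the plane wave components. -/
theorem WedgeSum.gauss_eq_integral_planeWave (D : WedgeSum T x₀ r) {χ : E → ℂ}
    (hχ : IsTest (Metric.ball x₀ r) χ) (hr : ∀ x ∈ tsupport χ, coordSq L x x₀ ≤ 1 / 32)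
    {y : E} (hy : coordSq L y x₀ ≤ 1 / 32) {ε : ℝ} (hε : 0 < ε) :
    T (holoTest L χ fun w => gaussKernel ε (w - cx L y)) = ∫ ξ, planeWave L T χ ε ξ (cx L y) := by
  have hg : Differentiable ℂ fun w : Fin N → ℂ => gaussKernel ε (w - cx L y) :=
    (differentiable_gaussKernel ε).comp (differentiable_id.sub_const _)
  refine (D.integral_comm L hχ (e := fun ξ w => fbiKernel ε 1 ξ (w - cx L y)) (μ := volume)
    (fun ξ => (differentiable_fbiKernel _ _ _).comp (differentiable_id.sub_const _)) ?_
    (isTest_holoTest L hχ hg) (fun x => ?_) (ρ := 1 / (8 * (N + 1))) (by positivity)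
    ((integrable_jap_exp 0 1 (show 0 < ε / 4 by positivity)).const_mul (2 * Real.exp (ε / 2)))
    (ae_of_all _ fun ξ x hx w hw => norm_fbiKernel_le_jap hε.le ξ _
      (sum_norm_sq_tube_le L (coordSq_sub_le L (hr x hx) hy) hw))).2.symm
  · exact (continuous_fbiKernel ε 1).comp (f := fun p : (Fin N → ℝ) × (Fin N → ℂ) =>
      (p.1, p.2 - cx L y)) (by fun_prop)
  · simp only [holoTest]
    rw [integral_const_mul]
    by_cases hx : x ∈ tsupport χ
    · have h := (integral_fbiKernel hε (fun i => L x i - L y i)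
        (coordSq_sub_le L (hr x hx) hy)).2
      have h2 : (fun i => ((L x i - L y i : ℝ) : ℂ)) = cx L x - cx L y := by
        funext i; simp [cx]
      rw [h2] at h
      rw [h]
    · rw [image_eq_zero_of_notMem_tsupport hx, zero_mul, zero_mul]

/-- Exponential decay of the plane wave components in all directions of `s`. -/
def HasDecayOn (T : (E → ℂ) → ℂ) (x₀ : E) (s : Set (Fin N → ℝ)) : Prop :=
  ∃ r, 0 < r ∧ ∀ (χ : E → ℂ) (σ : ℝ), 0 < σ → IsTest (Metric.ball x₀ r) χ →
    (∀ x ∈ Metric.ball x₀ σ, χ x = 1) → (∀ x ∈ tsupport χ, coordSq L x x₀ ≤ 1 / 32) →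
    ∃ A c δ : ℝ, 0 < c ∧ 0 < δ ∧ ∀ ξ ∈ s, ∀ l : ℝ, 0 ≤ l → ∀ ε ∈ Icc (0 : ℝ) 1,
      ∀ y : Fin N → ℂ, ‖y - cx L x₀‖ ≤ δ → ‖planeWave L T χ ε (l • ξ) y‖ ≤ A * Real.exp (-c * l)

theorem HasDecayOn.union {s t : Set (Fin N → ℝ)} (hs : HasDecayOn L T x₀ s)
    (ht : HasDecayOn L T x₀ t) : HasDecayOn L T x₀ (s ∪ t) := by
  obtain ⟨r₁, hr₁, h₁⟩ := hs
  obtain ⟨r₂, hr₂, h₂⟩ := ht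
  refine ⟨min r₁ r₂, lt_min hr₁ hr₂, fun χ σ hσ0 hχ hσ hr => ?_⟩
  obtain ⟨A₁, c₁, δ₁, hc₁, hδ₁, h₁⟩ := h₁ χ σ hσ0
    (hχ.mono (Metric.ball_subset_ball (min_le_left _ _))) hσ hr
  obtain ⟨A₂, c₂, δ₂, hc₂, hδ₂, h₂⟩ := h₂ χ σ hσ0
    (hχ.mono (Metric.ball_subset_ball (min_le_right _ _))) hσ hr
  refine ⟨|A₁| + |A₂|, min c₁ c₂, min δ₁ δ₂, lt_min hc₁ hc₂, lt_min hδ₁ hδ₂, ?_⟩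
  rintro ξ (hξ | hξ) l hl ε hε y hy
  · refine (h₁ ξ hξ l hl ε hε y (hy.trans (min_le_left _ _))).trans ?_
    have hA : A₁ ≤ |A₁| + |A₂| := (le_abs_self _).trans (by linarith [abs_nonneg A₂])
    have hc : -c₁ * l ≤ -(min c₁ c₂) * l := by nlinarith [min_le_left c₁ c₂]
    gcongr
  · refine (h₂ ξ hξ l hl ε hε y (hy.trans (min_le_right _ _))).trans ?_
    have hA : A₂ ≤ |A₁| + |A₂| := (le_abs_self _).trans (by linarith [abs_nonneg A₁])
    have hc : -c₂ * l ≤ -(min c₁ c₂) * l := by nlinarith [min_le_right c₁ c₂]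
    gcongr

/-- The covector with coordinates `ξ`. -/
def covec (ξ : Fin N → ℝ) : E →L[ℝ] ℝ :=
  ∑ i, ξ i • (ContinuousLinearMap.proj i ∘L L.toContinuousLinearMap)

theorem covec_apply (ξ : Fin N → ℝ) (v : E) : covec L ξ v = ∑ i, ξ i * L v i := by
  simp [covec]

theorem covec_ne_zero {ξ : Fin N → ℝ} (hξ : ξ ≠ 0) : covec L ξ ≠ 0 := by
  intro h
  apply hξ
  funext i
  have h2 := covec_apply L ξ (L.symm (Pi.single i 1))
  rw [h] at h2
  simpa [Pi.single_apply] using h2.symm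

/-- Negativity on the finitely many directions `v_j` is an open condition. Half of the smallest
margin at `ξ₀` serves as the constant `c₀` for all nearby unit covectors. -/
theorem hasDecayOn_nhds {ξ₀ : Fin N → ℝ} (h : IsWedgeSumAt T x₀ (covec L ξ₀)) :
    ∃ t ∈ 𝓝[Metric.sphere 0 1] ξ₀, HasDecayOn L T x₀ t := by
  obtain ⟨r, hr0, D, hD⟩ := h
  obtain ⟨c₀, hc₀, hc₀D⟩ := exists_pos_forall_le (fun j => -covec L ξ₀ (D.v j) / 2)
    fun j => by linarith [hD j]
  refine ⟨{ξ | ∀ j, ∑ i, ξ i * L (D.v j) i < -c₀} ∩ Metric.sphere 0 1,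
    inter_mem (mem_nhdsWithin_of_mem_nhds (IsOpen.mem_nhds ?_ fun j => ?_)) self_mem_nhdsWithin,
    r, hr0, fun χ σ hσ0 hχ hσ hr => ?_⟩
  · simp only [ofPred_forall]
    exact isOpen_iInter_of_finite fun j => isOpen_lt (by fun_prop) continuous_const
  · have h1 := hc₀D j
    have h2 := hD j
    rw [covec_apply] at h1 h2
    linarith
  · choose A c δ hc hδ hdec using fun j => (D.rep j).exists_decay L hχ hσ0 hσ hr hc₀
    obtain ⟨c', hc', hc'D⟩ := exists_pos_forall_le c hc
    obtain ⟨δ', hδ', hδ'D⟩ := exists_pos_forall_le δ hδ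
    refine ⟨∑ j, |A j|, c', δ', hc', hδ', fun ξ hξ l hl ε hε y hy => ?_⟩
    have hd : Differentiable ℂ fun w => fbiKernel ε 1 (l • ξ) (w - y) :=
      (differentiable_fbiKernel _ _ _).comp (differentiable_id.sub_const _)
    have hn : ‖l • ξ‖ = l := by
      rw [norm_smul, mem_sphere_zero_iff_norm.1 hξ.2, mul_one, Real.norm_of_nonneg hl]
    rw [planeWave, D.eq _ (isTest_holoTest L hχ hd), Finset.sum_mul]
    refine norm_sum_le_of_le _ fun j _ => ?_
    refine (hdec j (l • ξ) ?_ ε hε y (hy.trans (hδ'D j))).trans ?_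
    · rw [hn]
      simp only [Pi.smul_apply, smul_eq_mul, mul_assoc, ← Finset.mul_sum]
      nlinarith [hξ.1 j]
    · rw [hn]
      have h1 := le_abs_self (A j)
      have h2 : -c j * l ≤ -c' * l := by nlinarith [hc'D j]
      gcongr

theorem hasDecayOn_sphere (h : ∀ η : E →L[ℝ] ℝ, η ≠ 0 → IsWedgeSumAt T x₀ η) :
    HasDecayOn L T x₀ (Metric.sphere (0 : Fin N → ℝ) 1) := by
  -- Decay is inherited by subsets and finite unions and holds near each point, so compactness gives
  -- it on the whole sphere.
  refine (isCompact_sphere (0 : Fin N → ℝ) 1).induction_on (p := HasDecayOn L T x₀) ?_ ?_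
    (fun s t hs ht => hs.union L ht) fun ξ hξ => ?_
  · exact ⟨1, one_pos, fun χ σ _ _ _ _ => ⟨0, 1, 1, one_pos, one_pos, fun ξ hξ => hξ.elim⟩⟩
  · rintro s t hst ⟨r, hr, ht⟩
    refine ⟨r, hr, fun χ σ h1 h2 h3 h4 => ?_⟩
    obtain ⟨A, c, δ, hc, hδ, h⟩ := ht χ σ h1 h2 h3 h4
    exact ⟨A, c, δ, hc, hδ, fun ξ hξ => h ξ (hst hξ)⟩
  · refine hasDecayOn_nhds L (h _ (covec_ne_zero L ?_))
    rintro rfl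
    simp at hξ

end PlaneWave

/-! ## Analyticity of distributions which are boundary values in all directions -/

section Core

variable {N : ℕ}

/-- The weight of the Cauchy formula on the torus. -/
def torusWeight (R : ℝ) (θ : Fin N → ℝ) : ℂ :=
  ((2 * Real.pi * Complex.I) ^ N)⁻¹ * ∏ i, R * Complex.exp (θ i * Complex.I) * Complex.I

theorem continuous_torusWeight (R : ℝ) : Continuous (torusWeight (N := N) R) := by
  unfold torusWeight
  fun_prop

/-- The box of angles. -/
def angleBox (N : ℕ) : Set (Fin N → ℝ) := Icc 0 fun _ => 2 * Real.pi

theorem continuous_cauchyProd {c y : Fin N → ℂ} {R : ℝ} (hR : 0 < R) (hy : y ∈ Metric.ball c R) :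
    Continuous fun θ : Fin N → ℝ => ∏ i, (torusMap c (fun _ => R) θ i - y i)⁻¹ := by
  have h := continuous_torusMap c R
  exact continuous_finsetProd _ fun i _ => Continuous.inv₀ (by fun_prop)
    fun θ => torusMap_sub_ne_zero hR hy θ i

theorem eq_integral_torus {c y : Fin N → ℂ} {R : ℝ} (hR : 0 < R) (hy : y ∈ Metric.ball c R)
    {g : (Fin N → ℂ) → ℂ} (hg : Differentiable ℂ g) :
    g y = ∫ θ in angleBox N, torusWeight R θ * (∏ i, (torusMap c (fun _ => R) θ i - y i)⁻¹) *
      g (torusMap c (fun _ => R) θ) := by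
  have h := torusIntegral_cauchy hR (fun z _ => hg z) hy
  have h0 : (2 * Real.pi * Complex.I) ^ N ≠ 0 := pow_ne_zero _ (by simp [Real.pi_ne_zero])
  rw [← mul_right_inj' h0, ← h, torusIntegral, ← integral_const_mul]
  refine integral_congr_ae (ae_of_all _ fun θ => ?_)
  simp only [torusWeight, smul_eq_mul]
  set a := ∏ i, (R : ℂ) * Complex.exp (θ i * Complex.I) * Complex.I
  set b := ∏ i, (torusMap c (fun _ => R) θ i - y i)⁻¹
  rw [mul_assoc _ a b, mul_assoc _ (a * b), mul_inv_cancel_left₀ h0, mul_assoc]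

variable {E : Type*} [NormedAddCommGroup E] [NormedSpace ℝ E] [FiniteDimensional ℝ E]
  [MeasureSpace E] [BorelSpace E] [(volume : Measure E).IsAddHaarMeasure]
  (L : E ≃L[ℝ] (Fin N → ℝ))
variable {T : (E → ℂ) → ℂ} {x₀ : E} {r : ℝ}

/-- The kernel is entire in the base point, so Cauchy's formula may be applied under `T`; the plane
wave component inherits it. -/
theorem WedgeSum.planeWave_eq_integral (D : WedgeSum T x₀ r) {χ : E → ℂ}
    (hχ : IsTest (Metric.ball x₀ r) χ) (ε : ℝ) (ξ : Fin N → ℝ) {c y : Fin N → ℂ} {R : ℝ}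
    (hR : 0 < R) (hy : y ∈ Metric.ball c R) :
    planeWave L T χ ε ξ y = ∫ θ in angleBox N,
      torusWeight R θ * (∏ i, (torusMap c (fun _ => R) θ i - y i)⁻¹) *
        planeWave L T χ ε ξ (torusMap c (fun _ => R) θ) := by
  have hd : ∀ z : Fin N → ℂ, Differentiable ℂ fun w => fbiKernel ε 1 ξ (w - z) := fun z =>
    (differentiable_fbiKernel _ _ _).comp (differentiable_id.sub_const _)
  set m : (Fin N → ℝ) → ℂ := fun θ =>
    torusWeight R θ * ∏ i, (torusMap c (fun _ => R) θ i - y i)⁻¹ with hm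
  have hmc : Continuous m := (continuous_torusWeight R).mul (continuous_cauchyProd hR hy)
  have hF : Continuous fun q : (Fin N → ℝ) × (Fin N → ℂ) =>
      m q.1 * fbiKernel ε 1 ξ (q.2 - torusMap c (fun _ => R) q.1) := by
    have h1 := continuous_torusMap c R
    have h2 := (differentiable_fbiKernel ε 1 ξ).continuous
    fun_prop
  have hcpt : IsCompact (angleBox N) := isCompact_Icc
  obtain ⟨B, hB⟩ := (hcpt.prod (isCompact_tube L hχ.compact 1)).exists_bound_of_continuousOn
    hF.continuousOn
  have h := (D.integral_comm L hχ (μ := volume.restrict (angleBox N))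
    (e := fun θ w => m θ * fbiKernel ε 1 ξ (w - torusMap c (fun _ => R) θ))
    (fun θ => (hd _).const_mul _) hF (isTest_holoTest L hχ (hd y)) (fun x => ?_) one_pos
    (b := fun _ => B) (integrableOn_const (hs := hcpt.measure_ne_top)) ?_).2
  · rw [planeWave, ← h]
    refine integral_congr_ae (ae_of_all _ fun θ => ?_)
    simp only [planeWave]
    rw [← D.map_const_mul (isTest_holoTest L hχ (hd _))]
    congr 1; funext x; simp only [holoTest, hm]; ring
  · simp only [holoTest]
    rw [integral_const_mul]
    congr 1
    exact eq_integral_torus hR hy (g := fun z => fbiKernel ε 1 ξ (cx L x - z))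
      ((differentiable_fbiKernel _ _ _).comp (differentiable_const _ |>.sub differentiable_id))
  · exact (ae_restrict_iff' measurableSet_Icc).2 (ae_of_all _ fun θ hθ x hx w hw =>
      hB (θ, w) ⟨hθ, ⟨x, hx, hw⟩⟩)

/-- Only the size of the components is controlled, not their derivatives in `y`. Cauchy's formula
removes `y` from the component, Fubini exchanges `ξ` and the angles, and what remains is a Cauchy
integral with an integrable density, which is analytic. -/
theorem WedgeSum.analyticOnNhd_integral_planeWave (D : WedgeSum T x₀ r) {χ : E → ℂ}
    (hχ : IsTest (Metric.ball x₀ r) χ) {c₀ : Fin N → ℂ} {A c R : ℝ} (hc : 0 < c) (hR : 0 < R)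
    (hdec : ∀ ξ, ∀ y ∈ Metric.closedBall c₀ R,
      ‖planeWave L T χ 0 ξ y‖ ≤ A * Real.exp (-c * ‖ξ‖)) :
    AnalyticOnNhd ℂ (fun y => ∫ ξ, planeWave L T χ 0 ξ y) (Metric.ball c₀ R) := by
  have hcont : Continuous fun q : (Fin N → ℝ) × (Fin N → ℝ) =>
      planeWave L T χ 0 q.2 (torusMap c₀ (fun _ => R) q.1) := by
    have h1 := continuous_torusMap c₀ R
    exact (D.continuous_planeWave L hχ).comp (f := fun q : (Fin N → ℝ) × (Fin N → ℝ) =>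
      ((0 : ℝ), q.2, torusMap c₀ (fun _ => R) q.1)) (by fun_prop)
  have hfin : volume (angleBox N) ≠ ⊤ := IsCompact.measure_ne_top isCompact_Icc
  have : IsFiniteMeasure (volume.restrict (angleBox N)) := ⟨by
    simpa using hfin.lt_top⟩
  have hint : ∀ m : (Fin N → ℝ) → ℂ, Continuous m → Integrable
      (fun q : (Fin N → ℝ) × (Fin N → ℝ) =>
        m q.1 * planeWave L T χ 0 q.2 (torusMap c₀ (fun _ => R) q.1))
      ((volume.restrict (angleBox N)).prod volume) := by
    intro m hm
    have hmi : Integrable m (volume.restrict (angleBox N)) :=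
      hm.continuousOn.integrableOn_compact isCompact_Icc
    refine (hmi.norm.mul_prod ((integrable_exp_neg_norm hc).const_mul A)).mono'
      ((hm.comp continuous_fst).mul hcont).aestronglyMeasurable (ae_of_all _ fun q => ?_)
    rw [norm_mul]
    gcongr
    exact hdec _ _ (torusMap_mem_closedBall c₀ hR.le _)
  have h1 : AnalyticOnNhd ℂ (fun y => ∫ θ in Icc 0 fun _ => 2 * Real.pi,
      (∏ i, (torusMap c₀ (fun _ => R) θ i - y i)⁻¹) *
        ∫ ξ, torusWeight R θ * planeWave L T χ 0 ξ (torusMap c₀ (fun _ => R) θ))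
      (Metric.ball c₀ R) :=
    analyticOnNhd_cauchyIntegral c₀ hR (hint _ (continuous_torusWeight R)).integral_prod_left
  refine h1.congr Metric.isOpen_ball fun y hy => ?_
  have h2 := hint _ ((continuous_torusWeight R).mul (continuous_cauchyProd hR hy))
  simp only [D.planeWave_eq_integral L hχ 0 _ hR hy]
  rw [← integral_integral_swap h2]
  refine integral_congr_ae (ae_of_all _ fun θ => ?_)
  simp only
  rw [← integral_const_mul]
  congr 1; funext ξ; ring

variable [Nontrivial E]

/-- A distribution which, near `x₀` and for each covector `η ≠ 0`, is a sum of boundary values from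
wedges in directions on which `η` is negative, is a real analytic function near `x₀`. -/
theorem exists_analytic_of_isWedgeSumAt
    (h : ∀ η : E →L[ℝ] ℝ, η ≠ 0 → IsWedgeSumAt T x₀ η) :
    ∃ ρ, 0 < ρ ∧ ∃ k : E → ℂ, AnalyticOnNhd ℝ k (Metric.ball x₀ ρ) ∧
      ∀ φ, IsTest (Metric.ball x₀ ρ) φ → T φ = ∫ x, k x * φ x := by
  let N := Module.finrank ℝ E
  let L : E ≃L[ℝ] (Fin N → ℝ) := (Module.finBasis ℝ E).equivFunL
  have hNT : Nontrivial (Fin N → ℝ) := L.symm.toEquiv.nontrivial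
  obtain ⟨ξ₁, hξ₁⟩ := exists_norm_eq (Fin N → ℝ) (zero_le_one (α := ℝ))
  have hξ₁0 : ξ₁ ≠ 0 := by rintro rfl; simp at hξ₁
  -- One representation, for an arbitrary nonzero covector, is fixed in order to manipulate `T`; the
  -- signs of its directions play no role. The signs enter only through the decay estimate.
  obtain ⟨r₁, hr₁, D₁, -⟩ := h _ (covec_ne_zero L hξ₁0)
  obtain ⟨r₂, hr₂, hdec⟩ := hasDecayOn_sphere L h
  obtain ⟨r₃, hr₃, hcoord⟩ : ∃ r₃, 0 < r₃ ∧ ∀ x ∈ Metric.ball x₀ r₃, coordSq L x x₀ ≤ 1 / 32 := by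
    have h1 : ∀ᶠ x in 𝓝 x₀, coordSq L x x₀ < 1 / 32 :=
      (continuous_coordSq L x₀).continuousAt.eventually_lt continuousAt_const (by simp [coordSq])
    obtain ⟨r₃, hr₃, h2⟩ := Metric.eventually_nhds_iff_ball.1 h1
    exact ⟨r₃, hr₃, fun x hx => (h2 x hx).le⟩
  set r := min r₁ (min r₂ r₃) with hr
  have hr0 : 0 < r := lt_min hr₁ (lt_min hr₂ hr₃)
  set D := D₁.mono (r' := r) (min_le_left _ _)
  let f : ContDiffBump x₀ := ⟨r / 3, r / 2, by positivity, by linarith⟩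
  set χ : E → ℂ := fun x => (f x : ℂ) with hχdef
  have hsupp : tsupport χ ⊆ Metric.closedBall x₀ (r / 2) := by
    refine (closure_mono fun x hx => ?_).trans_eq f.tsupport_eq
    rw [Function.mem_support, hχdef] at hx
    simpa using hx
  have hχ : IsTest (Metric.ball x₀ r) χ :=
    ⟨Complex.ofRealCLM.contDiff.comp f.contDiff,
      HasCompactSupport.intro (isCompact_closedBall x₀ (r / 2)) fun x hx =>
        image_eq_zero_of_notMem_tsupport fun h => hx (hsupp h),
      hsupp.trans (Metric.closedBall_subset_ball (by linarith))⟩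
  have hσ : ∀ x ∈ Metric.ball x₀ (r / 3), χ x = 1 := fun x hx => by
    simp only [hχdef]
    rw [f.one_of_mem_closedBall (Metric.ball_subset_closedBall hx), Complex.ofReal_one]
  have hχc : ∀ x ∈ tsupport χ, coordSq L x x₀ ≤ 1 / 32 := fun x hx =>
    hcoord x (Metric.ball_subset_ball ((min_le_right _ _).trans (min_le_right _ _)) (hχ.subset hx))
  obtain ⟨A, c, δ, hc, hδ, hA⟩ := hdec χ (r / 3) (by positivity)
    (hχ.mono (Metric.ball_subset_ball ((min_le_right _ _).trans (min_le_left _ _)))) hσ hχc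
  have hA' : ∀ (ξ : Fin N → ℝ), ∀ ε ∈ Icc (0 : ℝ) 1, ∀ y : Fin N → ℂ, ‖y - cx L x₀‖ ≤ δ →
      ‖planeWave L T χ ε ξ y‖ ≤ A * Real.exp (-c * ‖ξ‖) := by
    intro ξ ε hε y hy
    -- The decay is stated along rays from the unit sphere; `ξ = 0` is the ray of `ξ₁` at length
    -- zero.
    rcases eq_or_ne ξ 0 with rfl | hξ
    · have := hA ξ₁ (by simpa using hξ₁) 0 le_rfl ε hε y hy
      simpa using this
    · have := hA (‖ξ‖⁻¹ • ξ) (by simp [norm_smul, hξ]) ‖ξ‖ (norm_nonneg _) ε hε y hy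
      rwa [smul_inv_smul₀ (norm_ne_zero_iff.2 hξ)] at this
  have hbi := (integrable_exp_neg_norm (N := N) hc).const_mul A
  have han := D.analyticOnNhd_integral_planeWave L hχ (c₀ := cx L x₀) hc hδ
    fun ξ y hy => hA' ξ 0 ⟨le_rfl, zero_le_one⟩ y (by
      simpa [dist_eq_norm] using Metric.mem_closedBall.1 hy)
  set H : (Fin N → ℂ) → ℂ := fun y => ∫ ξ, planeWave L T χ 0 ξ y with hH
  obtain ⟨ρ', hρ', hcxρ⟩ : ∃ ρ', 0 < ρ' ∧ ∀ x ∈ Metric.ball x₀ ρ', ‖cx L x - cx L x₀‖ < δ := by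
    have h1 : ∀ᶠ x in 𝓝 x₀, ‖cx L x - cx L x₀‖ < δ := by
      have h2 : Continuous fun x => ‖cx L x - cx L x₀‖ :=
        ((continuous_cx L).sub continuous_const).norm
      exact h2.continuousAt.eventually_lt continuousAt_const (by simpa using hδ)
    exact Metric.eventually_nhds_iff_ball.1 h1
  refine ⟨min ρ' (r / 3), lt_min hρ' (by positivity),
    fun x => (gaussMass L)⁻¹ * H (cx L x), ?_, ?_⟩
  · intro x hx
    refine analyticAt_const.mul ?_
    have h1 : AnalyticAt ℝ H (cx L x) := (han (cx L x) (by
      rw [Metric.mem_ball, dist_eq_norm]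
      exact hcxρ x (Metric.ball_subset_ball (min_le_left _ _) hx))).restrictScalars
    have h2 : AnalyticAt ℝ (cx L) x := by
      rw [analyticAt_pi_iff]
      exact fun i => (Complex.ofRealCLM ∘L (ContinuousLinearMap.proj (R := ℝ)
        (φ := fun _ : Fin N => ℝ) i) ∘L L.toContinuousLinearMap).analyticAt x
    exact h1.comp h2
  · intro φ hφ
    have hφσ := hφ.mono (Metric.ball_subset_ball (min_le_right ρ' (r / 3)))
    have hφi : Integrable φ := hφ.contDiff.continuous.integrable_of_hasCompactSupport hφ.compact
    have hsub : ∀ y ∈ tsupport φ, coordSq L y x₀ ≤ 1 / 32 ∧ ‖cx L y - cx L x₀‖ ≤ δ := by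
      intro y hy
      refine ⟨hcoord y (Metric.ball_subset_ball ?_ (hφ.subset hy)),
        (hcxρ y (Metric.ball_subset_ball (min_le_left _ _) (hφ.subset hy))).le⟩
      refine (min_le_right _ _).trans ((by linarith : r / 3 ≤ r).trans ?_)
      exact (min_le_right _ _).trans (min_le_right _ _)
    have hev : ∀ᶠ ε : ℝ in 𝓝[>] 0, ε ∈ Ioc (0 : ℝ) 1 := Ioc_mem_nhdsGT one_pos
    have hpw := D.continuous_planeWave L hχ
    -- For `ε > 0` the Gaussian transform is the sum of the plane waves. The decay is uniform in `ε
    -- ∈ (0, 1]`, so dominated convergence, in `ξ` and then in `y`, yields the sum at `ε = 0`.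
    have hlim : Tendsto (fun ε => ∫ y, φ y * T (holoTest L χ fun w => gaussKernel ε (w - cx L y)))
        (𝓝[>] 0) (𝓝 (∫ y, φ y * H (cx L y))) := by
      refine tendsto_integral_filter_of_dominated_convergence
        (fun y => ‖φ y‖ * ∫ ξ : Fin N → ℝ, A * Real.exp (-c * ‖ξ‖))
        (Eventually.of_forall fun ε => ?_) ?_ (hφi.norm.mul_const _) (ae_of_all _ fun y => ?_)
      · refine Continuous.aestronglyMeasurable (hφ.contDiff.continuous.mul ?_)
        refine D.continuous_family L hχ (e := fun y w => gaussKernel ε (w - cx L y))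
          (fun y => (differentiable_gaussKernel ε).comp (differentiable_id.sub_const _)) ?_
        exact (differentiable_gaussKernel ε).continuous.comp
          (continuous_snd.sub ((continuous_cx L).comp continuous_fst))
      · filter_upwards [hev] with ε hε
        refine ae_of_all _ fun y => ?_
        rw [norm_mul]
        by_cases hy : y ∈ tsupport φ
        · rw [D.gauss_eq_integral_planeWave L hχ hχc (hsub y hy).1 hε.1]
          gcongr
          exact norm_integral_le_of_norm_le hbi (ae_of_all _ fun ξ =>
            hA' ξ ε ⟨hε.1.le, hε.2⟩ _ (hsub y hy).2)
        · simp [image_eq_zero_of_notMem_tsupport hy]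
      · by_cases hy : y ∈ tsupport φ
        · refine Tendsto.const_mul _ ?_
          have h1 : Tendsto (fun ε => ∫ ξ, planeWave L T χ ε ξ (cx L y)) (𝓝[>] 0)
              (𝓝 (H (cx L y))) := by
            refine tendsto_integral_filter_of_dominated_convergence _
              (Eventually.of_forall fun ε => ?_) ?_ hbi (ae_of_all _ fun ξ => ?_)
            · exact (hpw.comp (f := fun ξ : Fin N → ℝ => (ε, ξ, cx L y))
                (by fun_prop)).aestronglyMeasurable
            · filter_upwards [hev] with ε hε
              exact ae_of_all _ fun ξ => hA' ξ ε ⟨hε.1.le, hε.2⟩ _ (hsub y hy).2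
            · exact ((hpw.comp (f := fun ε : ℝ => (ε, ξ, cx L y))
                (by fun_prop)).tendsto 0).mono_left nhdsWithin_le_nhds
          refine h1.congr' ?_
          filter_upwards [hev] with ε hε
          exact (D.gauss_eq_integral_planeWave L hχ hχc (hsub y hy).1 hε.1).symm
        · simp [image_eq_zero_of_notMem_tsupport hy]
    -- The same expression tends to the Gaussian mass times `T φ`, and the two limits are compared.
    have huniq := tendsto_nhds_unique hlim
      (D.tendsto_integral_gauss L hχ hσ (by linarith) hφσ)
    rw [← mul_right_inj' (gaussMass_ne_zero L), ← huniq, ← integral_const_mul]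
    congr 1; funext y
    rw [mul_assoc, mul_inv_cancel_left₀ (gaussMass_ne_zero L), mul_comm]

end Core

/-! ## Microlocal analyticity and sums of boundary values -/

section Micro

variable {E : Type*} [NormedAddCommGroup E] [NormedSpace ℝ E]

/-- The real part of a test function. -/
def IsTest.re {Ω : Opens E} {φ : E → ℂ} (h : IsTest (Ω : Set E) φ) : 𝓓(Ω, ℝ) where
  toFun x := (φ x).re
  contDiff' := Complex.reCLM.contDiff.comp h.contDiff
  hasCompactSupport' := h.compact.comp_left Complex.zero_re
  tsupport_subset' := (tsupport_comp_subset Complex.zero_re φ).trans h.subset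

/-- The imaginary part of a test function. -/
def IsTest.im {Ω : Opens E} {φ : E → ℂ} (h : IsTest (Ω : Set E) φ) : 𝓓(Ω, ℝ) where
  toFun x := (φ x).im
  contDiff' := Complex.imCLM.contDiff.comp h.contDiff
  hasCompactSupport' := h.compact.comp_left Complex.zero_im
  tsupport_subset' := (tsupport_comp_subset Complex.zero_im φ).trans h.subset

open scoped Classical in
/-- The complex linear extension of a distribution to complex valued test functions. -/
def distEval {Ω : Opens E} (u : 𝓓'(Ω, ℂ)) (φ : E → ℂ) : ℂ :=
  if h : IsTest (Ω : Set E) φ then u h.re + Complex.I * u h.im else 0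

theorem distEval_eq {Ω : Opens E} (u : 𝓓'(Ω, ℂ)) {φ : E → ℂ} (h : IsTest (Ω : Set E) φ) :
    distEval u φ = u h.re + Complex.I * u h.im := dif_pos h

variable {T T' : (E → ℂ) → ℂ} {x₀ v : E} {r : ℝ}

section

variable [MeasureSpace E]

/-- The boundary value of minus a function. -/
def WedgeRep.neg (W : WedgeRep T x₀ r v) : WedgeRep (fun φ => -T φ) x₀ r v where
  F x t := -W.F x t
  t₀ := W.t₀
  C := W.C
  m := W.m
  t₀_pos := W.t₀_pos
  contDiffAt x hx t ht := (W.contDiffAt x hx t ht).neg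
  dbar_eq x hx t ht := by
    have h := W.dbar_eq x hx t ht
    simp only [dbar] at h ⊢
    rw [show (Function.uncurry fun x t => -W.F x t) = -Function.uncurry W.F from rfl, fderiv_neg]
    simp only [neg_apply]
    rw [mul_neg, ← neg_sub', h, neg_zero]
  bound x hx t ht := by rw [norm_neg]; exact W.bound x hx t ht
  limit φ hφ := by simpa [integral_neg] using (W.limit φ hφ).neg

theorem IsWedgeSumAt.sub {η : E →L[ℝ] ℝ} (h : IsWedgeSumAt T x₀ η) (h' : IsWedgeSumAt T' x₀ η) :
    IsWedgeSumAt (fun φ => T φ - T' φ) x₀ η := by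
  obtain ⟨r, hr, D, hD⟩ := h
  obtain ⟨r', hr', D', hD'⟩ := h'
  let D₁ := D.mono (min_le_left r r')
  let D₂ := D'.mono (min_le_right r r')
  refine ⟨min r r', lt_min hr hr', ⟨D₁.m + D₂.m, Fin.append D₁.S fun j φ => -D₂.S j φ,
    Fin.append D₁.v D₂.v, fun j => ?_, fun φ hφ => ?_⟩, fun j => ?_⟩
  · refine Fin.addCases (fun i => ?_) (fun i => ?_) j
    · rw [Fin.append_left, Fin.append_left]
      exact D₁.rep i
    · rw [Fin.append_right, Fin.append_right]
      exact (D₂.rep i).neg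
  · rw [Fin.sum_univ_add]
    simp only [Fin.append_left, Fin.append_right, Finset.sum_neg_distrib]
    rw [D₁.eq φ hφ, D₂.eq φ hφ, sub_eq_add_neg]
  · refine Fin.addCases (fun i => ?_) (fun i => ?_) j
    · show η (Fin.append D₁.v D₂.v (Fin.castAdd D₂.m i)) < 0
      rw [Fin.append_left]
      exact hD i
    · show η (Fin.append D₁.v D₂.v (Fin.natAdd D₁.m i)) < 0
      rw [Fin.append_right]
      exact hD' i

theorem IsWedgeSumAt.congr {η : E →L[ℝ] ℝ} (h : IsWedgeSumAt T x₀ η) {σ : ℝ} (hσ : 0 < σ)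
    (hT : ∀ φ, IsTest (Metric.ball x₀ σ) φ → T' φ = T φ) : IsWedgeSumAt T' x₀ η := by
  obtain ⟨r, hr, D, hD⟩ := h
  let D₁ := D.mono (min_le_left r σ)
  exact ⟨min r σ, lt_min hr hσ, ⟨D₁.m, D₁.S, D₁.v, D₁.rep, fun φ hφ =>
    (hT φ (hφ.mono (Metric.ball_subset_ball (min_le_right _ _)))).trans (D₁.eq φ hφ)⟩, hD⟩

end

variable [FiniteDimensional ℝ E] [MeasureSpace E] [BorelSpace E]
  [(volume : Measure E).IsAddHaarMeasure]

/-- The boundary value of a holomorphic function along a ray. -/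
def WedgeRep.ofHolomorphic {F : E × E → ℂ} {D : Set (E × E)} (hF : IsHolomorphicOn F D)
    {t₀ C : ℝ} {m : ℕ} (ht₀ : 0 < t₀)
    (hD : ∀ x ∈ Metric.ball x₀ r, ∀ t ∈ Ioo 0 t₀, (x, t • v) ∈ D)
    (hC : ∀ x ∈ Metric.ball x₀ r, ∀ t ∈ Ioo 0 t₀, ‖F (x, t • v)‖ * t ^ m ≤ C)
    (hlim : ∀ φ, IsTest (Metric.ball x₀ r) φ →
      Tendsto (fun t : ℝ => ∫ x, F (x, t • v) * φ x) (𝓝[>] 0) (𝓝 (T φ))) :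
    WedgeRep T x₀ r v where
  F x t := F (x, t • v)
  t₀ := t₀
  C := C
  m := m
  t₀_pos := ht₀
  contDiffAt x hx t ht := by
    have h : ContDiff ℝ 1 fun q : E × ℝ => (q.1, q.2 • v) := by fun_prop
    exact (hF.contDiffAt (Module.finBasis ℝ E).equivFunL (hD x hx t ht)).comp (x, t) h.contDiffAt
  dbar_eq x hx t ht := by
    have h1 : HasFDerivAt F (fderiv ℝ F (x, t • v)) (x, t • v) :=
      ((hF.2.1 _ (hD x hx t ht)).differentiableAt (hF.1.mem_nhds (hD x hx t ht))).hasFDerivAt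
    have h2 : HasFDerivAt (fun q : E × ℝ => (q.1, q.2 • v))
        ((ContinuousLinearMap.fst ℝ E ℝ).prod ((ContinuousLinearMap.snd ℝ E ℝ).smulRight v))
        (x, t) :=
      ((ContinuousLinearMap.fst ℝ E ℝ).prod
        ((ContinuousLinearMap.snd ℝ E ℝ).smulRight v)).hasFDerivAt
    have h3 := (h1.comp (x, t) h2).fderiv
    have h4 : Function.uncurry (fun (x : E) (t : ℝ) => F (x, t • v))
        = F ∘ fun q : E × ℝ => (q.1, q.2 • v) := rfl
    have h5 := hF.2.2 _ (hD x hx t ht) v 0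
    rw [dbar, h4, h3]
    simp only [ContinuousLinearMap.comp_apply, ContinuousLinearMap.prod_apply,
      ContinuousLinearMap.smulRight_apply, ContinuousLinearMap.coe_fst',
      ContinuousLinearMap.coe_snd', one_smul, zero_smul]
    rw [neg_zero] at h5
    rw [h5, sub_self]
  bound := hC
  limit := hlim

theorem integrable_mul_isTest {U : Set E} {g φ : E → ℂ} (hg : ContinuousOn g U)
    (hφ : IsTest U φ) : Integrable fun x => g x * φ x := by
  have h1 : IntegrableOn (fun x => g x * φ x) (tsupport φ) :=
    ((hg.mono hφ.subset).mul hφ.contDiff.continuous.continuousOn).integrableOn_compact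
      hφ.compact.isCompact
  refine (integrableOn_iff_integrable_of_support_subset fun x hx => ?_).1 h1
  exact subset_tsupport φ (right_ne_zero_of_mul hx)

theorem integral_mul_isTest_eq {U : Set E} {g φ : E → ℂ} (hg : ContinuousOn g U)
    (hφ : IsTest U φ) : ∫ x, g x * φ x
      = (∫ x, g x * ((φ x).re : ℂ)) + Complex.I * ∫ x, g x * ((φ x).im : ℂ) := by
  have hre : IsTest U fun x => ((φ x).re : ℂ) :=
    ⟨(Complex.ofRealCLM.comp Complex.reCLM).contDiff.comp hφ.contDiff,
      hφ.compact.comp_left (g := fun z : ℂ => (z.re : ℂ)) (by simp),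
      (tsupport_comp_subset (g := fun z : ℂ => (z.re : ℂ)) (by simp) φ).trans hφ.subset⟩
  have him : IsTest U fun x => ((φ x).im : ℂ) :=
    ⟨(Complex.ofRealCLM.comp Complex.imCLM).contDiff.comp hφ.contDiff,
      hφ.compact.comp_left (g := fun z : ℂ => (z.im : ℂ)) (by simp),
      (tsupport_comp_subset (g := fun z : ℂ => (z.im : ℂ)) (by simp) φ).trans hφ.subset⟩
  rw [← integral_const_mul, ← integral_add (integrable_mul_isTest hg hre)
    ((integrable_mul_isTest hg him).const_mul _)]
  congr 1; funext x
  conv_lhs => rw [← Complex.re_add_im (φ x)]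
  ring

/-- An open ray meets the unit sphere in one point, so boundary values and growth bounds formulated
for cones specialise to a single direction. -/
theorem isRelCompactSubcone_ray {Γ : Set E} (hΓ : IsConvexOpenCone Γ) (hv : v ∈ Γ) (hv0 : v ≠ 0) :
    IsRelCompactSubcone {y | ∃ c : ℝ, 0 < c ∧ y = c • v} Γ where
  subset := by
    rintro _ ⟨c, hc, rfl⟩
    exact hΓ.smul_mem c hc v hv
  smul_mem := by
    rintro c hc _ ⟨d, hd, rfl⟩
    exact ⟨c * d, mul_pos hc hd, smul_smul _ _ _⟩
  closure_subset := by
    have h : {y | ∃ c : ℝ, 0 < c ∧ y = c • v} ∩ Metric.sphere 0 1 ⊆ {‖v‖⁻¹ • v} := by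
      rintro _ ⟨⟨c, hc, rfl⟩, h⟩
      rw [mem_sphere_zero_iff_norm, norm_smul, Real.norm_of_nonneg hc.le] at h
      rw [mem_singleton_iff, eq_inv_of_mul_eq_one_left h]
    refine (closure_minimal h isClosed_singleton).trans ?_
    rw [singleton_subset_iff]
    exact hΓ.smul_mem _ (by positivity) v hv

theorem tendsto_smul_ray (v : E) : Tendsto (fun t : ℝ => t • v) (𝓝[>] 0)
    (𝓝[{y | ∃ c : ℝ, 0 < c ∧ y = c • v}] 0) := by
  refine tendsto_nhdsWithin_iff.2 ⟨?_, ?_⟩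
  · exact ((by fun_prop : Continuous fun t : ℝ => t • v).tendsto' 0 0 (by simp)).mono_left
      nhdsWithin_le_nhds
  · filter_upwards [self_mem_nhdsWithin] with t ht
    exact ⟨t, ht, rfl⟩

theorem tendsto_integral_ray {Ω : Opens E} {f : 𝓓'(Ω, ℂ)} {F : E × E → ℂ} {D : Set (E × E)}
    {Γ : Set E} (hΓ : IsConvexOpenCone Γ) (hF : IsHolomorphicOn F D)
    (hb : HasBoundaryValue F Ω Γ f) (hv : v ∈ Γ) (hv0 : v ≠ 0) (hr : Metric.ball x₀ r ⊆ Ω)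
    {t₀ : ℝ} (ht₀ : 0 < t₀) (hD : ∀ x ∈ Metric.ball x₀ r, ∀ t ∈ Ioo 0 t₀, (x, t • v) ∈ D)
    {φ : E → ℂ} (hφ : IsTest (Metric.ball x₀ r) φ) :
    Tendsto (fun t : ℝ => ∫ x, F (x, t • v) * φ x) (𝓝[>] 0) (𝓝 (distEval f φ)) := by
  have hφΩ : IsTest (Ω : Set E) φ := hφ.mono hr
  have h := fun ψ => (hb _ (isRelCompactSubcone_ray hΓ hv hv0) ψ).comp (tendsto_smul_ray v)
  rw [distEval_eq f hφΩ]
  refine ((h hφΩ.re).add ((h hφΩ.im).const_mul Complex.I)).congr' ?_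
  filter_upwards [Ioo_mem_nhdsGT ht₀] with t ht
  have hc : ContinuousOn (fun x => F (x, t • v)) (Metric.ball x₀ r) :=
    hF.2.1.continuousOn.comp (by fun_prop) fun x hx => hD x hx t ht
  exact (integral_mul_isTest_eq hc hφ).symm

theorem exists_ray_tube {Ω : Opens E} {D : Set (E × E)} {Γ : Set E} (hΓ : IsConvexOpenCone Γ)
    (hD : IsTuboid D Ω Γ) (hx₀ : x₀ ∈ Ω) (hv : v ∈ Γ) (hv0 : v ≠ 0) :
    ∃ r t₀ : ℝ, 0 < r ∧ 0 < t₀ ∧ ∀ x ∈ Metric.ball x₀ r, ∀ t ∈ Ioo 0 t₀, (x, t • v) ∈ D := by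
  obtain ⟨Ω', -, hx', ρ, hρ, h⟩ := hD.exists_mem x₀ hx₀ _ (isRelCompactSubcone_ray hΓ hv hv0)
  obtain ⟨r, hr, hrΩ⟩ := Metric.isOpen_iff.1 Ω'.isOpen x₀ hx'
  have hv' : 0 < ‖v‖ := norm_pos_iff.2 hv0
  refine ⟨r, ρ / ‖v‖, hr, by positivity, fun x hx t ht => h x (hrΩ hx) _ ⟨t, ht.1, rfl⟩ ?_ ?_⟩
  · rw [norm_smul, Real.norm_of_nonneg ht.1.le]
    exact mul_pos ht.1 hv'
  · rw [norm_smul, Real.norm_of_nonneg ht.1.le]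
    exact ((lt_div_iff₀ hv').1 ht.2).le

theorem exists_wedgeRep_of_mem {Ω : Opens E} {f : 𝓓'(Ω, ℂ)} {F : E × E → ℂ} {D : Set (E × E)}
    {Γ : Set E} (hΓ : IsConvexOpenCone Γ) (hD : IsTuboid D Ω Γ) (hF : IsHolomorphicOn F D)
    (ht : IsTemperate F Ω Γ) (hb : HasBoundaryValue F Ω Γ f) (hx₀ : x₀ ∈ Ω)
    (hv : v ∈ Γ) (hv0 : v ≠ 0) : ∃ r, 0 < r ∧ Nonempty (WedgeRep (distEval f) x₀ r v) := by
  obtain ⟨r₁, t₁, hr₁, ht₁, h1⟩ := exists_ray_tube hΓ hD hx₀ hv hv0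
  obtain ⟨r₂, hr₂, h2⟩ := Metric.nhds_basis_closedBall.mem_iff.1 (Ω.isOpen.mem_nhds hx₀)
  obtain ⟨C, ρ, m, hρ, h3⟩ := ht _ (isCompact_closedBall x₀ r₂) h2 _
    (isRelCompactSubcone_ray hΓ hv hv0)
  have hv' : 0 < ‖v‖ := norm_pos_iff.2 hv0
  have ht₀ : 0 < min t₁ (ρ / ‖v‖) := lt_min ht₁ (by positivity)
  have hD' : ∀ x ∈ Metric.ball x₀ (min r₁ r₂), ∀ t ∈ Ioo 0 (min t₁ (ρ / ‖v‖)),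
      (x, t • v) ∈ D := fun x hx t ht =>
    h1 x (Metric.ball_subset_ball (min_le_left _ _) hx) t ⟨ht.1, ht.2.trans_le (min_le_left _ _)⟩
  have hrΩ : Metric.ball x₀ (min r₁ r₂) ⊆ Metric.closedBall x₀ r₂ :=
    (Metric.ball_subset_ball (min_le_right _ _)).trans Metric.ball_subset_closedBall
  refine ⟨min r₁ r₂, lt_min hr₁ hr₂, ⟨WedgeRep.ofHolomorphic hF (m := m) (C := C / ‖v‖ ^ m) ht₀ hD'
    (fun x hx t ht => ?_) fun φ hφ =>
      tendsto_integral_ray hΓ hF hb hv hv0 (hrΩ.trans h2) ht₀ hD' hφ⟩⟩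
  have hn : ‖t • v‖ = t * ‖v‖ := by rw [norm_smul, Real.norm_of_nonneg ht.1.le]
  have h4 := h3 x (hrΩ hx) (t • v) ⟨t, ht.1, rfl⟩ (by rw [hn]; exact mul_pos ht.1 hv') (by
    rw [hn]; exact ((lt_div_iff₀ hv').1 (ht.2.trans_le (min_le_right _ _))).le)
  have ht0 := ht.1
  calc ‖F (x, t • v)‖ * t ^ m ≤ C * (‖t • v‖ ^ m)⁻¹ * t ^ m := by gcongr
    _ = C / ‖v‖ ^ m := by
      rw [hn, mul_pow]
      field_simp

/-- If `F` extends holomorphically across `x₀`, its boundary value is the restriction of the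
extension to real points. That function is a boundary value from every direction, so `v` is free,
whatever the cone. -/
theorem exists_wedgeRep_of_isHolomorphicNear {Ω : Opens E} {f : 𝓓'(Ω, ℂ)} {F : E × E → ℂ}
    {D : Set (E × E)} {Γ : Set E} [Nontrivial E] (hΓ : IsConvexOpenCone Γ) (hD : IsTuboid D Ω Γ)
    (hF : IsHolomorphicOn F D) (hb : HasBoundaryValue F Ω Γ f) (hx₀ : x₀ ∈ Ω)
    (hG : IsHolomorphicNear F D x₀) (v : E) :
    ∃ r, 0 < r ∧ Nonempty (WedgeRep (distEval f) x₀ r v) := by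
  obtain ⟨U, G, hU, hGU, hGF⟩ := hG
  have : (𝓝[≠] (0 : E)).NeBot := Module.punctured_nhds_neBot ℝ E 0
  obtain ⟨w, hw, hw0⟩ : (Γ ∩ {0}ᶜ).Nonempty :=
    (dense_compl_singleton (0 : E)).inter_open_nonempty Γ hΓ.isOpen hΓ.nonempty
  obtain ⟨r₁, t₁, hr₁, ht₁, h1⟩ := exists_ray_tube hΓ hD hx₀ hw hw0
  obtain ⟨ρ, hρ, h2⟩ := Metric.nhds_basis_closedBall.mem_iff.1 (hGU.1.mem_nhds hU)
  rw [← closedBall_prod_same] at h2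
  obtain ⟨r₃, hr₃, h3⟩ := Metric.isOpen_iff.1 Ω.isOpen x₀ hx₀
  obtain ⟨C, hC⟩ := ((isCompact_closedBall x₀ ρ).prod (isCompact_closedBall (0 : E) ρ)
    ).exists_bound_of_continuousOn (hGU.2.1.continuousOn.mono h2)
  set r := min r₁ (min ρ r₃) with hr
  have hr0 : 0 < r := lt_min hr₁ (lt_min hρ hr₃)
  have hrρ : Metric.ball x₀ r ⊆ Metric.closedBall x₀ ρ :=
    (Metric.ball_subset_ball ((min_le_right _ _).trans (min_le_left _ _))).trans
      Metric.ball_subset_closedBall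
  have hrΩ : Metric.ball x₀ r ⊆ Ω :=
    (Metric.ball_subset_ball ((min_le_right _ _).trans (min_le_right _ _))).trans h3
  have htube : ∀ u : E, ∃ t₀ : ℝ, 0 < t₀ ∧ ∀ x ∈ Metric.ball x₀ r, ∀ t ∈ Ioo 0 t₀,
      (x, t • u) ∈ Metric.closedBall x₀ ρ ×ˢ Metric.closedBall (0 : E) ρ := by
    intro u
    refine ⟨ρ / (‖u‖ + 1), by positivity, fun x hx t ht => ⟨hrρ hx, ?_⟩⟩
    rw [mem_closedBall_zero_iff, norm_smul, Real.norm_of_nonneg ht.1.le]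
    have := (lt_div_iff₀ (by positivity)).1 ht.2
    nlinarith [ht.1]
  have hlim : ∀ (u : E) (φ : E → ℂ), IsTest (Metric.ball x₀ r) φ →
      Tendsto (fun t : ℝ => ∫ x, G (x, t • u) * φ x) (𝓝[>] 0) (𝓝 (∫ x, G (x, 0) * φ x)) := by
    intro u φ hφ
    obtain ⟨t₀, ht₀, hu⟩ := htube u
    have hφi : Integrable φ := hφ.contDiff.continuous.integrable_of_hasCompactSupport hφ.compact
    refine tendsto_integral_filter_of_dominated_convergence (fun x => C * ‖φ x‖) ?_ ?_
      (hφi.norm.const_mul C) (ae_of_all _ fun x => ?_)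
    · filter_upwards [Ioo_mem_nhdsGT ht₀] with t ht
      have hc : ContinuousOn (fun x => G (x, t • u)) (Metric.ball x₀ r) :=
        hGU.2.1.continuousOn.comp (by fun_prop) fun x hx => h2 (hu x hx t ht)
      exact (integrable_mul_isTest hc hφ).aestronglyMeasurable
    · filter_upwards [Ioo_mem_nhdsGT ht₀] with t ht
      refine ae_of_all _ fun x => ?_
      rw [norm_mul]
      by_cases hx : x ∈ tsupport φ
      · gcongr
        exact hC _ (hu x (hφ.subset hx) t ht)
      · simp [image_eq_zero_of_notMem_tsupport hx]
    · by_cases hx : x ∈ tsupport φ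
      · refine Tendsto.mul_const _ ?_
        have h4 : ContinuousAt G (x, 0) := hGU.2.1.continuousOn.continuousAt (hGU.1.mem_nhds
          (h2 ⟨hrρ (hφ.subset hx), Metric.mem_closedBall_self hρ.le⟩))
        have h5 : Tendsto (fun t : ℝ => (x, t • u)) (𝓝[>] 0) (𝓝 (x, 0)) :=
          ((by fun_prop : Continuous fun t : ℝ => (x, t • u)).tendsto' 0 _ (by simp)).mono_left
            nhdsWithin_le_nhds
        exact h4.tendsto.comp h5
      · simp [image_eq_zero_of_notMem_tsupport hx]
  -- The distribution is identified by approaching along a nonzero direction `w` of the cone, where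
  -- `F` and its extension coincide.
  have heq : ∀ φ, IsTest (Metric.ball x₀ r) φ → distEval f φ = ∫ x, G (x, 0) * φ x := by
    intro φ hφ
    have hsub : Metric.ball x₀ r ⊆ Metric.ball x₀ r₁ := Metric.ball_subset_ball (min_le_left _ _)
    refine tendsto_nhds_unique (tendsto_integral_ray hΓ hF hb hw hw0 hrΩ ht₁
      (fun x hx => h1 x (hsub hx)) hφ) ((hlim w φ hφ).congr' ?_)
    obtain ⟨t₀, ht₀, hu⟩ := htube w
    filter_upwards [Ioo_mem_nhdsGT ht₀, Ioo_mem_nhdsGT ht₁] with t ht ht'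
    congr 1; funext x
    by_cases hx : x ∈ tsupport φ
    · rw [hGF ⟨h2 (hu x (hφ.subset hx) t ht), h1 x (hsub (hφ.subset hx)) t ht'⟩]
    · simp [image_eq_zero_of_notMem_tsupport hx]
  obtain ⟨t₀, ht₀, hu⟩ := htube v
  exact ⟨r, hr0, ⟨WedgeRep.ofHolomorphic hGU (m := 0) ht₀ (fun x hx t ht => h2 (hu x hx t ht))
    (fun x hx t ht => by rw [pow_zero, mul_one]; exact hC _ (hu x hx t ht))
    fun φ hφ => by rw [heq φ hφ]; exact hlim v φ hφ⟩⟩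

/-- Microlocal analyticity gives a representation by boundary values from directions in which the
covector is negative. -/
theorem isWedgeSumAt_of_isMicroAnalyticAt {Ω : Opens E} {u : 𝓓'(Ω, ℂ)} {ξ₀ : E →L[ℝ] ℝ}
    (hξ₀ : ξ₀ ≠ 0) (hu : IsMicroAnalyticAt u x₀ ξ₀) : IsWedgeSumAt (distEval u) x₀ ξ₀ := by
  obtain ⟨Ω', hΩ, hx₀, m, Γ, D, F, f, hj, hsum⟩ := hu
  obtain ⟨v₀, hv₀⟩ : ∃ v₀, ξ₀ v₀ < 0 := by
    obtain ⟨w, hw⟩ : ∃ w, ξ₀ w ≠ 0 := by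
      by_contra! h
      exact hξ₀ (ContinuousLinearMap.ext h)
    rcases lt_or_gt_of_ne hw with h | h
    · exact ⟨w, h⟩
    · exact ⟨-w, by simpa using h⟩
  have hne : Nontrivial E := ⟨⟨v₀, 0, by rintro rfl; simp at hv₀⟩⟩
  have key : ∀ j, ∃ r, 0 < r ∧ ∃ v, ξ₀ v < 0 ∧ Nonempty (WedgeRep (distEval (f j)) x₀ r v) := by
    intro j
    obtain ⟨h1, h2, h3, h4, h5, h6⟩ := hj j
    -- If `ξ₀` is in the polar cone, the summand is holomorphic near `x₀` and any direction with `ξ₀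
    -- < 0` may be used. Otherwise the cone itself contains such a direction.
    by_cases h : ξ₀ ∈ polarCone (Γ j)
    · obtain ⟨r, hr, W⟩ := exists_wedgeRep_of_isHolomorphicNear h1 h2 h3 h5 hx₀ (h6 h) v₀
      exact ⟨r, hr, v₀, hv₀, W⟩
    · simp only [polarCone, mem_ofPred_eq, not_forall, not_le] at h
      obtain ⟨v, hv, hv'⟩ := h
      obtain ⟨r, hr, W⟩ := exists_wedgeRep_of_mem h1 h2 h3 h4 h5 hx₀ hv
        (by rintro rfl; simp at hv')
      exact ⟨r, hr, v, hv', W⟩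
  choose r hr v hv W using key
  obtain ⟨ρ, hρ, hρr⟩ := exists_pos_forall_le r hr
  obtain ⟨ρ', hρ', hρΩ⟩ := Metric.isOpen_iff.1 Ω'.isOpen x₀ hx₀
  refine ⟨min ρ ρ', lt_min hρ hρ', ⟨m, fun j => distEval (f j), v,
    fun j => (W j).some.mono ((min_le_left _ _).trans (hρr j)), fun φ hφ => ?_⟩, hv⟩
  have h1 : IsTest (Ω' : Set E) φ :=
    hφ.mono ((Metric.ball_subset_ball (min_le_right _ _)).trans hρΩ)
  have h2 : IsTest (Ω : Set E) φ := h1.mono hΩ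
  have hm : ∀ (ψ : 𝓓(Ω', ℝ)) (ψ' : 𝓓(Ω, ℝ)), (∀ x, ψ x = ψ' x) → u ψ' = ∑ j, f j ψ := by
    intro ψ ψ' h
    rw [← hsum]
    congr 1
    ext x
    rw [TestFunction.monoCLM_apply]
    simp [hΩ, h]
  rw [distEval_eq u h2, hm h1.re h2.re fun _ => rfl, hm h1.im h2.im fun _ => rfl, Finset.mul_sum,
    ← Finset.sum_add_distrib]
  exact Finset.sum_congr rfl fun j _ => (distEval_eq (f j) h1).symm

end Micro

/-! ## The volume measure of an analytic Lorentzian metric -/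

section Volume

variable {n : ℕ} {M : Type*} [TopologicalSpace M] [ChartedSpace (Eucl n) M]
  [IsManifold 𝓘(ℝ, Eucl n) ω M] (g : LorentzMetric n M)

/-- A vector orthogonal to everything is orthogonal to a timelike vector, hence spacelike or zero;
being orthogonal to itself, it is zero. -/
theorem LorentzMetric.nondegenerate (p : M) {v : TangentSpace 𝓘(ℝ, Eucl n) p}
    (hv : ∀ w, g.form p w v = 0) : v = 0 := by
  obtain ⟨t, -, ht⟩ := g.signature p
  by_contra h
  exact (ht v (hv t) h).ne' (hv v)

theorem LorentzMetric.nontrivial (g : LorentzMetric n M) (p : M) : Nontrivial (Eucl n) := by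
  obtain ⟨t, ht, -⟩ := g.signature p
  refine ⟨⟨(t : Eucl n), 0, fun h => ?_⟩⟩
  have h' : t = 0 := h
  rw [h', map_zero] at ht
  exact lt_irrefl _ ht

/-- The coordinate vector field of a chart is analytic. -/
theorem contMDiffOn_coordVector (x : M) (w : Eucl n) :
    ContMDiffOn 𝓘(ℝ, Eucl n) 𝓘(ℝ, Eucl n).tangent ω
      (fun y : Eucl n => (⟨(extChartAt 𝓘(ℝ, Eucl n) x).symm y,
        mfderiv 𝓘(ℝ, Eucl n) 𝓘(ℝ, Eucl n) (extChartAt 𝓘(ℝ, Eucl n) x).symm y w⟩ :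
          TangentBundle 𝓘(ℝ, Eucl n) M)) (extChartAt 𝓘(ℝ, Eucl n) x).target := by
  have hopen := isOpen_extChartAt_target (I := 𝓘(ℝ, Eucl n)) x
  have h1 := (contMDiffOn_extChartAt_symm (I := 𝓘(ℝ, Eucl n)) (n := ω) x
    ).contMDiffOn_tangentMapWithin (m := ω) le_rfl hopen.uniqueMDiffOn
  have h2 : ContMDiff 𝓘(ℝ, Eucl n) 𝓘(ℝ, Eucl n).tangent ω
      (fun y : Eucl n => (⟨y, w⟩ : TangentBundle 𝓘(ℝ, Eucl n) (Eucl n))) :=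
    contMDiff_vectorSpace_iff_contDiff.2 contDiff_const
  refine (h1.comp h2.contMDiffOn fun y hy => hy).congr fun y hy => ?_
  simp only [Function.comp_apply, tangentMapWithin]
  rw [mfderivWithin_of_isOpen hopen hy]

theorem contDiffOn_metricCoeff (x : M) (i j : Fin n) :
    ContDiffOn ℝ ω (fun y => metricCoeff g x y i j) (extChartAt 𝓘(ℝ, Eucl n) x).target := by
  rw [← contMDiffOn_iff_contDiffOn]
  intro y hy
  have hopen := isOpen_extChartAt_target (I := 𝓘(ℝ, Eucl n)) x
  have h : ContMDiffWithinAt 𝓘(ℝ, Eucl n) (𝓘(ℝ, Eucl n).prod 𝓘(ℝ, ℝ)) ω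
      (fun y => Bundle.TotalSpace.mk' ℝ (E := Bundle.Trivial M ℝ)
        ((extChartAt 𝓘(ℝ, Eucl n) x).symm y) (metricCoeff g x y i j))
      (extChartAt 𝓘(ℝ, Eucl n) x).target y := by
    refine ContMDiffWithinAt.clm_bundle_apply₂ (F₁ := Eucl n) (F₂ := Eucl n)
      (E₁ := fun p : M => TangentSpace 𝓘(ℝ, Eucl n) p)
      (E₂ := fun p : M => TangentSpace 𝓘(ℝ, Eucl n) p) (F₃ := ℝ) (E₃ := Bundle.Trivial M ℝ)
      (b := (extChartAt 𝓘(ℝ, Eucl n) x).symm)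
      (ψ := fun y => g.form ((extChartAt 𝓘(ℝ, Eucl n) x).symm y)) ?_
      (contMDiffOn_coordVector x _ y hy) (contMDiffOn_coordVector x _ y hy)
    exact g.contMDiff.contMDiffAt.comp_contMDiffWithinAt y
      (contMDiffOn_extChartAt_symm (I := 𝓘(ℝ, Eucl n)) (n := ω) x y hy)
  simp only [Bundle.contMDiffWithinAt_totalSpace] at h
  exact h.2

/-- A null vector of the matrix gives a coordinate combination orthogonal to the image of the chart
differential. As the differential is bijective, nondegeneracy applies. -/
theorem metricCoeff_det_ne_zero (x : M) {y : Eucl n}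
    (hy : y ∈ (extChartAt 𝓘(ℝ, Eucl n) x).target) : (metricCoeff g x y).det ≠ 0 := by
  set e := extChartAt 𝓘(ℝ, Eucl n) x
  set A : Eucl n →L[ℝ] Eucl n := mfderiv 𝓘(ℝ, Eucl n) 𝓘(ℝ, Eucl n) e.symm y with hA
  have hinv : Function.Bijective A := by
    have h := isInvertible_mfderivWithin_extChartAt_symm (I := 𝓘(ℝ, Eucl n)) hy
    rw [ModelWithCorners.range_eq_univ, mfderivWithin_univ] at h
    exact h.bijective
  let f : Eucl n →L[ℝ] Eucl n →L[ℝ] ℝ := g.form (e.symm y)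
  intro hdet
  obtain ⟨c, hc, hc0⟩ := Matrix.exists_mulVec_eq_zero_iff.2 hdet
  let b := (EuclideanSpace.basisFun (Fin n) ℝ).toBasis
  have hb : ∀ i, b i = EuclideanSpace.single i (1 : ℝ) := fun i => by simp [b]
  obtain ⟨S, hS⟩ : ∃ S, S = ∑ j, c j • b j := ⟨_, rfl⟩
  have h1 : ∀ i, f (A (b i)) (A S) = 0 := by
    intro i
    have h2 := congrFun hc0 i
    simp only [Matrix.mulVec, dotProduct, Pi.zero_apply] at h2
    rw [hS, map_sum, map_sum, ← h2]
    refine Finset.sum_congr rfl fun j _ => ?_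
    rw [map_smul, map_smul, smul_eq_mul, mul_comm, hb, hb]
    rfl
  have h3 : ∀ w, f w (A S) = 0 := by
    intro w
    obtain ⟨u, rfl⟩ := hinv.2 w
    rw [← b.sum_repr u]
    simp only [map_sum, map_smul, FunLike.coe_sum, Finset.sum_apply, FunLike.coe_smul,
      Pi.smul_apply, smul_eq_mul]
    refine Finset.sum_eq_zero fun i _ => ?_
    rw [h1 i, mul_zero]
  have h4 : A S = 0 := g.nondegenerate (e.symm y) h3
  have h5 := hinv.1 (h4.trans (map_zero A).symm)
  refine hc (funext fun j => ?_)
  have h6 := congrArg (fun u => b.repr u j) h5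
  simpa [hS, Finsupp.single_apply] using h6

theorem volDensity_pos (x : M) {y : Eucl n} (hy : y ∈ (extChartAt 𝓘(ℝ, Eucl n) x).target) :
    0 < volDensity g x y :=
  Real.sqrt_pos.2 (abs_pos.2 (metricCoeff_det_ne_zero g x hy))

theorem contDiffOn_volDensity (x : M) :
    ContDiffOn ℝ ω (volDensity g x) (extChartAt 𝓘(ℝ, Eucl n) x).target := by
  have hdet : ContDiffOn ℝ ω (fun y => (metricCoeff g x y).det)
      (extChartAt 𝓘(ℝ, Eucl n) x).target := by
    simp only [Matrix.det_apply']
    exact ContDiffOn.sum fun σ _ => contDiffOn_const.mul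
      (contDiffOn_prod fun i _ => contDiffOn_metricCoeff g x _ _)
  intro y hy
  have h1 := hdet y hy
  have h0 := metricCoeff_det_ne_zero g x hy
  -- Where the determinant does not vanish, `|t|` is locally `t` or `-t` and the square root is
  -- analytic.
  have h2 : ContDiffAt ℝ ω (fun t : ℝ => √|t|) (metricCoeff g x y).det := by
    rcases lt_or_gt_of_ne h0 with h | h
    · have : (fun t : ℝ => √|t|) =ᶠ[𝓝 (metricCoeff g x y).det] fun t => √(-t) := by
        filter_upwards [gt_mem_nhds h] with t ht
        rw [abs_of_neg ht]
      exact ((Real.contDiffAt_sqrt (neg_ne_zero.2 h0)).comp _ contDiffAt_id.neg).congr_of_eventuallyEq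
        this
    · have : (fun t : ℝ => √|t|) =ᶠ[𝓝 (metricCoeff g x y).det] fun t => √t := by
        filter_upwards [lt_mem_nhds h] with t ht
        rw [abs_of_pos ht]
      exact (Real.contDiffAt_sqrt h0).congr_of_eventuallyEq this
  exact ContDiffAt.comp_contDiffWithinAt (g := fun t : ℝ => √|t|)
    (f := fun y => (metricCoeff g x y).det) y h2 h1

theorem continuousOn_volDensity (x : M) :
    ContinuousOn (volDensity g x) (extChartAt 𝓘(ℝ, Eucl n) x).target :=
  (contDiffOn_volDensity g x).continuousOn

variable [T2Space M] [SecondCountableTopology M] [Nonempty M] [MeasurableSpace M] [BorelSpace M]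

theorem isLocallyFiniteMeasure_volumeMeasure : IsLocallyFiniteMeasure (volumeMeasure g) := by
  refine ⟨fun x => ?_⟩
  set e := extChartAt 𝓘(ℝ, Eucl n) x with he
  have hmem : e.target ∈ 𝓝 (e x) := extChartAt_target_mem_nhds x
  obtain ⟨r, hr, hrt⟩ := Metric.nhds_basis_closedBall.mem_iff.1 hmem
  have hA : e.source ∩ e ⁻¹' Metric.ball (e x) r ∈ 𝓝 x := inter_mem (extChartAt_source_mem_nhds x)
    ((continuousAt_extChartAt x).preimage_mem_nhds (Metric.ball_mem_nhds _ hr))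
  have hAo : IsOpen (e.source ∩ e ⁻¹' Metric.ball (e x) r) :=
    (continuousOn_extChartAt x).isOpen_inter_preimage (isOpen_extChartAt_source x) Metric.isOpen_ball
  refine ⟨_, hA, ?_⟩
  rw [volumeMeasure_apply g x hAo.measurableSet inter_subset_left]
  have hc := (continuousOn_volDensity g x).mono hrt
  have hint : IntegrableOn (volDensity g x) (Metric.closedBall (e x) r) :=
    hc.integrableOn_compact (isCompact_closedBall _ _)
  refine (lintegral_mono_set fun y hy => ?_).trans_lt hint.lintegral_lt_top
  have h : e (e.symm y) ∈ Metric.ball (e x) r := hy.2.2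
  rw [e.right_inv hy.1] at h
  exact Metric.ball_subset_closedBall h

theorem isOpenPosMeasure_volumeMeasure : (volumeMeasure g).IsOpenPosMeasure := by
  refine ⟨fun U hU ⟨x, hx⟩ => ?_⟩
  set e := extChartAt 𝓘(ℝ, Eucl n) x with he
  have hAo : IsOpen (U ∩ e.source) := hU.inter (isOpen_extChartAt_source x)
  have hBo : IsOpen (e.target ∩ e.symm ⁻¹' (U ∩ e.source)) :=
    (continuousOn_extChartAt_symm x).isOpen_inter_preimage (isOpen_extChartAt_target x) hAo
  have hBn : (e.target ∩ e.symm ⁻¹' (U ∩ e.source)).Nonempty := ⟨e x, mem_extChartAt_target x, by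
    rw [mem_preimage, extChartAt_to_inv]
    exact ⟨hx, mem_extChartAt_source x⟩⟩
  intro h0
  have h1 : volumeMeasure g (U ∩ e.source) = 0 := measure_mono_null inter_subset_left h0
  rw [volumeMeasure_apply g x hAo.measurableSet inter_subset_right] at h1
  have hmeas : AEMeasurable (fun y => ENNReal.ofReal (volDensity g x y))
      (volume.restrict (e.target ∩ e.symm ⁻¹' (U ∩ e.source))) :=
    (((continuousOn_volDensity g x).mono inter_subset_left).aemeasurable hBo.measurableSet
      ).ennreal_ofReal
  have h2 := (lintegral_eq_zero_iff' hmeas).1 h1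
  have h3 : ∀ᵐ y ∂volume.restrict (e.target ∩ e.symm ⁻¹' (U ∩ e.source)), False := by
    filter_upwards [h2, ae_restrict_mem hBo.measurableSet] with y hy hyB
    exact (ENNReal.ofReal_pos.2 (volDensity_pos g x hyB.1)).ne' hy
  rw [ae_iff] at h3
  simp only [not_false_eq_true, ofPred_true, Measure.restrict_apply_univ] at h3
  exact (hBo.measure_pos volume hBn).ne' h3

/-- Integration in a chart. -/
theorem integral_volumeMeasure_eq (x : M) {F : M → ℂ}
    (hF : ContinuousOn F (extChartAt 𝓘(ℝ, Eucl n) x).source)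
    (hF0 : ∀ p ∉ (extChartAt 𝓘(ℝ, Eucl n) x).source, F p = 0) :
    ∫ p, F p ∂(volumeMeasure g) = ∫ y in (extChartAt 𝓘(ℝ, Eucl n) x).target,
      (volDensity g x y : ℂ) * F ((extChartAt 𝓘(ℝ, Eucl n) x).symm y) := by
  set e := extChartAt 𝓘(ℝ, Eucl n) x with he
  have hs := (isOpen_extChartAt_source (I := 𝓘(ℝ, Eucl n)) x).measurableSet
  have ht := (isOpen_extChartAt_target (I := 𝓘(ℝ, Eucl n)) x).measurableSet
  set ν : Measure (Eucl n) := (volume.restrict e.target).withDensity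
    fun y => ENNReal.ofReal (volDensity g x y) with hν
  have hac : ν ≪ volume.restrict e.target := withDensity_absolutelyContinuous _ _
  have hae : AEMeasurable e.symm ν :=
    ((continuousOn_extChartAt_symm x).aemeasurable ht).mono_ac hac
  have hmeas : (volumeMeasure g).restrict e.source = Measure.map e.symm ν := by
    ext A hA
    rw [Measure.restrict_apply hA, Measure.map_apply_of_aemeasurable hae hA,
      volumeMeasure_apply g x (hA.inter hs) inter_subset_right, hν, ← restrict_withDensity ht,
      Measure.restrict_apply' ht, inter_comm (e.symm ⁻¹' A),
      withDensity_apply _ (measurableSet_chart_image (n := n) x hA)]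
    congr 2
    ext y
    simp only [mem_inter_iff, mem_preimage]
    exact ⟨fun h => ⟨h.1, h.2.1⟩, fun h => ⟨h.1, h.2, e.map_target h.1⟩⟩
  rw [← setIntegral_eq_integral_of_forall_compl_eq_zero hF0, hmeas,
    integral_map hae (by rw [← hmeas]; exact hF.aestronglyMeasurable hs), hν,
    integral_withDensity_eq_integral_toReal_smul₀
      ((continuousOn_volDensity g x).aemeasurable ht).ennreal_ofReal
      (ae_of_all _ fun y => ENNReal.ofReal_lt_top)]
  refine setIntegral_congr_fun ht fun y hy => ?_
  simp only [ENNReal.toReal_ofReal (volDensity_pos g x hy).le, Complex.real_smul]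

/-- A continuous function on an open set which is orthogonal to all test functions vanishes. -/
theorem eq_zero_of_integral_test_eq_zero {U : Set M} (hU : IsOpen U) {f : M → ℂ}
    (hf : ContinuousOn f U)
    (h : ∀ u : TestFn 𝓘(ℝ, Eucl n) M, tsupport u ⊆ U →
      (∀ p, conj (u p) = u p) → ∫ p, u p * f p ∂(volumeMeasure g) = 0) :
    ∀ x ∈ U, f x = 0 := by
  have := isLocallyFiniteMeasure_volumeMeasure g
  have := isOpenPosMeasure_volumeMeasure g
  have : LocallyCompactSpace M := ChartedSpace.locallyCompactSpace (Eucl n) M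
  have : IsManifold 𝓘(ℝ, Eucl n) ∞ M := IsManifold.of_le (n := ω) le_top
  have h1 := hU.ae_eq_zero_of_integral_contMDiff_smul_eq_zero 𝓘(ℝ, Eucl n) (μ := volumeMeasure g)
    (hf.locallyIntegrableOn hU.measurableSet) fun φ hφ hc hs => ?_
  · have h2 : f =ᵐ[(volumeMeasure g).restrict U] fun _ => 0 :=
      (ae_restrict_iff' hU.measurableSet).2 h1
    exact fun x hx => Measure.eqOn_open_of_ae_eq h2 hU hf continuousOn_const hx
  · let u : TestFn 𝓘(ℝ, Eucl n) M := ⟨fun p => (φ p : ℂ),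
      (Complex.ofRealCLM.contMDiff (n := ∞)).comp hφ, hc.comp_left Complex.ofReal_zero⟩
    have h2 := h u ((tsupport_comp_subset (g := fun t : ℝ => (t : ℂ)) Complex.ofReal_zero φ).trans hs)
      fun p => Complex.conj_ofReal _
    simpa only [Complex.real_smul] using h2

end Volume

/-! ## Test functions in charts -/

section Chart

variable {W : Type*} [NormedAddCommGroup W] [NormedSpace ℝ W]
  {H : Type*} [TopologicalSpace H] {I : ModelWithCorners ℝ W H}
  {N : Type*} [TopologicalSpace N] [ChartedSpace H N] [I.Boundaryless] [T2Space N]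
  [IsManifold I ω N]

/-- A complex valued test function in a chart, as a test function on the manifold. -/
def fromChart (x : N) {φ : W → ℂ} (h : IsTest (chartDomain I x : Set W) φ) : TestFn I N :=
  ofChart I x h.re + Complex.I • ofChart I x h.im

theorem fromChart_of_mem {x p : N} {φ : W → ℂ} (h : IsTest (chartDomain I x : Set W) φ)
    (hp : p ∈ (extChartAt I x).source) : fromChart x h p = φ (extChartAt I x p) := by
  show ofChart I x h.re p + Complex.I * ofChart I x h.im p = _
  rw [ofChart_of_mem _ hp, ofChart_of_mem _ hp, mul_comm]
  exact Complex.re_add_im _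

theorem fromChart_of_notMem {x p : N} {φ : W → ℂ} (h : IsTest (chartDomain I x : Set W) φ)
    (hp : p ∉ (extChartAt I x).source) : fromChart x h p = 0 := by
  show ofChart I x h.re p + Complex.I * ofChart I x h.im p = _
  rw [ofChart_of_notMem _ hp, ofChart_of_notMem _ hp, mul_zero, add_zero]

theorem toLin_fromChart (K : ManifoldDistribution I N) (x : N) {φ : W → ℂ}
    (h : IsTest (chartDomain I x : Set W) φ) :
    K.toLin (fromChart x h) = distEval (K.inChart x) φ := by
  rw [fromChart, map_add, map_smul, distEval_eq _ h]
  rfl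

open scoped Classical in
-- The converse of `fromChart`: the coordinate expression extended by zero is smooth, because its
-- support is the image of a compact set and so closed in the model space.
theorem exists_fromChart_eq (x : N) {B : Set W} (hB : B ⊆ (extChartAt I x).target) (u : TestFn I N)
    (hu : tsupport u ⊆ (extChartAt I x).source ∩ extChartAt I x ⁻¹' B) :
    ∃ φ, ∃ h : IsTest (chartDomain I x : Set W) φ, IsTest B φ ∧ fromChart x h = u ∧
      ∀ y ∈ (extChartAt I x).target, φ y = u ((extChartAt I x).symm y) := by
  set e := extChartAt I x with he
  set φ : W → ℂ := fun y => if y ∈ e.target then u (e.symm y) else 0 with hφ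
  set K : Set W := e '' tsupport u with hK
  have hus : tsupport u ⊆ e.source := hu.trans inter_subset_left
  have hKc : IsCompact K := u.2.2.isCompact.image_of_continuousOn
    ((continuousOn_extChartAt x).mono hus)
  have hKB : K ⊆ B := by
    rintro _ ⟨p, hp, rfl⟩
    exact (hu hp).2
  have h0 : ∀ y ∉ K, φ y = 0 := by
    intro y hy
    simp only [hφ]
    split_ifs with hyt
    · refine image_eq_zero_of_notMem_tsupport fun h => hy ⟨_, h, e.right_inv hyt⟩
    · rfl
  have hts : tsupport φ ⊆ K := closure_minimal (fun y hy => by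
    by_contra h; exact hy (h0 y h)) hKc.isClosed
  have hcd : ContDiff ℝ ∞ φ := by
    refine contDiff_iff_contDiffAt.2 fun y => ?_
    by_cases hy : y ∈ e.target
    · have h1 : ContMDiffAt 𝓘(ℝ, W) I ∞ e.symm y :=
        (contMDiffOn_extChartAt_symm x).contMDiffAt ((isOpen_extChartAt_target x).mem_nhds hy)
      have h2 : ContMDiffAt 𝓘(ℝ, W) 𝓘(ℝ, ℂ) ∞ (fun y => u (e.symm y)) y :=
        (u.2.1.contMDiffAt (x := e.symm y)).comp y h1
      refine h2.contDiffAt.congr_of_eventuallyEq ?_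
      filter_upwards [(isOpen_extChartAt_target x).mem_nhds hy] with z hz using if_pos hz
    · have hyK : y ∉ K := fun h => hy (hB (hKB h))
      refine (contDiffAt_const (c := (0 : ℂ))).congr_of_eventuallyEq ?_
      filter_upwards [hKc.isClosed.isOpen_compl.mem_nhds hyK] with z hz using h0 z hz
  have hT : IsTest B φ := ⟨hcd, HasCompactSupport.intro hKc h0, hts.trans hKB⟩
  refine ⟨φ, hT.mono hB, hT, ?_, fun y hy => if_pos hy⟩
  apply Subtype.ext
  funext p
  by_cases hp : p ∈ e.source
  · rw [fromChart_of_mem _ hp]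
    simp only [hφ]
    rw [if_pos (e.map_source hp), e.left_inv hp]
  · rw [fromChart_of_notMem _ hp]
    exact (image_eq_zero_of_notMem_tsupport fun h => hp (hus h)).symm

end Chart

/-! ### Product charts and tensor products of test functions. -/

section Tensor

/-- Coordinates of `ℝⁿ × ℝⁿ`. -/
def pairCoord (n : ℕ) : (Eucl n × Eucl n) ≃L[ℝ] (Fin (n + n) → ℝ) :=
  (((EuclideanSpace.equiv (Fin n) ℝ).toLinearEquiv.prodCongr
    (EuclideanSpace.equiv (Fin n) ℝ).toLinearEquiv).trans
    ((LinearEquiv.sumArrowLequivProdArrow (Fin n) (Fin n) ℝ ℝ).symm.trans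
      (LinearEquiv.funCongrLeft ℝ ℝ finSumFinEquiv.symm))).toContinuousLinearEquiv

/-- In these coordinates a Gaussian on the product is a tensor product of Gaussians. -/
theorem sum_pairCoord_sq (n : ℕ) (x : Eucl n × Eucl n) :
    ∑ i, pairCoord n x i ^ 2 = ∑ i, x.1 i ^ 2 + ∑ i, x.2 i ^ 2 := by
  rw [← Equiv.sum_comp finSumFinEquiv, Fintype.sum_sum_type]
  have h : ∀ j, pairCoord n x (finSumFinEquiv j)
      = (LinearEquiv.sumArrowLequivProdArrow (Fin n) (Fin n) ℝ ℝ).symm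
        (fun i => x.1 i, fun i => x.2 i) j := fun j => by
    show (LinearEquiv.sumArrowLequivProdArrow (Fin n) (Fin n) ℝ ℝ).symm
        (fun i => x.1 i, fun i => x.2 i) (finSumFinEquiv.symm (finSumFinEquiv j)) = _
    rw [Equiv.symm_apply_apply]
  simp only [h]
  rfl

instance isAddHaarMeasure_prod_eucl (n : ℕ) :
    (volume : Measure (Eucl n × Eucl n)).IsAddHaarMeasure :=
  inferInstanceAs ((volume : Measure (Eucl n)).prod volume).IsAddHaarMeasure

variable {n : ℕ} {M : Type*} [TopologicalSpace M] [ChartedSpace (Eucl n) M]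
  [IsManifold 𝓘(ℝ, Eucl n) ω M] [T2Space M]

theorem IsTest.tensor {E₁ E₂ : Type*} [NormedAddCommGroup E₁] [NormedSpace ℝ E₁]
    [NormedAddCommGroup E₂] [NormedSpace ℝ E₂] {B₁ : Set E₁} {B₂ : Set E₂} {φ₁ : E₁ → ℂ}
    {φ₂ : E₂ → ℂ} (h₁ : IsTest B₁ φ₁) (h₂ : IsTest B₂ φ₂) :
    IsTest (B₁ ×ˢ B₂) fun y : E₁ × E₂ => conj (φ₁ y.1) * φ₂ y.2 := by
  have h0 : ∀ y ∉ tsupport φ₁ ×ˢ tsupport φ₂, conj (φ₁ y.1) * φ₂ y.2 = 0 := by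
    rintro y hy
    rw [mem_prod, not_and_or] at hy
    rcases hy with hy | hy
    · simp [image_eq_zero_of_notMem_tsupport hy]
    · simp [image_eq_zero_of_notMem_tsupport hy]
  have hc : IsClosed (tsupport φ₁ ×ˢ tsupport φ₂) :=
    (isClosed_tsupport _).prod (isClosed_tsupport _)
  refine ⟨?_, HasCompactSupport.intro' (h₁.compact.prod h₂.compact) hc h0, ?_⟩
  · exact (Complex.conjCLE.toContinuousLinearMap.contDiff.comp
      (h₁.contDiff.comp contDiff_fst)).mul (h₂.contDiff.comp contDiff_snd)
  · refine (closure_minimal (fun y hy => ?_) hc).trans (prod_mono h₁.subset h₂.subset)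
    by_contra h
    exact hy (h0 y h)

theorem coe_chartDomain_prod (p : M × M) :
    (chartDomain (𝓘(ℝ, Eucl n).prod 𝓘(ℝ, Eucl n)) p : Set (Eucl n × Eucl n))
      = (extChartAt 𝓘(ℝ, Eucl n) p.1).target ×ˢ (extChartAt 𝓘(ℝ, Eucl n) p.2).target := by
  show (extChartAt (𝓘(ℝ, Eucl n).prod 𝓘(ℝ, Eucl n)) p).target = _
  rw [extChartAt_prod]
  rfl

/-- In product charts, tensor products of test functions are tensor products. -/
theorem distEval_tensor (K : ManifoldDistribution (𝓘(ℝ, Eucl n).prod 𝓘(ℝ, Eucl n)) (M × M))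
    (p : M × M) {φ₁ φ₂ : Eucl n → ℂ}
    (h₁ : IsTest (chartDomain 𝓘(ℝ, Eucl n) p.1 : Set (Eucl n)) φ₁)
    (h₂ : IsTest (chartDomain 𝓘(ℝ, Eucl n) p.2 : Set (Eucl n)) φ₂) :
    distEval (K.inChart p) (fun y => conj (φ₁ y.1) * φ₂ y.2)
      = K.toLin (tensorConj (fromChart p.1 h₁) (fromChart p.2 h₂)) := by
  have h : IsTest (chartDomain (𝓘(ℝ, Eucl n).prod 𝓘(ℝ, Eucl n)) p : Set (Eucl n × Eucl n))
      fun y => conj (φ₁ y.1) * φ₂ y.2 := by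
    rw [coe_chartDomain_prod]
    exact h₁.tensor h₂
  rw [← toLin_fromChart K p h]
  congr 1
  apply Subtype.ext
  funext q
  have hs : ∀ q : M × M, q ∈ (extChartAt (𝓘(ℝ, Eucl n).prod 𝓘(ℝ, Eucl n)) p).source ↔
      q.1 ∈ (extChartAt 𝓘(ℝ, Eucl n) p.1).source ∧ q.2 ∈ (extChartAt 𝓘(ℝ, Eucl n) p.2).source := by
    intro q
    rw [extChartAt_prod]
    rfl
  show fromChart p h q = conj (fromChart p.1 h₁ q.1) * fromChart p.2 h₂ q.2
  by_cases hq : q ∈ (extChartAt (𝓘(ℝ, Eucl n).prod 𝓘(ℝ, Eucl n)) p).source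
  · rw [fromChart_of_mem _ hq, fromChart_of_mem _ ((hs q).1 hq).1,
      fromChart_of_mem _ ((hs q).1 hq).2, extChartAt_prod]
    rfl
  · rw [fromChart_of_notMem _ hq]
    rw [hs, not_and_or] at hq
    rcases hq with hq | hq
    · rw [fromChart_of_notMem _ hq, map_zero, zero_mul]
    · rw [fromChart_of_notMem _ hq, mul_zero]

/-- The difference of two distributions in the chart at `p`. -/
def chartDiff (K K' : ManifoldDistribution (𝓘(ℝ, Eucl n).prod 𝓘(ℝ, Eucl n)) (M × M)) (p : M × M)
    (φ : Eucl n × Eucl n → ℂ) : ℂ := distEval (K.inChart p) φ - distEval (K'.inChart p) φ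

/-- Sums of boundary values which agree on tensor products agree. -/
theorem chartDiff_eq_of_tensor
    {K₁ K₁' K₂ K₂' : ManifoldDistribution (𝓘(ℝ, Eucl n).prod 𝓘(ℝ, Eucl n)) (M × M)}
    (hK : ∀ u v : TestFn 𝓘(ℝ, Eucl n) M, K₁.toLin (tensorConj u v) - K₁'.toLin (tensorConj u v)
      = K₂.toLin (tensorConj u v) - K₂'.toLin (tensorConj u v)) (p : M × M)
    {η : Eucl n × Eucl n →L[ℝ] ℝ}
    (h₁ : IsWedgeSumAt (chartDiff K₁ K₁' p)
      (extChartAt (𝓘(ℝ, Eucl n).prod 𝓘(ℝ, Eucl n)) p p) η)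
    (h₂ : IsWedgeSumAt (chartDiff K₂ K₂' p)
      (extChartAt (𝓘(ℝ, Eucl n).prod 𝓘(ℝ, Eucl n)) p p) η) :
    ∃ σ, 0 < σ ∧ ∀ φ, IsTest (Metric.ball (extChartAt (𝓘(ℝ, Eucl n).prod 𝓘(ℝ, Eucl n)) p p) σ) φ →
      chartDiff K₁ K₁' p φ = chartDiff K₂ K₂' p φ := by
  obtain ⟨r₁, hr₁, D₁, -⟩ := h₁
  obtain ⟨r₂, hr₂, D₂, -⟩ := h₂
  set z : Eucl n × Eucl n := extChartAt (𝓘(ℝ, Eucl n).prod 𝓘(ℝ, Eucl n)) p p with hz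
  obtain ⟨r₃, hr₃, h3⟩ := Metric.isOpen_iff.1
    (isOpen_extChartAt_target (I := 𝓘(ℝ, Eucl n).prod 𝓘(ℝ, Eucl n)) p) z (mem_extChartAt_target p)
  set r := min r₁ (min r₂ r₃) with hr
  have hr0 : 0 < r := lt_min hr₁ (lt_min hr₂ hr₃)
  have hrt : Metric.ball z.1 r ×ˢ Metric.ball z.2 r ⊆
      (extChartAt 𝓘(ℝ, Eucl n) p.1).target ×ˢ (extChartAt 𝓘(ℝ, Eucl n) p.2).target := by
    rw [ball_prod_same, ← coe_chartDomain_prod]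
    exact (Metric.ball_subset_ball ((min_le_right _ _).trans (min_le_right _ _))).trans h3
  have hrt1 : Metric.ball z.1 r ⊆ (extChartAt 𝓘(ℝ, Eucl n) p.1).target := fun y hy =>
    (hrt (mk_mem_prod hy (Metric.mem_ball_self hr0))).1
  have hrt2 : Metric.ball z.2 r ⊆ (extChartAt 𝓘(ℝ, Eucl n) p.2).target := fun y hy =>
    (hrt (mk_mem_prod (Metric.mem_ball_self hr0) hy)).2
  let f : ∀ c : Eucl n, ContDiffBump c := fun c => ⟨r / 3, r / 2, by positivity, by linarith⟩
  have hf : ∀ c : Eucl n, IsTest (Metric.ball c r) fun y => ((f c y : ℝ) : ℂ) := by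
    intro c
    have hs : tsupport (fun y => ((f c y : ℝ) : ℂ)) ⊆ Metric.closedBall c (r / 2) := by
      refine (closure_mono fun x hx => ?_).trans_eq (f c).tsupport_eq
      rw [Function.mem_support] at hx
      simpa using hx
    exact ⟨Complex.ofRealCLM.contDiff.comp (f c).contDiff,
      HasCompactSupport.intro (isCompact_closedBall c (r / 2)) fun x hx =>
        image_eq_zero_of_notMem_tsupport (f := fun y => ((f c y : ℝ) : ℂ)) fun h => hx (hs h),
      hs.trans (Metric.closedBall_subset_ball (by linarith))⟩
  have hχ := (hf z.1).tensor (hf z.2)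
  rw [ball_prod_same] at hχ
  refine ⟨r / 3, by positivity, fun φ hφ => WedgeSum.eq_of_gauss (pairCoord n)
    (D₁.mono (min_le_left _ _)) (D₂.mono ((min_le_right _ _).trans (min_le_left _ _))) hχ
    (σ := r / 3) (fun y hy => ?_) (by linarith) (fun ε hε y => ?_) hφ⟩
  · have hy' : y ∈ Metric.ball z.1 (r / 3) ×ˢ Metric.ball z.2 (r / 3) := by
      rwa [ball_prod_same]
    rw [(f z.1).one_of_mem_closedBall (Metric.ball_subset_closedBall hy'.1),
      (f z.2).one_of_mem_closedBall (Metric.ball_subset_closedBall hy'.2)]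
    simp
  · set G : Eucl n → Eucl n → ℂ := fun a x =>
      ((Real.exp (-(∑ i, (x i - a i) ^ 2) / (4 * ε)) : ℝ) : ℂ) with hG
    have hGc : ∀ a, ContDiff ℝ ∞ (G a) := fun a => by
      refine Complex.ofRealCLM.contDiff.comp (Real.contDiff_exp.comp ?_)
      have : ∀ i, ContDiff ℝ ∞ fun x : Eucl n => x i := fun i =>
        (EuclideanSpace.proj i : Eucl n →L[ℝ] ℝ).contDiff
      fun_prop
    have ht1 : IsTest (Metric.ball z.1 r) fun x => ((f z.1 x : ℝ) : ℂ) * G y.1 x :=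
      (hf z.1).mul_contDiff (hGc _)
    have ht2 : IsTest (Metric.ball z.2 r) fun x => ((f z.2 x : ℝ) : ℂ) * G y.2 x :=
      (hf z.2).mul_contDiff (hGc _)
    have hfun : holoTest (pairCoord n) (fun x : Eucl n × Eucl n =>
        conj ((f z.1 x.1 : ℝ) : ℂ) * ((f z.2 x.2 : ℝ) : ℂ))
          (fun w => gaussKernel ε (w - cx (pairCoord n) y))
        = fun x => (((Real.pi / ε) ^ (((n + n : ℕ) : ℝ) / 2) : ℝ) : ℂ) *
          (conj (((f z.1 x.1 : ℝ) : ℂ) * G y.1 x.1) * (((f z.2 x.2 : ℝ) : ℂ) * G y.2 x.2)) := by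
      funext x
      have he : Real.exp (-(∑ i, pairCoord n (x - y) i ^ 2) / (4 * ε))
          = Real.exp (-(∑ i, (x.1 i - y.1 i) ^ 2) / (4 * ε)) *
            Real.exp (-(∑ i, (x.2 i - y.2 i) ^ 2) / (4 * ε)) := by
        rw [sum_pairCoord_sq, ← Real.exp_add]
        congr 1
        simp only [Prod.fst_sub, Prod.snd_sub, PiLp.sub_apply]
        ring
      simp only [holoTest, ← cx_sub, hG]
      rw [gaussKernel_cx _ ε hε, he]
      simp only [map_mul, Complex.conj_ofReal]
      push_cast
      ring
    have ht := ht1.tensor ht2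
    rw [ball_prod_same] at ht
    rw [hfun, (D₁.mono (min_le_left _ _ : r ≤ r₁)).map_const_mul ht,
      (D₂.mono ((min_le_right _ _).trans (min_le_left _ _) : r ≤ r₂)).map_const_mul ht]
    congr 1
    simp only [chartDiff]
    rw [distEval_tensor K₁ p (ht1.mono hrt1) (ht2.mono hrt2),
      distEval_tensor K₁' p (ht1.mono hrt1) (ht2.mono hrt2),
      distEval_tensor K₂ p (ht1.mono hrt1) (ht2.mono hrt2),
      distEval_tensor K₂' p (ht1.mono hrt1) (ht2.mono hrt2)]
    exact hK _ _

end Tensor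

/-! ## Analytic kernels -/

section Kernel

theorem continuous_mul_of_tsupport_subset {X : Type*} [TopologicalSpace X] {U : Set X}
    (hU : IsOpen U) {f v : X → ℂ} (hf : ContinuousOn f U) (hv : Continuous v)
    (h : tsupport v ⊆ U) : Continuous fun x => f x * v x := by
  refine continuous_iff_continuousAt.2 fun x => ?_
  by_cases hx : x ∈ tsupport v
  · exact (hf.continuousAt (hU.mem_nhds (h hx))).mul hv.continuousAt
  · refine (continuousAt_const (y := (0 : ℂ))).congr ?_
    filter_upwards [notMem_tsupport_iff_eventuallyEq.1 hx] with y hy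
    rw [hy, Pi.zero_apply, mul_zero]

variable {n : ℕ} {M : Type*} [TopologicalSpace M] [ChartedSpace (Eucl n) M]
  [IsManifold 𝓘(ℝ, Eucl n) ω M] [T2Space M] [SecondCountableTopology M] [Nonempty M]
  [MeasurableSpace M] [BorelSpace M] (g : LorentzMetric n M)

theorem integrable_test (v : TestFn 𝓘(ℝ, Eucl n) M) {U : Set M} (hU : IsOpen U)
    {f : M → ℂ} (hf : ContinuousOn f U) (h : tsupport v ⊆ U) :
    Integrable (fun x => f x * v x) (volumeMeasure g) := by
  have := isLocallyFiniteMeasure_volumeMeasure g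
  exact (continuous_mul_of_tsupport_subset hU hf v.2.1.continuous h
    ).integrable_of_hasCompactSupport v.2.2.mul_left

theorem continuousOn_integral_kernel {N₁ N₂ : Set M} (hN₁ : IsOpen N₁) (hN₂ : IsOpen N₂)
    {k : M × M → ℂ} (hk : ContinuousOn k (N₁ ×ˢ N₂)) (v : TestFn 𝓘(ℝ, Eucl n) M)
    (hv : tsupport v ⊆ N₂) : ContinuousOn (fun x => ∫ y, k (x, y) * v y ∂(volumeMeasure g)) N₁ := by
  have := isLocallyFiniteMeasure_volumeMeasure g
  refine continuousOn_integral_of_compact_support (k := tsupport v) v.2.2.isCompact ?_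
    fun x y _ hy => by rw [image_eq_zero_of_notMem_tsupport hy, mul_zero]
  rintro ⟨x, y⟩ ⟨hx, -⟩
  refine ContinuousAt.continuousWithinAt ?_
  by_cases hy : y ∈ tsupport v
  · exact (hk.continuousAt ((hN₁.prod hN₂).mem_nhds ⟨hx, hv hy⟩)).mul
      (v.2.1.continuous.continuousAt.comp continuousAt_snd)
  · refine (continuousAt_const (y := (0 : ℂ))).congr ?_
    filter_upwards [continuousAt_snd.eventually (notMem_tsupport_iff_eventuallyEq.1 hy)] with q hq
    show 0 = k (q.1, q.2) * v q.2
    rw [hq, Pi.zero_apply, mul_zero]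

/-- The integral kernel `h` in the product chart at `p`, as an integral kernel on the manifold. -/
def chartKernel (p : M × M) (h : Eucl n × Eucl n → ℂ) (q : M × M) : ℂ :=
  h (extChartAt 𝓘(ℝ, Eucl n) p.1 q.1, extChartAt 𝓘(ℝ, Eucl n) p.2 q.2) *
    ((volDensity g p.1 (extChartAt 𝓘(ℝ, Eucl n) p.1 q.1) : ℂ) *
      (volDensity g p.2 (extChartAt 𝓘(ℝ, Eucl n) p.2 q.2) : ℂ))⁻¹

variable {B₁ B₂ : Set (Eucl n)} {p : M × M} {h : Eucl n × Eucl n → ℂ}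

/-- The part of a chart domain corresponding to a set in the model space. -/
def chartSet (x : M) (B : Set (Eucl n)) : Set M :=
  (extChartAt 𝓘(ℝ, Eucl n) x).source ∩ extChartAt 𝓘(ℝ, Eucl n) x ⁻¹' B

theorem isOpen_chartSet (x : M) {B : Set (Eucl n)} (hB : IsOpen B) : IsOpen (chartSet x B) :=
  (continuousOn_extChartAt x).isOpen_inter_preimage (isOpen_extChartAt_source x) hB

theorem contMDiffAt_chartKernel (hB₁ : B₁ ⊆ (extChartAt 𝓘(ℝ, Eucl n) p.1).target)
    (hB₂ : B₂ ⊆ (extChartAt 𝓘(ℝ, Eucl n) p.2).target) (hh : AnalyticOnNhd ℝ h (B₁ ×ˢ B₂))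
    {q : M × M} (hq : q ∈ chartSet p.1 B₁ ×ˢ chartSet p.2 B₂) :
    ContMDiffAt (𝓘(ℝ, Eucl n).prod 𝓘(ℝ, Eucl n)) 𝓘(ℝ, ℂ) ω (chartKernel g p h) q := by
  set e₁ := extChartAt 𝓘(ℝ, Eucl n) p.1 with he₁
  set e₂ := extChartAt 𝓘(ℝ, Eucl n) p.2 with he₂
  have hd : ∀ (x : M) {y : Eucl n}, y ∈ (extChartAt 𝓘(ℝ, Eucl n) x).target →
      ContDiffAt ℝ ω (fun y => (volDensity g x y : ℂ)) y := fun x y hy =>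
    Complex.ofRealCLM.contDiff.contDiffAt.comp y
      ((contDiffOn_volDensity g x).contDiffAt ((isOpen_extChartAt_target x).mem_nhds hy))
  have h1 : ContDiffAt ℝ ω (fun y : Eucl n × Eucl n => h y *
      ((volDensity g p.1 y.1 : ℂ) * (volDensity g p.2 y.2 : ℂ))⁻¹) (e₁ q.1, e₂ q.2) := by
    have ha : AnalyticAt ℝ h (e₁ q.1, e₂ q.2) :=
      hh (e₁ q.1, e₂ q.2) (mk_mem_prod hq.1.2 hq.2.2)
    have hd1 : ContDiffAt ℝ ω (fun y : Eucl n × Eucl n => (volDensity g p.1 y.1 : ℂ))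
        (e₁ q.1, e₂ q.2) :=
      ContDiffAt.comp (g := fun y => (volDensity g p.1 y : ℂ)) (f := Prod.fst) (e₁ q.1, e₂ q.2)
        (hd p.1 (hB₁ hq.1.2)) contDiffAt_fst
    have hd2 : ContDiffAt ℝ ω (fun y : Eucl n × Eucl n => (volDensity g p.2 y.2 : ℂ))
        (e₁ q.1, e₂ q.2) :=
      ContDiffAt.comp (g := fun y => (volDensity g p.2 y : ℂ)) (f := Prod.snd) (e₁ q.1, e₂ q.2)
        (hd p.2 (hB₂ hq.2.2)) contDiffAt_snd
    refine ha.contDiffAt.mul ((hd1.mul hd2).inv ?_)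
    refine mul_ne_zero ?_ ?_
    · exact_mod_cast (volDensity_pos g p.1 (hB₁ hq.1.2)).ne'
    · exact_mod_cast (volDensity_pos g p.2 (hB₂ hq.2.2)).ne'
  have h2 : ContMDiffAt (𝓘(ℝ, Eucl n).prod 𝓘(ℝ, Eucl n)) 𝓘(ℝ, Eucl n × Eucl n) ω
      (fun q : M × M => (e₁ q.1, e₂ q.2)) q :=
    ContMDiffAt.prodMk_space
      ((contMDiffAt_extChartAt' (by simpa [he₁] using hq.1.1)).comp q contMDiffAt_fst)
      ((contMDiffAt_extChartAt' (by simpa [he₂] using hq.2.1)).comp q contMDiffAt_snd)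
  exact h1.contMDiffAt.comp q h2

/-- The density in the integration variable cancels against `dvol_g`; the one in the other variable
remains as a factor and is used up by the outer integration against `u`. -/
theorem integral_chartKernel (hB₁ : B₁ ⊆ (extChartAt 𝓘(ℝ, Eucl n) p.1).target)
    (hB₂o : IsOpen B₂)
    (hB₂ : B₂ ⊆ (extChartAt 𝓘(ℝ, Eucl n) p.2).target) (hh : AnalyticOnNhd ℝ h (B₁ ×ˢ B₂))
    {v : TestFn 𝓘(ℝ, Eucl n) M} (hv : tsupport v ⊆ chartSet p.2 B₂) {φ : Eucl n → ℂ}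
    (hφ : IsTest B₂ φ)
    (hvφ : ∀ y ∈ (extChartAt 𝓘(ℝ, Eucl n) p.2).target,
      φ y = v ((extChartAt 𝓘(ℝ, Eucl n) p.2).symm y)) {a : Eucl n} (ha : a ∈ B₁) :
    (volDensity g p.1 a : ℂ) * ∫ y, chartKernel g p h
      ((extChartAt 𝓘(ℝ, Eucl n) p.1).symm a, y) * v y ∂(volumeMeasure g)
      = ∫ b, h (a, b) * φ b := by
  set e₁ := extChartAt 𝓘(ℝ, Eucl n) p.1 with he₁
  set e₂ := extChartAt 𝓘(ℝ, Eucl n) p.2 with he₂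
  have hx : e₁.symm a ∈ chartSet p.1 B₁ := by
    refine ⟨e₁.map_target (hB₁ ha), ?_⟩
    rw [mem_preimage, ← he₁, e₁.right_inv (hB₁ ha)]
    exact ha
  have hc : ContinuousOn (fun y => chartKernel g p h (e₁.symm a, y)) (chartSet p.2 B₂) :=
    fun y hy => ((contMDiffAt_chartKernel g hB₁ hB₂ hh (q := (e₁.symm a, y)) ⟨hx, hy⟩
      ).continuousAt.comp (f := fun y => (e₁.symm a, y)) (by fun_prop)).continuousWithinAt
  rw [integral_volumeMeasure_eq g p.2
    (continuous_mul_of_tsupport_subset (isOpen_chartSet p.2 hB₂o) hc v.2.1.continuous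
      hv).continuousOn
    (fun y hy => by rw [image_eq_zero_of_notMem_tsupport fun h => hy (hv h).1, mul_zero]),
    ← integral_const_mul]
  have h0 : ∀ b ∉ e₂.target, h (a, b) * φ b = 0 := fun b hb => by
    rw [image_eq_zero_of_notMem_tsupport fun h => hb (hB₂ (hφ.subset h)), mul_zero]
  rw [← setIntegral_eq_integral_of_forall_compl_eq_zero h0]
  refine setIntegral_congr_fun (isOpen_extChartAt_target p.2).measurableSet fun b hb => ?_
  have hb' : b ∈ e₂.target := hb
  have h1 : (volDensity g p.1 a : ℂ) ≠ 0 := by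
    exact_mod_cast (volDensity_pos g p.1 (hB₁ ha)).ne'
  have h2 : (volDensity g p.2 b : ℂ) ≠ 0 := by exact_mod_cast (volDensity_pos g p.2 hb).ne'
  simp only [chartKernel]
  rw [← he₁, ← he₂, e₁.right_inv (hB₁ ha), e₂.right_inv hb', hvφ b hb]
  field_simp

/-- If the kernel of `A` is a sum of boundary values for every codirection at `p`, then `A` has an
analytic kernel near `p`. -/
theorem exists_local_kernel {A : Op n M}
    {K K' : ManifoldDistribution (𝓘(ℝ, Eucl n).prod 𝓘(ℝ, Eucl n)) (M × M)}
    (hA : ∀ u v : TestFn 𝓘(ℝ, Eucl n) M, pairing g u (A v)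
      = K.toLin (tensorConj u v) - K'.toLin (tensorConj u v)) (p : M × M)
    (hwf : ∀ η : Eucl n × Eucl n →L[ℝ] ℝ, η ≠ 0 → IsWedgeSumAt (chartDiff K K' p)
      (extChartAt (𝓘(ℝ, Eucl n).prod 𝓘(ℝ, Eucl n)) p p) η) :
    ∃ N₁ N₂ : Set M, IsOpen N₁ ∧ IsOpen N₂ ∧ p.1 ∈ N₁ ∧ p.2 ∈ N₂ ∧ ∃ k : M × M → ℂ,
      (∀ q ∈ N₁ ×ˢ N₂, ContMDiffAt (𝓘(ℝ, Eucl n).prod 𝓘(ℝ, Eucl n)) 𝓘(ℝ, ℂ) ω k q) ∧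
      ∀ v : TestFn 𝓘(ℝ, Eucl n) M, tsupport v ⊆ N₂ → ∀ x ∈ N₁,
        A v x = ∫ y, k (x, y) * v y ∂(volumeMeasure g) := by
  have := g.nontrivial p.1
  set e₁ := extChartAt 𝓘(ℝ, Eucl n) p.1 with he₁
  set e₂ := extChartAt 𝓘(ℝ, Eucl n) p.2 with he₂
  set z : Eucl n × Eucl n := extChartAt (𝓘(ℝ, Eucl n).prod 𝓘(ℝ, Eucl n)) p p with hz
  have hz' : z = (e₁ p.1, e₂ p.2) := by
    rw [hz, extChartAt_prod]
    rfl
  obtain ⟨ρ, hρ, h, hh, hTh⟩ := exists_analytic_of_isWedgeSumAt hwf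
  obtain ⟨r₃, hr₃, h3⟩ := Metric.isOpen_iff.1
    (isOpen_extChartAt_target (I := 𝓘(ℝ, Eucl n).prod 𝓘(ℝ, Eucl n)) p) z (mem_extChartAt_target p)
  set r := min ρ r₃ with hr
  have hr0 : 0 < r := lt_min hρ hr₃
  set B₁ := Metric.ball z.1 r with hB₁def
  set B₂ := Metric.ball z.2 r with hB₂def
  have hBz : B₁ ×ˢ B₂ = Metric.ball z r := ball_prod_same _ _ _
  have hrt : B₁ ×ˢ B₂ ⊆ e₁.target ×ˢ e₂.target := by
    rw [hBz, ← coe_chartDomain_prod]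
    exact (Metric.ball_subset_ball (min_le_right _ _)).trans h3
  have hB₁ : B₁ ⊆ e₁.target := fun y hy => (hrt (mk_mem_prod hy (Metric.mem_ball_self hr0))).1
  have hB₂ : B₂ ⊆ e₂.target := fun y hy => (hrt (mk_mem_prod (Metric.mem_ball_self hr0) hy)).2
  have hhB : AnalyticOnNhd ℝ h (B₁ ×ˢ B₂) := by
    rw [hBz]
    exact hh.mono (Metric.ball_subset_ball (min_le_left _ _))
  have hN₁ : IsOpen (chartSet p.1 B₁) := isOpen_chartSet _ Metric.isOpen_ball
  have hN₂ : IsOpen (chartSet p.2 B₂) := isOpen_chartSet _ Metric.isOpen_ball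
  refine ⟨chartSet p.1 B₁, chartSet p.2 B₂, hN₁, hN₂, ⟨mem_extChartAt_source _, ?_⟩,
    ⟨mem_extChartAt_source _, ?_⟩, chartKernel g p h,
    fun q hq => contMDiffAt_chartKernel g hB₁ hB₂ hhB hq, fun v hv => ?_⟩
  · show e₁ p.1 ∈ B₁
    rw [hB₁def, hz']
    exact Metric.mem_ball_self hr0
  · show e₂ p.2 ∈ B₂
    rw [hB₂def, hz']
    exact Metric.mem_ball_self hr0
  have hkc : ContinuousOn (chartKernel g p h) (chartSet p.1 B₁ ×ˢ chartSet p.2 B₂) := fun q hq =>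
    (contMDiffAt_chartKernel g hB₁ hB₂ hhB hq).continuousAt.continuousWithinAt
  have hGc := continuousOn_integral_kernel g hN₁ hN₂ hkc v hv
  set G : M → ℂ := fun x => ∫ y, chartKernel g p h (x, y) * v y ∂(volumeMeasure g) with hG
  have hAc : Continuous (A v) := (A v).2.continuous
  -- Both `A v` and the candidate are continuous, so it suffices to pair with real test functions.
  -- Both pairings turn out to be the integral of `h` against the tensor product in the chart.
  have key := eq_zero_of_integral_test_eq_zero g hN₁ (f := fun x => A v x - G x)
    (hAc.continuousOn.sub hGc) fun u hu hreal => ?_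
  · exact fun x hx => sub_eq_zero.1 (key x hx)
  obtain ⟨φ₁, h₁, hφ₁, hu', huφ⟩ := exists_fromChart_eq p.1 hB₁ u hu
  obtain ⟨φ₂, h₂, hφ₂, hv', hvφ⟩ := exists_fromChart_eq p.2 hB₂ v hv
  have hi1 := integrable_test g u isOpen_univ hAc.continuousOn (subset_univ _)
  have hi2 := integrable_test g u hN₁ hGc hu
  have hconj : ∀ y ∈ e₁.target, conj (φ₁ y) = φ₁ y := fun y hy => by rw [huφ y hy, hreal]
  have hlhs : ∫ x, A v x * u x ∂(volumeMeasure g) = ∫ y, h y * (conj (φ₁ y.1) * φ₂ y.2) := by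
    have h4 := hA u v
    have hten := hφ₁.tensor hφ₂
    rw [hBz] at hten
    have h5 := hTh _ (hten.mono (Metric.ball_subset_ball (min_le_left _ _)))
    rw [chartDiff, distEval_tensor K p h₁ h₂, distEval_tensor K' p h₁ h₂, hu', hv'] at h5
    rw [← h5, ← h4, pairing]
    simp only [hreal]
    congr 1; funext x; ring
  have hrhs : ∫ x, G x * u x ∂(volumeMeasure g) = ∫ y, h y * (conj (φ₁ y.1) * φ₂ y.2) := by
    have hten := hφ₁.tensor hφ₂
    have hint := integrable_mul_isTest (U := B₁ ×ˢ B₂) hhB.continuousOn hten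
    rw [Measure.volume_eq_prod] at hint ⊢
    rw [integral_prod _ hint, integral_volumeMeasure_eq g p.1
      (continuous_mul_of_tsupport_subset hN₁ hGc u.2.1.continuous hu).continuousOn
      (fun y hy => by rw [image_eq_zero_of_notMem_tsupport fun h => hy (hu h).1, mul_zero])]
    have h0 : ∀ a ∉ e₁.target, ∫ b, h (a, b) * (conj (φ₁ a) * φ₂ b) = 0 := fun a ha => by
      simp [image_eq_zero_of_notMem_tsupport fun h => ha (hB₁ (hφ₁.subset h))]
    rw [← setIntegral_eq_integral_of_forall_compl_eq_zero h0]
    refine setIntegral_congr_fun (isOpen_extChartAt_target p.1).measurableSet fun a ha => ?_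
    have hswap : ∫ b, h (a, b) * (conj (φ₁ a) * φ₂ b) = φ₁ a * ∫ b, h (a, b) * φ₂ b := by
      rw [← integral_const_mul, hconj a ha]
      congr 1; funext b; ring
    rw [hswap, ← huφ a ha]
    by_cases haφ : a ∈ tsupport φ₁
    · rw [← integral_chartKernel g hB₁ Metric.isOpen_ball hB₂ hhB hv hφ₂ hvφ (hφ₁.subset haφ)]
      simp only [hG]
      ring
    · rw [image_eq_zero_of_notMem_tsupport haφ]
      ring
  calc ∫ x, u x * (A v x - G x) ∂(volumeMeasure g)
      = ∫ x, (A v x * u x - G x * u x) ∂(volumeMeasure g) := by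
        congr 1; funext x; ring
    _ = 0 := by rw [integral_sub hi1 hi2, hlhs, hrhs, sub_self]

/-- An operator with local analytic kernels has an analytic kernel. -/
theorem hasAnalyticKernel_of_local {A : Op n M}
    (hloc : ∀ p : M × M, ∃ N₁ N₂ : Set M, IsOpen N₁ ∧ IsOpen N₂ ∧ p.1 ∈ N₁ ∧ p.2 ∈ N₂ ∧
      ∃ k : M × M → ℂ,
      (∀ q ∈ N₁ ×ˢ N₂, ContMDiffAt (𝓘(ℝ, Eucl n).prod 𝓘(ℝ, Eucl n)) 𝓘(ℝ, ℂ) ω k q) ∧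
      ∀ v : TestFn 𝓘(ℝ, Eucl n) M, tsupport v ⊆ N₂ → ∀ x ∈ N₁,
        A v x = ∫ y, k (x, y) * v y ∂(volumeMeasure g)) : HasAnalyticKernel g A := by
  choose N₁ N₂ hN₁ hN₂ hp₁ hp₂ k hk hA using hloc
  have hslice : ∀ p x, x ∈ N₁ p → ContinuousOn (fun y => k p (x, y)) (N₂ p) := fun p x hx y hy =>
    ((hk p (x, y) ⟨hx, hy⟩).continuousAt.comp (f := fun y => (x, y))
      (by fun_prop)).continuousWithinAt
  -- With the first variable fixed, two local kernels represent the same functional on test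
  -- functions supported in the overlap and hence coincide there. This makes the diagonal choice `k
  -- q q` agree near `p` with the single analytic function `k p`.
  have hagree : ∀ p q, q ∈ N₁ p ×ˢ N₂ p → k q q = k p q := by
    intro p q hq
    have h1 := eq_zero_of_integral_test_eq_zero g ((hN₂ q).inter (hN₂ p))
      (f := fun y => k q (q.1, y) - k p (q.1, y))
      (((hslice q q.1 (hp₁ q)).mono inter_subset_left).sub
        ((hslice p q.1 hq.1).mono inter_subset_right)) (fun u hu _ => ?_) q.2 ⟨hp₂ q, hq.2⟩
    · exact sub_eq_zero.1 h1
    · have h2 := hA q u (hu.trans inter_subset_left) q.1 (hp₁ q)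
      have h3 := hA p u (hu.trans inter_subset_right) q.1 hq.1
      have i1 := integrable_test g u (hN₂ q) (hslice q q.1 (hp₁ q)) (hu.trans inter_subset_left)
      have i2 := integrable_test g u (hN₂ p) (hslice p q.1 hq.1) (hu.trans inter_subset_right)
      calc _ = ∫ y, (k q (q.1, y) * u y - k p (q.1, y) * u y) ∂(volumeMeasure g) := by
            congr 1; funext y; ring
        _ = 0 := by rw [integral_sub i1 i2, ← h2, ← h3, sub_self]
  have hsm : ContMDiff (𝓘(ℝ, Eucl n).prod 𝓘(ℝ, Eucl n)) 𝓘(ℝ, ℂ) ω fun q => k q q := fun p => by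
    refine (hk p p ⟨hp₁ p, hp₂ p⟩).congr_of_eventuallyEq ?_
    filter_upwards [((hN₁ p).prod (hN₂ p)).mem_nhds ⟨hp₁ p, hp₂ p⟩] with q hq using hagree p q hq
  refine ⟨fun q => k q q, hsm, fun v x => ?_⟩
  have : LocallyCompactSpace M := ChartedSpace.locallyCompactSpace (Eucl n) M
  have : IsManifold 𝓘(ℝ, Eucl n) ∞ M := IsManifold.of_le (n := ω) le_top
  -- For fixed `x`, the support of `v` is covered by finitely many neighbourhoods attached to the
  -- points `(x, y)`. A partition of unity splits `v` into pieces to which the local formulas apply.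
  obtain ⟨t, ht⟩ := v.2.2.isCompact.elim_finite_subcover (fun y => N₂ (x, y))
    (fun y => hN₂ (x, y)) fun y _ => mem_iUnion.2 ⟨y, hp₂ (x, y)⟩
  obtain ⟨f, hf⟩ := SmoothPartitionOfUnity.exists_isSubordinate 𝓘(ℝ, Eucl n)
    (isClosed_tsupport v) (fun y : t => N₂ (x, y)) (fun y => hN₂ (x, y)) (by
      refine ht.trans fun y hy => ?_
      obtain ⟨i, hi, hy⟩ := mem_iUnion₂.1 hy
      exact mem_iUnion.2 ⟨⟨i, hi⟩, hy⟩)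
  let w : t → TestFn 𝓘(ℝ, Eucl n) M := fun i => ⟨fun y => (f i y : ℂ) * v y, by
    have h1 : ContMDiff 𝓘(ℝ, Eucl n) 𝓘(ℝ, ℂ) ∞ (fun y => (f i y : ℂ)) :=
      (Complex.ofRealCLM.contMDiff (n := ∞)).comp (f i).contMDiff
    have h3 : ContDiff ℝ ∞ (fun z : ℂ × ℂ => z.1 * z.2) := contDiff_fst.mul contDiff_snd
    exact ⟨h3.contMDiff.comp (h1.prodMk_space v.2.1), v.2.2.mul_left⟩⟩
  have hw : ∀ i, tsupport (w i) ⊆ N₂ (x, i) := fun i =>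
    ((tsupport_mul_subset_left (f := fun y => (f i y : ℂ)) (g := v)).trans
      (tsupport_comp_subset (g := fun t : ℝ => (t : ℂ)) Complex.ofReal_zero (f i))).trans (hf i)
  have hsum : v = ∑ i, w i := by
    apply Subtype.ext
    funext y
    have h1 : (((∑ i, w i : TestFn 𝓘(ℝ, Eucl n) M) : TestFn 𝓘(ℝ, Eucl n) M) : M → ℂ) y
        = ∑ i, (f i y : ℂ) * v y := by
      rw [Submodule.coe_sum, Finset.sum_apply]
    rw [h1, ← Finset.sum_mul]
    by_cases hy : y ∈ tsupport v
    · have h2 := f.sum_eq_one hy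
      rw [finsum_eq_sum_of_fintype] at h2
      rw [← Complex.ofReal_sum, h2, Complex.ofReal_one, one_mul]
    · rw [image_eq_zero_of_notMem_tsupport hy, mul_zero]
  have hAw : ∀ i, A (w i) x = ∫ y, k (x, y) (x, y) * w i y ∂(volumeMeasure g) := by
    intro i
    rw [hA (x, i) (w i) (hw i) x (hp₁ (x, i))]
    congr 1; funext y
    by_cases hy : y ∈ tsupport (w i)
    · rw [hagree (x, i) (x, y) ⟨hp₁ (x, i), hw i hy⟩]
    · rw [image_eq_zero_of_notMem_tsupport hy, mul_zero, mul_zero]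
  have hkc : Continuous fun y => k (x, y) (x, y) := hsm.continuous.comp (by fun_prop)
  have hA1 : A v x = ∑ i, A (w i) x := by
    conv_lhs => rw [hsum]
    rw [map_sum, Submodule.coe_sum, Finset.sum_apply]
  rw [hA1, Finset.sum_congr rfl fun i _ => hAw i, ← integral_finsetSum _ fun i _ =>
    integrable_test g (w i) isOpen_univ hkc.continuousOn (subset_univ _)]
  congr 1; funext y
  rw [← Finset.mul_sum]
  congr 1
  have h1 : (v : M → ℂ) y = ((∑ i, w i : TestFn 𝓘(ℝ, Eucl n) M) : M → ℂ) y := by rw [← hsum]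
  rw [h1, Submodule.coe_sum, Finset.sum_apply]

end Kernel

/-! ## Microlocal regularity of the difference of two-point functions -/

section Difference

theorem CCR.psi_mul_psiStar {V : Type*} [AddCommGroup V] [Module ℂ V] (q : V → V → ℂ) (v w : V) :
    CCR.psi q v * CCR.psiStar q w
      = CCR.psiStar q w * CCR.psi q v + algebraMap ℂ (CCR.Alg q) (q v w) := by
  have h := RingQuot.mkAlgHom_rel ℂ (CCR.Rel.comm_psi_psiStar (q := q) v w)
  rw [map_sub, map_mul, map_mul, AlgHom.commutes] at h
  rw [← h, CCR.psi, CCR.psiStar, add_sub_cancel]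

variable {n : ℕ} {M : Type*} [TopologicalSpace M] [ChartedSpace (Eucl n) M]
  [IsManifold 𝓘(ℝ, Eucl n) ω M] [T2Space M]

/-- The derivative of the inverse of the product chart at `p`. -/
def chartSymmDeriv (p : M × M) : Eucl n × Eucl n →L[ℝ] Eucl n × Eucl n :=
  mfderiv 𝓘(ℝ, Eucl n × Eucl n) (𝓘(ℝ, Eucl n).prod 𝓘(ℝ, Eucl n))
    (extChartAt (𝓘(ℝ, Eucl n).prod 𝓘(ℝ, Eucl n)) p).symm
    (extChartAt (𝓘(ℝ, Eucl n).prod 𝓘(ℝ, Eucl n)) p p)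

/-- The covector `(ξ₁, -ξ₂)` of `M × M` in the product chart. -/
def chartCovector (p : M × M) (ξ₁ ξ₂ : Eucl n →L[ℝ] ℝ) : Eucl n × Eucl n →L[ℝ] ℝ :=
  (ξ₁ ∘L ContinuousLinearMap.fst ℝ (Eucl n) (Eucl n)
    - ξ₂ ∘L ContinuousLinearMap.snd ℝ (Eucl n) (Eucl n)) ∘L chartSymmDeriv p

theorem exists_inverse_chartSymmDeriv (p : M × M) :
    ∃ A : Eucl n × Eucl n →L[ℝ] Eucl n × Eucl n,
      A ∘L chartSymmDeriv p = ContinuousLinearMap.id ℝ _ ∧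
      chartSymmDeriv p ∘L A = ContinuousLinearMap.id ℝ _ := by
  have : IsManifold (𝓘(ℝ, Eucl n).prod 𝓘(ℝ, Eucl n)) 1 (M × M) :=
    IsManifold.of_le (n := ω) le_top
  have h1 := mfderiv_extChartAt_comp_mfderivWithin_extChartAt_symm'
    (I := 𝓘(ℝ, Eucl n).prod 𝓘(ℝ, Eucl n)) (mem_extChartAt_source p)
  have h2 := mfderivWithin_extChartAt_symm_comp_mfderiv_extChartAt'
    (I := 𝓘(ℝ, Eucl n).prod 𝓘(ℝ, Eucl n)) (mem_extChartAt_source p)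
  rw [ModelWithCorners.range_eq_univ, mfderivWithin_univ] at h1 h2
  exact ⟨_, h1, h2⟩

/-- The chart differential is invertible and the test vector `(v, 0)` sees only the first component,
so `ξ₂` may be arbitrary, in particular zero. -/
theorem chartCovector_ne_zero (p : M × M) {ξ₁ ξ₂ : Eucl n →L[ℝ] ℝ} (h : ξ₁ ≠ 0) :
    chartCovector p ξ₁ ξ₂ ≠ 0 := by
  obtain ⟨A, -, hA⟩ := exists_inverse_chartSymmDeriv (n := n) p
  intro h0
  refine h (ContinuousLinearMap.ext fun v => ?_)
  have h1 := congrArg (fun l => l (A (v, 0))) h0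
  have h2 : chartSymmDeriv p (A (v, 0)) = (v, 0) := congrArg (fun l => l (v, (0 : Eucl n))) hA
  simpa [chartCovector, h2] using h1

theorem exists_chartCovector_eq (p : M × M) (η : Eucl n × Eucl n →L[ℝ] ℝ) :
    ∃ ξ₁ ξ₂, chartCovector p ξ₁ ξ₂ = η := by
  obtain ⟨A, hA, -⟩ := exists_inverse_chartSymmDeriv (n := n) p
  refine ⟨(η ∘L A) ∘L ContinuousLinearMap.inl ℝ (Eucl n) (Eucl n),
    -((η ∘L A) ∘L ContinuousLinearMap.inr ℝ (Eucl n) (Eucl n)), ?_⟩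
  have h : ((η ∘L A) ∘L ContinuousLinearMap.inl ℝ (Eucl n) (Eucl n)) ∘L
      ContinuousLinearMap.fst ℝ (Eucl n) (Eucl n)
      - (-((η ∘L A) ∘L ContinuousLinearMap.inr ℝ (Eucl n) (Eucl n))) ∘L
      ContinuousLinearMap.snd ℝ (Eucl n) (Eucl n) = η ∘L A := by
    refine ContinuousLinearMap.ext fun v => ?_
    show (η ∘L A) (v.1, 0) - -((η ∘L A) (0, v.2)) = (η ∘L A) v
    rw [sub_neg_eq_add, ← map_add, Prod.mk_add_mk, add_zero, zero_add]
  rw [chartCovector, h, ContinuousLinearMap.comp_assoc, hA, ContinuousLinearMap.comp_id]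

/-- The minus sign in `chartCovector` is the one of the primed set, and the differentials of the two
projections are the linear projections. The wave front condition is thus literally a statement about
this covector. -/
theorem isMicroAnalyticAt_of_notMem
    {K : ManifoldDistribution (𝓘(ℝ, Eucl n).prod 𝓘(ℝ, Eucl n)) (M × M)} {p : M × M}
    {ξ₁ ξ₂ : Eucl n →L[ℝ] ℝ} (hξ : chartCovector p ξ₁ ξ₂ ≠ 0)
    (h : ((⟨p.1, ξ₁⟩, ⟨p.2, ξ₂⟩) :
      Cotangent 𝓘(ℝ, Eucl n) M × Cotangent 𝓘(ℝ, Eucl n) M) ∉ primed K.WFa) :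
    IsMicroAnalyticAt (K.inChart p) (extChartAt (𝓘(ℝ, Eucl n).prod 𝓘(ℝ, Eucl n)) p p)
      (chartCovector p ξ₁ ξ₂) := by
  by_contra hc
  refine h ?_
  show _ ≠ 0 ∧ ¬ _
  rw [mfderiv_fst, mfderiv_snd]
  refine ⟨fun h0 => hξ ?_, hc⟩
  rw [chartCovector]
  exact (congrArg (fun l : Eucl n × Eucl n →L[ℝ] ℝ => l ∘L _) h0).trans
    (ContinuousLinearMap.zero_comp _)

theorem isWedgeSumAt_chartDiff
    {K K' : ManifoldDistribution (𝓘(ℝ, Eucl n).prod 𝓘(ℝ, Eucl n)) (M × M)} {p : M × M}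
    {ξ₁ ξ₂ : Eucl n →L[ℝ] ℝ} (hξ : chartCovector p ξ₁ ξ₂ ≠ 0)
    (h : ((⟨p.1, ξ₁⟩, ⟨p.2, ξ₂⟩) :
      Cotangent 𝓘(ℝ, Eucl n) M × Cotangent 𝓘(ℝ, Eucl n) M) ∉ primed K.WFa ∪ primed K'.WFa) :
    IsWedgeSumAt (chartDiff K K' p) (extChartAt (𝓘(ℝ, Eucl n).prod 𝓘(ℝ, Eucl n)) p p)
      (chartCovector p ξ₁ ξ₂) := by
  rw [mem_union, not_or] at h
  exact (isWedgeSumAt_of_isMicroAnalyticAt hξ (isMicroAnalyticAt_of_notMem hξ h.1)).sub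
    (isWedgeSumAt_of_isMicroAnalyticAt hξ (isMicroAnalyticAt_of_notMem hξ h.2))

theorem disjoint_upperShell_lowerShell {g : LorentzMetric n M} (τ : TimeOrientation g) :
    Disjoint (upperShell τ) (lowerShell τ) := by
  refine Set.disjoint_left.2 fun X hX hX' => ?_
  have h1 := hX.2 (τ.field X.1) ⟨τ.timelike _, τ.timelike _⟩
  have h2 := hX'.2 (-τ.field X.1) ⟨by simpa using τ.timelike _, by simpa using τ.timelike _⟩
  rw [map_neg] at h2
  linarith

/-- Two pairs of two-point functions with the same difference, whose wave front sets lie in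
opposite energy shells, differ by a sum of boundary values for every codirection. -/
theorem isWedgeSumAt_chartDiff_of_shell {g : LorentzMetric n M} (τ : TimeOrientation g)
    {K₁ K₁' K₂ K₂' : ManifoldDistribution (𝓘(ℝ, Eucl n).prod 𝓘(ℝ, Eucl n)) (M × M)}
    (hK : ∀ u v : TestFn 𝓘(ℝ, Eucl n) M, K₁.toLin (tensorConj u v) - K₁'.toLin (tensorConj u v)
      = K₂.toLin (tensorConj u v) - K₂'.toLin (tensorConj u v))
    (h₁ : primed K₁.WFa ∪ primed K₁'.WFa ⊆ upperShell τ ×ˢ upperShell τ)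
    (h₂ : primed K₂.WFa ∪ primed K₂'.WFa ⊆ lowerShell τ ×ˢ lowerShell τ) (p : M × M)
    {η : Eucl n × Eucl n →L[ℝ] ℝ} (hη : η ≠ 0) :
    IsWedgeSumAt (chartDiff K₁ K₁' p) (extChartAt (𝓘(ℝ, Eucl n).prod 𝓘(ℝ, Eucl n)) p p) η := by
  have := g.nontrivial p.1
  obtain ⟨ξ₁, ξ₂, rfl⟩ := exists_chartCovector_eq p η
  by_cases hmem : ((⟨p.1, ξ₁⟩, ⟨p.2, ξ₂⟩) :
      Cotangent 𝓘(ℝ, Eucl n) M × Cotangent 𝓘(ℝ, Eucl n) M) ∈ primed K₁.WFa ∪ primed K₁'.WFa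
  · have hmem' := fun h => Set.disjoint_left.1 (disjoint_upperShell_lowerShell τ)
      (h₁ hmem).1 (h₂ h).1
    obtain ⟨v, hv⟩ := exists_ne (0 : Eucl n)
    obtain ⟨ξ, hξ⟩ : ∃ ξ : Eucl n →L[ℝ] ℝ, ξ ≠ 0 :=
      ⟨innerSL ℝ v, fun h => hv ((inner_self_eq_zero (𝕜 := ℝ)).1 (congrArg (fun l => l v) h))⟩
    have hne : chartCovector p ξ 0 ≠ 0 := chartCovector_ne_zero p hξ
    -- To transfer the representation, the two differences must agree near the point on all test
    -- functions. This uses the covector `(ξ, 0)`: shells contain no zero covectors, so it is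
    -- regular for both pairs and both are sums of boundary values there.
    obtain ⟨σ, hσ, heq⟩ := chartDiff_eq_of_tensor hK p
      (isWedgeSumAt_chartDiff hne fun h => (h₁ h).2.1.1 rfl)
      (isWedgeSumAt_chartDiff hne fun h => (h₂ h).2.1.1 rfl)
    exact (isWedgeSumAt_chartDiff hη hmem').congr hσ heq
  · exact isWedgeSumAt_chartDiff hη hmem

variable [SecondCountableTopology M] [Nonempty M] [MeasurableSpace M] [BorelSpace M]

theorem pairing_sub (g : LorentzMetric n M) (A B : Op n M) (u v : TestFn 𝓘(ℝ, Eucl n) M) :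
    pairing g u ((A - B) v) = pairing g u (A v) - pairing g u (B v) := by
  have hi : ∀ C : Op n M, Integrable (fun x => conj (u x) * C v x) (volumeMeasure g) := fun C => by
    have := isLocallyFiniteMeasure_volumeMeasure g
    have hc : Continuous (C v) := (C v).2.continuous
    have hs : HasCompactSupport fun x => conj (u x) * C v x := by
      refine HasCompactSupport.mul_right (f := fun x => conj (u x)) ?_
      exact u.2.2.comp_left (g := fun z : ℂ => conj z) (map_zero _)
    exact ((Complex.continuous_conj.comp u.2.1.continuous).mul hc).integrable_of_hasCompactSupport
      hs
  rw [pairing, pairing, pairing, ← integral_sub (hi A) (hi B)]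
  congr 1
  funext x
  show conj (u x) * (A v x - B v x) = _
  ring

/-- An operator whose Schwartz kernel is a difference of two-point functions as above has an
analytic kernel. -/
theorem hasAnalyticKernel_of_shell {g : LorentzMetric n M} (τ : TimeOrientation g)
    {A : Op n M} {K₁ K₁' K₂ K₂' : ManifoldDistribution (𝓘(ℝ, Eucl n).prod 𝓘(ℝ, Eucl n)) (M × M)}
    (hA : ∀ u v : TestFn 𝓘(ℝ, Eucl n) M, pairing g u (A v)
      = K₁.toLin (tensorConj u v) - K₁'.toLin (tensorConj u v))
    (hK : ∀ u v : TestFn 𝓘(ℝ, Eucl n) M, K₁.toLin (tensorConj u v) - K₁'.toLin (tensorConj u v)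
      = K₂.toLin (tensorConj u v) - K₂'.toLin (tensorConj u v))
    (h₁ : primed K₁.WFa ∪ primed K₁'.WFa ⊆ upperShell τ ×ˢ upperShell τ)
    (h₂ : primed K₂.WFa ∪ primed K₂'.WFa ⊆ lowerShell τ ×ˢ lowerShell τ) :
    HasAnalyticKernel g A :=
  hasAnalyticKernel_of_local g fun p => exists_local_kernel g hA p fun _ hη =>
    isWedgeSumAt_chartDiff_of_shell τ hK h₁ h₂ p hη

end Difference

end

theorem mainTheorem8 {n : ℕ} {M : Type*} [TopologicalSpace M] [T2Space M]
    [SecondCountableTopology M] [ConnectedSpace M] [MeasurableSpace M] [BorelSpace M]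
    [ChartedSpace (Eucl n) M] [IsManifold 𝓘(ℝ, Eucl n) ω M]
    (g : LorentzMetric n M) (τ : TimeOrientation g) (hg : IsGloballyHyperbolic g)
    (V : M → ℝ) (hV : ContMDiff 𝓘(ℝ, Eucl n) 𝓘(ℝ, ℝ) ω V)
    (s s' : CCRP τ V →ₗ[ℂ] ℂ)
    (hs : IsAnalyticHadamard τ V s) (hs' : IsAnalyticHadamard τ V s')
    (Lp Lm Lp' Lm' : Op n M)
    (hL : IsCovariance τ V s Lp Lm) (hL' : IsCovariance τ V s' Lp' Lm') :
    HasAnalyticKernel g (Lp - Lp') ∧ HasAnalyticKernel g (Lm - Lm') := by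
  obtain ⟨hqf, Lp₀, Lm₀, hL₀, Kp, Km, hKp, hKm, wfp, wfm⟩ := hs
  obtain ⟨hqf', Lp₀', Lm₀', hL₀', Kp', Km', hKp', hKm', wfp', wfm'⟩ := hs'
  -- The commutator is the same scalar in both states, which are normalised, so it drops out of the
  -- difference.
  have hcomm : ∀ u v : TestFn 𝓘(ℝ, Eucl n) M, Kp.toLin (tensorConj u v)
      - Kp'.toLin (tensorConj u v) = Km.toLin (tensorConj u v) - Km'.toLin (tensorConj u v) := by
    intro u v
    rw [hKp, hKp', hKm, hKm', hL₀.plus, hL₀'.plus, hL₀.minus, hL₀'.minus, CCR.psi_mul_psiStar,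
      map_add, map_add, Algebra.algebraMap_eq_smul_one, map_smul, map_smul, hqf.map_one,
      hqf'.map_one, add_sub_add_right_eq_sub]
  -- The covariances in the Hadamard condition need not be the given operators; both have the same
  -- pairings, fixed by the state.
  have hp : ∀ u v : TestFn 𝓘(ℝ, Eucl n) M, pairing g u ((Lp - Lp') v)
      = Kp.toLin (tensorConj u v) - Kp'.toLin (tensorConj u v) := fun u v => by
    rw [pairing_sub, hKp, hKp', hL.plus, hL'.plus, hL₀.plus, hL₀'.plus]
  -- The minus difference is expressed through the plus kernels, so the same microlocal statement
  -- serves for both.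
  have hm : ∀ u v : TestFn 𝓘(ℝ, Eucl n) M, pairing g u ((Lm - Lm') v)
      = Kp.toLin (tensorConj u v) - Kp'.toLin (tensorConj u v) := fun u v => by
    rw [hcomm, pairing_sub, hKm, hKm', hL.minus, hL'.minus, hL₀.minus, hL₀'.minus]
  exact ⟨hasAnalyticKernel_of_shell τ hp hcomm (union_subset wfp wfp') (union_subset wfm wfm'),
    hasAnalyticKernel_of_shell τ hm hcomm (union_subset wfp wfp') (union_subset wfm wfm')⟩
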